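/- Let $p\geq 3$ be a prime and let $V$ be an $\mathbf{F}_p$-vector space of dimension $2\sigma_0$ equipped with a non-degenerate symmetric bilinear form which is non-neutral, i.e. there is no totally isotropic subspace of $V$ of dimension $\sigma_0$. For a scheme $S$ over $\mathbf{F}_p$, let $F_S^*$ be the map $v\otimes s\mapsto v\otimes s^p$ on $V\otimes\mathcal{O}_S$, and for a submodule $K\subset V\otimes\mathcal{O}_S$ let $F_S^*K$ also denote the submodule generated by its image. A characteristic subspace of $V\otimes\mathcal{O}_S$ is a totally isotropic $\mathcal{O}_S$-submodule $K\subset V\otimes\mathcal{O}_S$ such that $K$ and $K+F_S^*K$ are locally free of ranks $\sigma_0$ and $\sigma_0+1$ respectively, and both are locally direct summands of $V\otimes\mathcal{O}_S$. Let $M_V$ be the functor sending an $\mathbf{F}_p$-scheme $S$ to the set of characteristic subspaces of $V\otimes\mathcal{O}_S$. Then $M_V$ is representable by an $\mathbf{F}_p$-scheme, and every connected component $C$ of $M_V\otimes_{\mathbf{F}_p}\mathbf{F}_{p^2}$ is open and, with its open subscheme structure, is purely inseparably unirational over $\mathbf{F}_{p^2}$; that is, $C$ is integral and for some $n\geq 0$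 there is a dominant rational map $\mathbf{A}^n_{\mathbf{F}_{p^2}}\dashrightarrow C$ over $\mathbf{F}_{p^2}$ for which the induced extension of function fields $\mathbf{F}_{p^2}(C)\subset\mathbf{F}_{p^2}(t_1,\dots,t_n)$ is purely inseparable (hence also finite). -/

import Mathlib

open CategoryTheory CategoryTheory.Limits AlgebraicGeometry TopologicalSpace
open scoped TensorProduct

noncomputable section

namespace PeriodSpace

/-! ## `𝔽_p`-schemes and the sheaf `V ⊗ 𝒪_S` -/

/-- Schemes over `𝔽_p`. -/
abbrev FpScheme (p : ℕ) [Fact p.Prime] := Over (Spec (CommRingCat.of (ZMod p)))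

variable {p : ℕ} [Fact p.Prime]

/-- The sections of the structure sheaf of an `𝔽_p`-scheme form an `𝔽_p`-algebra. -/
instance sectionAlgebra (S : FpScheme p) (U : S.left.Opens) : Algebra (ZMod p) Γ(S.left, U) :=
  ((Scheme.ΓSpecIso (CommRingCat.of (ZMod p))).inv ≫ S.hom.appTop ≫
    S.left.presheaf.map (homOfLE le_top : U ⟶ ⊤).op).hom.toAlgebra

/-- The additive map `A ⊗ V → A' ⊗ V`, `a ⊗ v ↦ f a ⊗ v`, induced by a homomorphism `f : A → A'`
between `𝔽_p`-algebras (such an `f` is automatically `𝔽_p`-linear). -/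
def mapCoeff (V : Type*) [AddCommGroup V] [Module (ZMod p) V] {A A' : Type*} [CommRing A]
    [CommRing A'] [Algebra (ZMod p) A] [Algebra (ZMod p) A'] (f : A →+* A') :
    A ⊗[ZMod p] V →ₗ[ZMod p] A' ⊗[ZMod p] V :=
  LinearMap.rTensor V (f.toAddMonoidHom.toZModLinearMap p)

/-- The Frobenius map `A ⊗ V → A ⊗ V`, `a ⊗ v ↦ a ^ p ⊗ v`. -/
def frob (V : Type*) [AddCommGroup V] [Module (ZMod p) V] (A : Type*) [CommRing A]
    [Algebra (ZMod p) A] : A ⊗[ZMod p] V →ₗ[ZMod p] A ⊗[ZMod p] V :=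
  LinearMap.rTensor V (FiniteField.frobeniusAlgHom (ZMod p) A).toLinearMap

/-- The sections over `U` of `V ⊗ 𝒪_S` (for a finite-dimensional vector space `V`). -/
abbrev Sec (S : FpScheme p) (V : Type*) [AddCommGroup V] [Module (ZMod p) V]
    (U : S.left.Opens) := Γ(S.left, U) ⊗[ZMod p] V

/-- Restriction of sections of `V ⊗ 𝒪_S` to a smaller open subset. -/
def Sec.res {S : FpScheme p} {V : Type*} [AddCommGroup V] [Module (ZMod p) V]
    {U W : S.left.Opens} (h : W ≤ U) : Sec S V U →ₗ[ZMod p] Sec S V W :=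
  mapCoeff V (S.left.presheaf.map (homOfLE h).op).hom

/-- Pullback of sections of `V ⊗ 𝒪_T` along a morphism `f : S ⟶ T`. -/
def Sec.pull {S T : FpScheme p} (f : S ⟶ T) {V : Type*} [AddCommGroup V] [Module (ZMod p) V]
    (U : T.left.Opens) : Sec T V U →ₗ[ZMod p] Sec S V (f.left ⁻¹ᵁ U) :=
  mapCoeff V (f.left.app U).hom

/-! ## `𝒪_S`-submodules of `V ⊗ 𝒪_S` -/

/-- An `𝒪_S`-submodule (subsheaf of modules) of `V ⊗ 𝒪_S`. -/
@[ext]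
structure Submod (S : FpScheme p) (V : Type*) [AddCommGroup V] [Module (ZMod p) V] where
  /-- The sections over an open subset. -/
  obj : ∀ U : S.left.Opens, Submodule Γ(S.left, U) (Sec S V U)
  res_mem : ∀ {U W : S.left.Opens} (h : W ≤ U) {s : Sec S V U}, s ∈ obj U → Sec.res h s ∈ obj W
  mem_of_local : ∀ {U : S.left.Opens} {s : Sec S V U},
    (∀ x ∈ U, ∃ (W : S.left.Opens) (h : W ≤ U), x ∈ W ∧ Sec.res h s ∈ obj W) → s ∈ obj U

namespace Submod

variable {S T : FpScheme p} {V : Type*} [AddCommGroup V] [Module (ZMod p) V]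

/-- The intersection of a set of submodules. -/
instance : InfSet (Submod S V) where
  sInf P :=
    { obj := fun U => ⨅ K ∈ P, K.obj U
      res_mem := fun h s hs => by
        simp only [Submodule.mem_iInf] at hs ⊢
        exact fun K hK => K.res_mem h (hs K hK)
      mem_of_local := fun {U} s hs => by
        simp only [Submodule.mem_iInf] at hs ⊢
        intro K hK
        refine K.mem_of_local fun x hx => ?_
        obtain ⟨W, h, hxW, hW⟩ := hs x hx
        exact ⟨W, h, hxW, hW K hK⟩ }

/-- `f^*K`, as a submodule of `f^*(V ⊗ 𝒪_T) = V ⊗ 𝒪_S`: the smallest `𝒪_S`-submodule that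
contains the pullbacks of all the local sections of `K`. -/
def pullback (f : S ⟶ T) (K : Submod T V) : Submod S V :=
  sInf {L | ∀ (U : T.left.Opens), ∀ s ∈ K.obj U, Sec.pull f U s ∈ L.obj (f.left ⁻¹ᵁ U)}

/-- `K + F_S^*K`: the smallest `𝒪_S`-submodule that contains the local sections of `K` and their
images under the Frobenius map of `V ⊗ 𝒪_S`. -/
def addFrob (K : Submod S V) : Submod S V :=
  sInf {L | ∀ (U : S.left.Opens), ∀ s ∈ K.obj U, s ∈ L.obj U ∧ frob V Γ(S.left, U) s ∈ L.obj U}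

/-- `K` is locally free of rank `r`: locally on `S` there are `r` sections of `K` which form a
basis of `K` (also after restriction to every smaller open subset). -/
def IsLocallyFreeOfRank (K : Submod S V) (r : ℕ) : Prop :=
  ∀ x : S.left, ∃ U : S.left.Opens, x ∈ U ∧ ∃ e : Fin r → Sec S V U,
    ∀ (W : S.left.Opens) (h : W ≤ U),
      LinearIndependent Γ(S.left, W) (fun i => Sec.res h (e i)) ∧
      Submodule.span Γ(S.left, W) (Set.range fun i => Sec.res h (e i)) = K.obj W

/-- `K` is locally a direct summand of `V ⊗ 𝒪_S`. -/
def IsLocallyDirectSummand (K : Submod S V) : Prop :=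
  ∀ x : S.left, ∃ U : S.left.Opens, x ∈ U ∧ ∃ C : Submod S V,
    ∀ W : S.left.Opens, W ≤ U → IsCompl (K.obj W) (C.obj W)

/-- `K` is totally isotropic for the `𝒪_S`-bilinear extension of the form `B` on `V`. -/
def IsTotallyIsotropic (B : LinearMap.BilinForm (ZMod p) V) (K : Submod S V) : Prop :=
  ∀ U : S.left.Opens, ∀ s ∈ K.obj U, ∀ t ∈ K.obj U, B.baseChange Γ(S.left, U) s t = 0

/-- Characteristic subspaces of `V ⊗ 𝒪_S`, where `V` has dimension `2 * σ`. -/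
structure IsCharacteristic (B : LinearMap.BilinForm (ZMod p) V) (σ : ℕ) (K : Submod S V) :
    Prop where
  isotropic : K.IsTotallyIsotropic B
  locallyFree : K.IsLocallyFreeOfRank σ
  summand : K.IsLocallyDirectSummand
  locallyFree_addFrob : K.addFrob.IsLocallyFreeOfRank (σ + 1)
  summand_addFrob : K.addFrob.IsLocallyDirectSummand

end Submod

/-! ## The period space -/

/-- The `𝔽_p`-scheme `M`, with the tautological characteristic subspace `K` of `V ⊗ 𝒪_M`,
represents the functor `M_V` which sends an `𝔽_p`-scheme `S` to the set of characteristic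
subspaces of `V ⊗ 𝒪_S`. -/
structure IsPeriodSpace {V : Type*} [AddCommGroup V] [Module (ZMod p) V]
    (B : LinearMap.BilinForm (ZMod p) V) (σ : ℕ) (M : FpScheme p) (K : Submod M V) : Prop where
  isCharacteristic : K.IsCharacteristic B σ
  existsUnique : ∀ (S : FpScheme p) (L : Submod S V), L.IsCharacteristic B σ →
    ∃! f : S ⟶ M, K.pullback f = L

/-- A bilinear form on a space of dimension `2 * σ` is neutral if there is a totally isotropic
subspace of dimension `σ`. -/
def IsNeutral {V : Type*} [AddCommGroup V] [Module (ZMod p) V]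
    (B : LinearMap.BilinForm (ZMod p) V) (σ : ℕ) : Prop :=
  ∃ W : Submodule (ZMod p) V, Module.finrank (ZMod p) W = σ ∧ ∀ x ∈ W, ∀ y ∈ W, B x y = 0

/-- The base change `M ⊗_{𝔽_p} 𝔽_{p²}`. -/
abbrev baseChangeFpSq (M : FpScheme p) : Scheme :=
  Limits.pullback M.hom
    (Spec.map (CommRingCat.ofHom (algebraMap (ZMod p) (GaloisField p 2))))

/-- The structure morphism `M ⊗_{𝔽_p} 𝔽_{p²} ⟶ Spec 𝔽_{p²}`. -/
abbrev baseChangeFpSqHom (M : FpScheme p) :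
    baseChangeFpSq M ⟶ Spec (CommRingCat.of (GaloisField p 2)) :=
  Limits.pullback.snd M.hom
    (Spec.map (CommRingCat.ofHom (algebraMap (ZMod p) (GaloisField p 2))))

/-- A scheme `X` over a field `k` is purely inseparably unirational over `k` if it is integral and
for some `n` there is a dominant rational map `f` of `k`-schemes from affine `n`-space over `k`
to `X` for which the field extension `φ : k(X) → k(𝔸ⁿ)` induced by `f` is purely
inseparable. (Then `φ` is finite, because `k(𝔸ⁿ)` is finitely generated over `k`;
so `f` is generically finite.) -/
def IsPurelyInseparablyUnirational {k : Type} [Field k] {X : Scheme}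
    (sX : X ⟶ Spec (CommRingCat.of k)) : Prop :=
  ∃ _ : IsIntegral X, ∃ (n : ℕ) (f : 𝔸(Fin n; Spec (CommRingCat.of k)) ⤏ X),
    f.compHom sX =
      (𝔸(Fin n; Spec (CommRingCat.of k)) ↘ Spec (CommRingCat.of k)).toRationalMap ∧
    f.IsDominant ∧
    ∃ φ : X.functionField ⟶ 𝔸(Fin n; Spec (CommRingCat.of k)).functionField,
      f.fromFunctionField = Spec.map φ ≫ X.fromSpecStalk (genericPoint X) ∧
      φ.hom.IsPurelyInseparable

end PeriodSpace

end

noncomputable section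

namespace PeriodSpace

variable {p : ℕ} [Fact p.Prime]

/-! ## Coordinates -/

section Coefficients

variable {V : Type*} [AddCommGroup V] [Module (ZMod p) V]
variable {A A' A'' : Type*} [CommRing A] [CommRing A'] [CommRing A'']
  [Algebra (ZMod p) A] [Algebra (ZMod p) A'] [Algebra (ZMod p) A'']

theorem mapCoeff_tmul (f : A →+* A') (a : A) (v : V) :
    mapCoeff V f (a ⊗ₜ[ZMod p] v) = f a ⊗ₜ v := rfl

theorem frob_tmul (a : A) (v : V) : frob V A (a ⊗ₜ[ZMod p] v) = (a ^ p) ⊗ₜ v := by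
  simp [frob, FiniteField.frobeniusAlgHom_apply, ZMod.card]

theorem mapCoeff_smul (f : A →+* A') (a : A) (s : A ⊗[ZMod p] V) :
    mapCoeff V f (a • s) = f a • mapCoeff V f s := by
  induction s with
  | zero => simp
  | tmul x v => simp [mapCoeff_tmul, TensorProduct.smul_tmul']
  | add x y hx hy => simp [hx, hy]

theorem mapCoeff_mapCoeff (f : A →+* A') (g : A' →+* A'') (s : A ⊗[ZMod p] V) :
    mapCoeff V g (mapCoeff V f s) = mapCoeff V (g.comp f) s := by
  induction s with
  | zero => simp
  | tmul x v => simp [mapCoeff_tmul]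
  | add x y hx hy => simp [hx, hy]

theorem mapCoeff_id (s : A ⊗[ZMod p] V) : mapCoeff V (RingHom.id A) s = s := by
  induction s with
  | zero => simp
  | tmul x v => simp [mapCoeff_tmul]
  | add x y hx hy => simp [hx, hy]

theorem frob_mapCoeff (f : A →+* A') (s : A ⊗[ZMod p] V) :
    frob V A' (mapCoeff V f s) = mapCoeff V f (frob V A s) := by
  induction s with
  | zero => simp
  | tmul x v => simp [mapCoeff_tmul, frob_tmul]
  | add x y hx hy => simp [hx, hy]

variable {J : Type*} [Fintype J]

/-- The coordinates of an element of `A ⊗ V` with respect to a basis of `V`. -/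
def crd (b : Module.Basis J (ZMod p) V) (A : Type*) [CommRing A] [Algebra (ZMod p) A] :
    A ⊗[ZMod p] V ≃ₗ[A] (J → A) :=
  (b.baseChange A).equivFun

theorem crd_tmul (b : Module.Basis J (ZMod p) V) (a : A) (v : V) (j : J) :
    crd b A (a ⊗ₜ v) j = b.repr v j • a := by
  simp [crd, Module.Basis.baseChange]

theorem crd_mapCoeff (b : Module.Basis J (ZMod p) V) (f : A →+* A') (s : A ⊗[ZMod p] V) :
    crd b A' (mapCoeff V f s) = f ∘ crd b A s := by
  have hf (n : ZMod p) (a : A) : f (n • a) = n • f a :=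
    map_smul (f.toAddMonoidHom.toZModLinearMap p) n a
  ext j
  induction s with
  | zero => simp
  | tmul x v => simp [mapCoeff_tmul, crd_tmul, hf]
  | add x y hx hy => simp_all

theorem add_pow_prime (x y : A) : (x + y) ^ p = x ^ p + y ^ p := by
  simpa [ZMod.card] using map_add (FiniteField.frobeniusAlgHom (ZMod p) A) x y

theorem crd_frob (b : Module.Basis J (ZMod p) V) (s : A ⊗[ZMod p] V) (j : J) :
    crd b A (frob V A s) j = crd b A s j ^ p := by
  induction s with
  | zero => simp [(Fact.out : p.Prime).ne_zero]
  | tmul x v => simp [frob_tmul, crd_tmul, smul_pow, ZMod.pow_card]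
  | add x y hx hy => simp [hx, hy, add_pow_prime]

theorem crd_symm_apply (b : Module.Basis J (ZMod p) V) (c : J → A) :
    (crd b A).symm c = ∑ j, c j ⊗ₜ b j := by
  rw [LinearEquiv.symm_apply_eq]
  classical
  ext j
  simp [crd_tmul, Finsupp.single_apply]

theorem baseChange_eq_sum (b : Module.Basis J (ZMod p) V) (B : LinearMap.BilinForm (ZMod p) V)
    (s t : A ⊗[ZMod p] V) :
    B.baseChange A s t = ∑ i, ∑ j, crd b A s i * crd b A t j * algebraMap (ZMod p) A (B (b i) (b j)) := by
  conv_lhs => rw [← (crd b A).symm_apply_apply s, ← (crd b A).symm_apply_apply t]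
  rw [crd_symm_apply, crd_symm_apply, LinearMap.BilinForm.sum_left]
  simp only [LinearMap.BilinForm.sum_right, LinearMap.BilinForm.baseChange_tmul, Algebra.smul_def]
  exact Finset.sum_congr rfl fun i _ ↦ Finset.sum_congr rfl fun j _ ↦ by ring

end Coefficients

/-! ## Restriction and pullback of sections -/

section Sections

variable {S T R : FpScheme p} {V : Type*} [AddCommGroup V] [Module (ZMod p) V]

/-- Restriction of functions to a smaller open subset. -/
abbrev rs {U W : S.left.Opens} (h : W ≤ U) : Γ(S.left, U) →+* Γ(S.left, W) :=
  (S.left.presheaf.map (homOfLE h).op).hom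

theorem rs_rs {U W W' : S.left.Opens} (h : W ≤ U) (h' : W' ≤ W) (a : Γ(S.left, U)) :
    rs h' (rs h a) = rs (h'.trans h) a := by
  rw [← CommRingCat.comp_apply, ← Functor.map_comp]; rfl

theorem rs_comp_rs {U W W' : S.left.Opens} (h : W ≤ U) (h' : W' ≤ W) :
    (rs h').comp (rs h) = rs (h'.trans h) :=
  RingHom.ext (rs_rs h h')

theorem rs_refl {U : S.left.Opens} : rs (le_refl U) = RingHom.id _ := by
  ext a
  exact congr($(S.left.presheaf.map_id (.op U)) a)

/-- Pullback of functions. -/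
abbrev pl (f : S ⟶ T) (U : T.left.Opens) : Γ(T.left, U) →+* Γ(S.left, f.left ⁻¹ᵁ U) :=
  (f.left.app U).hom

theorem preimage_le (f : S ⟶ T) {U W : T.left.Opens} (h : W ≤ U) :
    f.left ⁻¹ᵁ W ≤ f.left ⁻¹ᵁ U :=
  fun _ hx ↦ h hx

theorem pl_comp_rs (f : S ⟶ T) {U W : T.left.Opens} (h : W ≤ U) :
    (pl f W).comp (rs h) = (rs (preimage_le f h)).comp (pl f U) := by
  ext a
  exact congr($(f.left.naturality (homOfLE h).op) a)

theorem pl_rs (f : S ⟶ T) {U W : T.left.Opens} (h : W ≤ U) (a : Γ(T.left, U)) :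
    pl f W (rs h a) = rs (preimage_le f h) (pl f U a) :=
  congr($(pl_comp_rs f h) a)

theorem pl_comp (f : S ⟶ T) (g : T ⟶ R) (U : R.left.Opens) :
    pl (f ≫ g) U = (pl f (g.left ⁻¹ᵁ U)).comp (pl g U) := by
  ext a
  exact congr($(Scheme.Hom.comp_app f.left g.left U) a)

theorem pl_id (U : S.left.Opens) : pl (𝟙 S) U = RingHom.id _ := by
  ext a
  exact congr($(Scheme.Hom.id_app (X := S.left) U) a)

theorem Sec.res_smul {U W : S.left.Opens} (h : W ≤ U) (a : Γ(S.left, U)) (s : Sec S V U) :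
    Sec.res h (a • s) = rs h a • Sec.res h s :=
  mapCoeff_smul _ _ _

theorem Sec.res_res {U W W' : S.left.Opens} (h : W ≤ U) (h' : W' ≤ W) (s : Sec S V U) :
    Sec.res h' (Sec.res h s) = Sec.res (h'.trans h) s := by
  rw [Sec.res, Sec.res, mapCoeff_mapCoeff, rs_comp_rs]; rfl

theorem Sec.res_refl {U : S.left.Opens} (s : Sec S V U) : Sec.res (le_refl U) s = s := by
  exact congr(mapCoeff V $(rs_refl (U := U)) s).trans (mapCoeff_id s)

theorem Sec.pull_smul (f : S ⟶ T) {U : T.left.Opens} (a : Γ(T.left, U)) (s : Sec T V U) :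
    Sec.pull f U (a • s) = pl f U a • Sec.pull f U s :=
  mapCoeff_smul _ _ _

theorem Sec.pull_res (f : S ⟶ T) {U W : T.left.Opens} (h : W ≤ U) (s : Sec T V U) :
    Sec.pull f W (Sec.res h s) = Sec.res (preimage_le f h) (Sec.pull f U s) := by
  simp only [Sec.pull, Sec.res, mapCoeff_mapCoeff]
  rw [pl_comp_rs]

theorem Sec.pull_comp (f : S ⟶ T) (g : T ⟶ R) (U : R.left.Opens) (s : Sec R V U) :
    Sec.pull (f ≫ g) U s = Sec.pull f (g.left ⁻¹ᵁ U) (Sec.pull g U s) := by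
  exact congr(mapCoeff V $(pl_comp f g U) s).trans (mapCoeff_mapCoeff _ _ s).symm

theorem Sec.pull_id (U : S.left.Opens) (s : Sec S V U) : Sec.pull (𝟙 S) U s = s := by
  exact congr(mapCoeff V $(pl_id U) s).trans (mapCoeff_id s)

theorem Sec.frob_res {U W : S.left.Opens} (h : W ≤ U) (s : Sec S V U) :
    frob V _ (Sec.res h s) = Sec.res h (frob V _ s) :=
  frob_mapCoeff _ _

theorem Sec.frob_pull (f : S ⟶ T) {U : T.left.Opens} (s : Sec T V U) :
    frob V _ (Sec.pull f U s) = Sec.pull f U (frob V _ s) :=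
  frob_mapCoeff _ _

theorem frob_smul {A : Type*} [CommRing A] [Algebra (ZMod p) A] (a : A) (s : A ⊗[ZMod p] V) :
    frob V A (a • s) = a ^ p • frob V A s := by
  induction s with
  | zero => simp
  | tmul x v => simp [frob_tmul, TensorProduct.smul_tmul', mul_pow]
  | add x y hx hy => simp [hx, hy]

theorem section_ext_of_local {X : Scheme} {U : X.Opens} {a b : Γ(X, U)}
    (H : ∀ x ∈ U, ∃ (W : X.Opens) (h : W ≤ U), x ∈ W ∧
      X.presheaf.map (homOfLE h).op a = X.presheaf.map (homOfLE h).op b) : a = b := by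
  refine TopCat.Presheaf.section_ext X.sheaf U a b fun x hx ↦ ?_
  obtain ⟨W, h, hxW, e⟩ := H x hx
  have := congr(X.presheaf.germ W x hxW $e)
  rwa [TopCat.Presheaf.germ_res_apply, TopCat.Presheaf.germ_res_apply] at this

end Sections

/-! ## Submodules of `V ⊗ 𝒪_S` -/

namespace Submod

variable {S T R : FpScheme p} {V : Type*} [AddCommGroup V] [Module (ZMod p) V]

instance : PartialOrder (Submod S V) where
  le K L := ∀ U, K.obj U ≤ L.obj U
  le_refl K U := le_rfl
  le_trans K L M h h' U := (h U).trans (h' U)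
  le_antisymm K L h h' := Submod.ext (funext fun U ↦ le_antisymm (h U) (h' U))

theorem mem_sInf_obj {P : Set (Submod S V)} {U : S.left.Opens} {s : Sec S V U} :
    s ∈ (sInf P).obj U ↔ ∀ K ∈ P, s ∈ K.obj U := by
  change s ∈ (⨅ K ∈ P, K.obj U) ↔ _
  simp

theorem isGLB_sInf (P : Set (Submod S V)) : IsGLB P (sInf P) :=
  ⟨fun _ hK _ _ hs ↦ mem_sInf_obj.1 hs _ hK, fun _ hL U _ hs ↦
    mem_sInf_obj.2 fun _ hK ↦ hL hK U hs⟩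

theorem le_of_local {K L : Submod S V}
    (H : ∀ x : S.left, ∃ U : S.left.Opens, x ∈ U ∧ ∀ W ≤ U, K.obj W ≤ L.obj W) : K ≤ L := by
  intro U s hs
  refine L.mem_of_local fun x hx ↦ ?_
  obtain ⟨U', hxU', h⟩ := H x
  exact ⟨U ⊓ U', inf_le_left, ⟨hx, hxU'⟩, h _ inf_le_right (K.res_mem _ hs)⟩

theorem ext_of_local {K L : Submod S V}
    (H : ∀ x : S.left, ∃ U : S.left.Opens, x ∈ U ∧ ∀ W ≤ U, K.obj W = L.obj W) : K = L :=
  le_antisymm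
    (le_of_local fun x ↦ (H x).imp fun _ h ↦ ⟨h.1, fun W hW ↦ (h.2 W hW).le⟩)
    (le_of_local fun x ↦ (H x).imp fun _ h ↦ ⟨h.1, fun W hW ↦ (h.2 W hW).ge⟩)

/-- The largest submodule of `V ⊗ 𝒪_T` whose pullback is contained in `L`. -/
def pushforward (f : S ⟶ T) (L : Submod S V) : Submod T V where
  obj U :=
    { carrier := {s | Sec.pull f U s ∈ L.obj (f.left ⁻¹ᵁ U)}
      add_mem' := fun h h' ↦ by simpa using add_mem h h'
      zero_mem' := by simp
      smul_mem' := fun a s h ↦ by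
        simpa [Sec.pull_smul] using Submodule.smul_mem _ _ h }
  res_mem {U W} h s hs := by
    change Sec.pull f _ (Sec.res h s) ∈ L.obj (f.left ⁻¹ᵁ W)
    rw [Sec.pull_res]
    exact L.res_mem _ hs
  mem_of_local {U s} H := by
    refine L.mem_of_local fun x hx ↦ ?_
    obtain ⟨W, h, hxW, hW⟩ := H _ hx
    refine ⟨f.left ⁻¹ᵁ W, preimage_le f h, hxW, ?_⟩
    rw [← Sec.pull_res]
    exact hW

theorem mem_pushforward {f : S ⟶ T} {L : Submod S V} {U : T.left.Opens} {s : Sec T V U} :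
    s ∈ (pushforward f L).obj U ↔ Sec.pull f U s ∈ L.obj (f.left ⁻¹ᵁ U) := Iff.rfl

theorem pullback_le_iff {f : S ⟶ T} {K : Submod T V} {L : Submod S V} :
    K.pullback f ≤ L ↔ K ≤ pushforward f L := by
  constructor
  · intro h U s hs
    exact h _ (mem_sInf_obj.2 fun K' hK' ↦ hK' U s hs)
  · intro h
    exact (isGLB_sInf _).1 fun U s hs ↦ h U hs

theorem pull_mem_pullback (f : S ⟶ T) {K : Submod T V} {U : T.left.Opens} {s : Sec T V U}
    (hs : s ∈ K.obj U) : Sec.pull f U s ∈ (K.pullback f).obj (f.left ⁻¹ᵁ U) :=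
  pullback_le_iff.1 le_rfl U hs

theorem pullback_comp (f : S ⟶ T) (g : T ⟶ R) (K : Submod R V) :
    K.pullback (f ≫ g) = (K.pullback g).pullback f := by
  refine eq_of_forall_ge_iff fun L ↦ ?_
  rw [pullback_le_iff, pullback_le_iff, pullback_le_iff]
  refine forall_congr' fun U ↦ forall_congr' fun s ↦ imp_congr_right fun _ ↦ ?_
  rw [mem_pushforward, mem_pushforward, mem_pushforward, Sec.pull_comp]
  rfl

theorem pullback_id (K : Submod S V) : K.pullback (𝟙 S) = K := by
  refine eq_of_forall_ge_iff fun L ↦ ?_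
  rw [pullback_le_iff]
  refine forall_congr' fun U ↦ forall_congr' fun s ↦ imp_congr_right fun _ ↦ ?_
  rw [mem_pushforward, Sec.pull_id]
  rfl

/-- The largest submodule whose Frobenius twist is contained in `L`. -/
def frobPreimage (L : Submod S V) : Submod S V where
  obj U :=
    { carrier := {s | frob V _ s ∈ L.obj U}
      add_mem' := fun h h' ↦ by simpa using add_mem h h'
      zero_mem' := by simp
      smul_mem' := fun a s h ↦ by
        simpa [frob_smul] using Submodule.smul_mem _ _ h }
  res_mem {U W} h s hs := by
    change frob V _ (Sec.res h s) ∈ L.obj W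
    rw [Sec.frob_res]
    exact L.res_mem _ hs
  mem_of_local {U s} H := by
    refine L.mem_of_local fun x hx ↦ ?_
    obtain ⟨W, h, hxW, hW⟩ := H _ hx
    refine ⟨W, h, hxW, ?_⟩
    rw [← Sec.frob_res]
    exact hW

theorem mem_frobPreimage {L : Submod S V} {U : S.left.Opens} {s : Sec S V U} :
    s ∈ L.frobPreimage.obj U ↔ frob V _ s ∈ L.obj U := Iff.rfl

theorem addFrob_le_iff {K L : Submod S V} : K.addFrob ≤ L ↔ K ≤ L ∧ K ≤ L.frobPreimage := by
  constructor
  · intro h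
    exact ⟨fun U s hs ↦ h _ (mem_sInf_obj.2 fun K' hK' ↦ (hK' U s hs).1),
      fun U s hs ↦ h _ (mem_sInf_obj.2 fun K' hK' ↦ (hK' U s hs).2)⟩
  · intro h
    exact (isGLB_sInf _).1 fun U s hs ↦ ⟨h.1 U hs, h.2 U hs⟩

theorem le_addFrob (K : Submod S V) : K ≤ K.addFrob := (addFrob_le_iff.1 le_rfl).1

theorem frob_mem_addFrob {K : Submod S V} {U : S.left.Opens} {s : Sec S V U}
    (hs : s ∈ K.obj U) : frob V _ s ∈ K.addFrob.obj U :=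
  (addFrob_le_iff.1 le_rfl).2 U hs

theorem addFrob_pullback (f : S ⟶ T) (K : Submod T V) :
    (K.pullback f).addFrob = K.addFrob.pullback f := by
  refine eq_of_forall_ge_iff fun L ↦ ?_
  rw [addFrob_le_iff, pullback_le_iff, pullback_le_iff, pullback_le_iff, addFrob_le_iff]
  refine and_congr_right fun _ ↦ ?_
  refine forall_congr' fun U ↦ forall_congr' fun s ↦ imp_congr_right fun _ ↦ ?_
  rw [mem_pushforward, mem_frobPreimage, mem_frobPreimage, mem_pushforward, Sec.frob_pull]

end Submod

end PeriodSpace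

namespace PeriodSpace

variable {p : ℕ} [Fact p.Prime]

/-! ## Frames -/

namespace Submod

open Matrix

variable {S T R : FpScheme p} {V : Type*} [AddCommGroup V] [Module (ZMod p) V]
variable {J : Type*} [Fintype J] (b : Module.Basis J (ZMod p) V)

theorem crd_res {U W : S.left.Opens} (h : W ≤ U) (s : Sec S V U) :
    crd b _ (Sec.res h s) = rs h ∘ crd b _ s := crd_mapCoeff b _ s

theorem crd_pull (f : S ⟶ T) (U : T.left.Opens) (s : Sec T V U) :
    crd b _ (Sec.pull f U s) = pl f U ∘ crd b _ s := crd_mapCoeff b _ s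

theorem comp_mulVec {A A' : Type*} [CommRing A] [CommRing A'] {L : Type*} (f : A →+* A')
    (P : Matrix L J A) (c : J → A) : f ∘ (P *ᵥ c) = P.map f *ᵥ (f ∘ c) :=
  funext (RingHom.map_mulVec f P c)

theorem map_rs_rs {L J : Type*} {U W W' : S.left.Opens} (h : W ≤ U) (h' : W' ≤ W)
    (P : Matrix L J Γ(S.left, U)) : (P.map (rs h)).map (rs h') = P.map (rs (h'.trans h)) := by
  ext i j
  exact rs_rs h h' _

theorem map_rs_refl {L J : Type*} {U : S.left.Opens} (P : Matrix L J Γ(S.left, U)) :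
    P.map (rs (le_refl U)) = P := by
  ext i j
  exact congr($rs_refl (P i j))

theorem map_pl_rs {L J : Type*} (f : S ⟶ T) {U W : T.left.Opens} (h : W ≤ U)
    (P : Matrix L J Γ(T.left, U)) :
    (P.map (rs h)).map (pl f W) = (P.map (pl f U)).map (rs (preimage_le f h)) := by
  ext i j
  exact pl_rs f h _

/-- The submodule of the sections of `V ⊗ 𝒪_S` whose restrictions to `U` are killed by the
matrix `P`. -/
def ker {L : Type*} (U : S.left.Opens) (P : Matrix L J Γ(S.left, U)) : Submod S V where
  obj W :=
    { carrier := {s | P.map (rs inf_le_right) *ᵥ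
        crd b _ (Sec.res (inf_le_left : W ⊓ U ≤ W) s) = 0}
      add_mem' := fun {s t} h h' ↦ by
        simp only [Set.mem_ofPred_eq] at h h' ⊢
        rw [map_add, map_add, mulVec_add, h, h', add_zero]
      zero_mem' := by simp
      smul_mem' := fun a s h ↦ by
        simp only [Set.mem_ofPred_eq] at h ⊢
        rw [Sec.res_smul, map_smul, mulVec_smul, h, smul_zero] }
  res_mem {W W'} h s hs := by
    change P.map _ *ᵥ _ = 0 at hs
    change P.map _ *ᵥ _ = 0
    have h' : W' ⊓ U ≤ W ⊓ U := inf_le_inf_right _ h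
    have := congr(rs h' ∘ $hs)
    rw [comp_mulVec, map_rs_rs, ← crd_res, Sec.res_res] at this
    rw [Sec.res_res, this]
    ext; simp
  mem_of_local {W s} H := by
    change P.map _ *ᵥ _ = 0
    funext i
    refine section_ext_of_local fun x hx ↦ ?_
    obtain ⟨W', h, hxW, hs⟩ := H x hx.1
    have h' : W' ⊓ U ≤ W ⊓ U := inf_le_inf_right _ h
    refine ⟨W' ⊓ U, h', ⟨hxW, hx.2⟩, ?_⟩
    change P.map _ *ᵥ _ = 0 at hs
    have e : rs h' ∘ (P.map (rs inf_le_right) *ᵥ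
        crd b _ (Sec.res (inf_le_left : W ⊓ U ≤ W) s)) = 0 := by
      rw [comp_mulVec, map_rs_rs, ← crd_res, Sec.res_res, ← hs, Sec.res_res]
    have := congr_fun e i
    simpa using this

variable {b} in
theorem mem_ker {L : Type*} {U : S.left.Opens} {P : Matrix L J Γ(S.left, U)}
    {W : S.left.Opens} {s : Sec S V W} : s ∈ (ker b U P).obj W ↔
      P.map (rs inf_le_right) *ᵥ crd b _ (Sec.res (inf_le_left : W ⊓ U ≤ W) s) = 0 := Iff.rfl

variable {b} in
theorem mem_ker_of_le {L : Type*} {U : S.left.Opens} {P : Matrix L J Γ(S.left, U)}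
    {W : S.left.Opens} (h : W ≤ U) {s : Sec S V W} :
    s ∈ (ker b U P).obj W ↔ P.map (rs h) *ᵥ crd b _ s = 0 := by
  rw [mem_ker]
  constructor
  · intro hs
    have h' : W ≤ W ⊓ U := le_inf le_rfl h
    have := congr(rs h' ∘ $hs)
    rw [comp_mulVec, map_rs_rs, ← crd_res, Sec.res_res, Sec.res_refl] at this
    rw [this]
    ext; simp
  · intro hs
    have := congr(rs (inf_le_left : W ⊓ U ≤ W) ∘ $hs)
    rw [comp_mulVec, map_rs_rs, ← crd_res] at this
    rw [this]
    ext; simp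

variable {ι ι' : Type*} [Fintype ι] [DecidableEq ι] [Fintype ι'] [DecidableEq ι']

/-- Over `U`, the submodule `K` is free with basis the columns of `e`, and `α` extends the
coordinate functions of this basis to `V ⊗ 𝒪_U`. -/
structure IsFrameOn (K : Submod S V) (U : S.left.Opens) (e : Matrix J ι Γ(S.left, U))
    (α : Matrix ι J Γ(S.left, U)) : Prop where
  left_inv : α * e = 1
  mem_iff : ∀ {W : S.left.Opens} (h : W ≤ U) {s : Sec S V W},
    s ∈ K.obj W ↔ crd b _ s = e.map (rs h) *ᵥ (α.map (rs h) *ᵥ crd b _ s)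

namespace IsFrameOn

variable {b} {K L : Submod S V} {U : S.left.Opens} {e : Matrix J ι Γ(S.left, U)}
  {α : Matrix ι J Γ(S.left, U)} {e' : Matrix J ι' Γ(S.left, U)} {α' : Matrix ι' J Γ(S.left, U)}

theorem left_inv_map {A : Type*} [CommRing A] (H : IsFrameOn b K U e α) (f : Γ(S.left, U) →+* A) :
    α.map f * e.map f = 1 := by
  rw [← Matrix.map_mul, H.left_inv, Matrix.map_one _ (map_zero f) (map_one f)]

theorem mem_iff_exists (H : IsFrameOn b K U e α) {W : S.left.Opens} (h : W ≤ U) {s : Sec S V W} :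
    s ∈ K.obj W ↔ ∃ c, crd b _ s = e.map (rs h) *ᵥ c := by
  rw [H.mem_iff h]
  refine ⟨fun hs ↦ ⟨_, hs⟩, ?_⟩
  rintro ⟨c, hc⟩
  rw [hc, mulVec_mulVec c, H.left_inv_map, one_mulVec]

theorem mem_iff_exists' (H : IsFrameOn b K U e α) {s : Sec S V U} :
    s ∈ K.obj U ↔ ∃ c, crd b _ s = e *ᵥ c := by
  rw [H.mem_iff_exists le_rfl, map_rs_refl]

theorem restrict (H : IsFrameOn b K U e α) {W : S.left.Opens} (h : W ≤ U) :
    IsFrameOn b K W (e.map (rs h)) (α.map (rs h)) where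
  left_inv := H.left_inv_map _
  mem_iff h' s := by rw [H.mem_iff (h'.trans h), map_rs_rs, map_rs_rs]

theorem col_mem (H : IsFrameOn b K U e α) (i : ι) :
    (crd b _).symm (fun j ↦ e j i) ∈ K.obj U := by
  rw [H.mem_iff_exists']
  exact ⟨Pi.single i 1, by ext; simp⟩

/-- A smaller submodule with a frame of the same size is equal. -/
theorem obj_eq_of_le (H : IsFrameOn b K U e α) (H' : IsFrameOn b L U e' α')
    (hc : Fintype.card ι = Fintype.card ι') (hKL : K.obj U ≤ L.obj U)
    {W : S.left.Opens} (h : W ≤ U) : K.obj W = L.obj W := by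
  have he : e = e' * (α' * e) := by
    ext j i
    have := congr_fun ((H'.mem_iff le_rfl).1 (hKL (H.col_mem i))) j
    rw [map_rs_refl, map_rs_refl, LinearEquiv.apply_symm_apply] at this
    exact this
  have h1 : (α * e') * (α' * e) = 1 := by
    rw [Matrix.mul_assoc, ← he, H.left_inv]
  have h2 : (α' * e) * (α * e') = 1 := (Matrix.mul_eq_one_comm_of_card_eq _ _ _ hc).1 h1
  have he' : e' = e * (α * e') := by
    conv_rhs => rw [he, Matrix.mul_assoc, h2, Matrix.mul_one]
  ext s
  rw [H.mem_iff_exists h, H'.mem_iff_exists h]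
  constructor
  · rintro ⟨c, hc⟩
    exact ⟨(α' * e).map (rs h) *ᵥ c, by rw [mulVec_mulVec, ← Matrix.map_mul, ← he, hc]⟩
  · rintro ⟨c, hc⟩
    exact ⟨(α * e').map (rs h) *ᵥ c, by rw [mulVec_mulVec, ← Matrix.map_mul, ← he', hc]⟩

theorem pullback {f : S ⟶ T} {K : Submod T V} {U : T.left.Opens} {e : Matrix J ι Γ(T.left, U)}
    {α : Matrix ι J Γ(T.left, U)} (H : IsFrameOn b K U e α) :
    IsFrameOn b (K.pullback f) (f.left ⁻¹ᵁ U) (e.map (pl f U)) (α.map (pl f U)) where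
  left_inv := H.left_inv_map _
  mem_iff {W} h s := by
    classical
    constructor
    · intro hs
      have hle : K.pullback f ≤
          ker b (f.left ⁻¹ᵁ U) (1 - e.map (pl f U) * α.map (pl f U)) := by
        rw [pullback_le_iff]
        intro U' t ht
        rw [mem_pushforward, mem_ker]
        have := (H.mem_iff inf_le_right).1 (K.res_mem (inf_le_left : U' ⊓ U ≤ U') ht)
        have := congr(pl f _ ∘ $this)
        rw [comp_mulVec, comp_mulVec, map_pl_rs, map_pl_rs, ← crd_pull, Sec.pull_res] at this
        rw [Matrix.map_sub _ (fun _ _ ↦ map_sub _ _ _), sub_mulVec, Matrix.map_mul,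
          Matrix.map_one _ (map_zero _) (map_one _), one_mulVec, sub_eq_zero, ← mulVec_mulVec]
        exact this
      have := (mem_ker_of_le h).1 (hle W hs)
      rwa [Matrix.map_sub _ (fun _ _ ↦ map_sub _ _ _), sub_mulVec, Matrix.map_mul,
          Matrix.map_one _ (map_zero _) (map_one _), one_mulVec, sub_eq_zero,
          ← mulVec_mulVec] at this
    · intro hs
      rw [← (crd b _).symm_apply_apply s, hs]
      generalize (α.map (pl f U)).map (rs h) *ᵥ crd b _ s = c
      have : (crd b Γ(S.left, W)).symm ((e.map (pl f U)).map (rs h) *ᵥ c) =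
          ∑ i, c i • Sec.res h (Sec.pull f U ((crd b _).symm (fun j ↦ e j i))) := by
        rw [LinearEquiv.symm_apply_eq, map_sum]
        ext j
        simp only [map_smul, crd_res, crd_pull, LinearEquiv.apply_symm_apply, Finset.sum_apply,
          Pi.smul_apply, Function.comp_apply, mulVec, dotProduct, Matrix.map_apply, smul_eq_mul]
        exact Finset.sum_congr rfl fun i _ ↦ mul_comm _ _
      rw [this]
      exact sum_mem fun i _ ↦ Submodule.smul_mem _ _
        ((K.pullback f).res_mem h (pull_mem_pullback f (H.col_mem i)))

end IsFrameOn

theorem dual_eq_one_of_isCompl {A M : Type*} [CommRing A] [AddCommGroup M] [Module A M]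
    {K C : Submodule A M} {ε : ι → M} (hε : LinearIndependent A ε) (hKC : Disjoint K C)
    (hεK : ∀ i, ε i ∈ K) {β : J → M} {e : J → ι → A} (he : ∀ i, ε i = ∑ j, e j i • β j)
    {a : J → ι → A} (ha : ∀ j, β j - ∑ l, a j l • ε l ∈ C) (l i : ι) :
    ∑ j, a j l * e j i = (1 : Matrix ι ι A) l i := by
  have h2 : ∑ l, (∑ j, a j l * e j i) • ε l = ∑ j, e j i • ∑ l, a j l • ε l := by
    simp only [Finset.sum_smul, Finset.smul_sum, smul_smul]
    rw [Finset.sum_comm]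
    exact Finset.sum_congr rfl fun j _ ↦ Finset.sum_congr rfl fun l _ ↦ by rw [mul_comm]
  have h0 : ε i - ∑ l, (∑ j, a j l * e j i) • ε l = 0 := by
    refine Submodule.disjoint_def.1 hKC _ (sub_mem (hεK i) (sum_mem fun l _ ↦
      Submodule.smul_mem _ _ (hεK l))) ?_
    rw [h2, he i]
    rw [← Finset.sum_sub_distrib]
    refine sum_mem fun j _ ↦ ?_
    rw [← smul_sub]
    exact Submodule.smul_mem _ _ (ha j)
  have h3 : ∑ l, ((∑ j, a j l * e j i) - (1 : Matrix ι ι A) l i) • ε l = 0 := by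
    simp only [sub_smul, Finset.sum_sub_distrib]
    rw [← neg_inj, neg_sub, neg_zero, ← h0]
    simp [Matrix.one_apply]
  exact sub_eq_zero.1 (Fintype.linearIndependent_iff.1 hε _ h3 l)

theorem exists_isFrameOn {K : Submod S V} {r : ℕ} (h₁ : K.IsLocallyFreeOfRank r)
    (h₂ : K.IsLocallyDirectSummand) (x : S.left) :
    ∃ U : S.left.Opens, x ∈ U ∧ ∃ (e : Matrix J (Fin r) Γ(S.left, U))
      (α : Matrix (Fin r) J Γ(S.left, U)), IsFrameOn b K U e α := by
  classical
  obtain ⟨U₁, hx₁, ε, hε⟩ := h₁ x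
  obtain ⟨U₂, hx₂, C, hC⟩ := h₂ x
  set U := U₁ ⊓ U₂
  have hU : U ≤ U₁ := inf_le_left
  have hspan (W : S.left.Opens) (h : W ≤ U) := (hε W (h.trans hU)).2
  set e : Matrix J (Fin r) Γ(S.left, U) := .of fun j i ↦ crd b _ (Sec.res hU (ε i)) j
  have hdec (j : J) : ∃ c : Fin r → Γ(S.left, U),
      (1 : Γ(S.left, U)) ⊗ₜ[ZMod p] b j - ∑ i, c i • Sec.res hU (ε i) ∈ C.obj U := by
    obtain ⟨k, hk, k', hk', hkk⟩ := Submodule.mem_sup.1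
      ((hC U inf_le_right).sup_eq_top ▸ Submodule.mem_top :
        (1 : Γ(S.left, U)) ⊗ₜ[ZMod p] b j ∈ K.obj U ⊔ C.obj U)
    rw [← hspan U le_rfl, Submodule.mem_span_range_iff_exists_fun] at hk
    obtain ⟨c, rfl⟩ := hk
    exact ⟨c, by rwa [← hkk, add_sub_cancel_left]⟩
  choose a ha using hdec
  set α : Matrix (Fin r) J Γ(S.left, U) := .of fun i j ↦ a j i
  have hli : α * e = 1 := by
    ext l i
    refine dual_eq_one_of_isCompl (hε U hU).1 (hC U inf_le_right).disjoint (fun l ↦ ?_)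
      (fun i ↦ ?_) ha l i
    · rw [← hspan U le_rfl]
      exact Submodule.subset_span ⟨l, rfl⟩
    · rw [← (crd b _).symm_apply_apply (Sec.res hU (ε i)), crd_symm_apply]
      simp [e, TensorProduct.smul_tmul']
  refine ⟨U, ⟨hx₁, hx₂⟩, e, α, hli, fun {W} h s ↦ ?_⟩
  have hcol (c : Fin r → Γ(S.left, W)) :
      crd b _ (∑ i, c i • Sec.res (h.trans hU) (ε i)) = e.map (rs h) *ᵥ c := by
    ext j
    simp only [map_sum, map_smul, Finset.sum_apply, Pi.smul_apply, smul_eq_mul, mulVec, dotProduct,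
      Matrix.map_apply, e, Matrix.of_apply]
    refine Finset.sum_congr rfl fun i _ ↦ ?_
    rw [← Sec.res_res hU h, crd_res, mul_comm]
    rfl
  rw [← hspan W h, Submodule.mem_span_range_iff_exists_fun]
  constructor
  · rintro ⟨c, rfl⟩
    rw [hcol, mulVec_mulVec c, ← Matrix.map_mul, hli, Matrix.map_one _ (map_zero _) (map_one _),
      one_mulVec]
  · intro hs
    exact ⟨_, (crd b _).injective ((hcol _).trans hs.symm)⟩

theorem locallyFree_of_isFrameOn {K : Submod S V} {r : ℕ} (hr : Fintype.card ι = r)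
    (H : ∀ x : S.left, ∃ U : S.left.Opens, x ∈ U ∧ ∃ (e : Matrix J ι Γ(S.left, U))
      (α : Matrix ι J Γ(S.left, U)), IsFrameOn b K U e α) :
    K.IsLocallyFreeOfRank r ∧ K.IsLocallyDirectSummand := by
  classical
  constructor
  · intro x
    obtain ⟨U, hx, e, α, h⟩ := H x
    let σ : Fin r ≃ ι := (Fintype.equivFinOfCardEq hr).symm
    refine ⟨U, hx, fun i ↦ (crd b _).symm (fun j ↦ e j (σ i)), fun W hW ↦ ?_⟩
    have hcol (c : Fin r → Γ(S.left, W)) :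
        crd b _ (∑ i, c i • Sec.res hW ((crd b _).symm (fun j ↦ e j (σ i)))) =
          e.map (rs hW) *ᵥ (c ∘ σ.symm) := by
      ext j
      simp only [map_sum, map_smul, Finset.sum_apply, Pi.smul_apply, smul_eq_mul, mulVec,
        dotProduct, Matrix.map_apply, crd_res, LinearEquiv.apply_symm_apply, Function.comp_apply]
      refine Fintype.sum_equiv σ _ _ fun i ↦ ?_
      simp [mul_comm]
    constructor
    · rw [Fintype.linearIndependent_iff]
      intro c hc i
      have h1 := hcol c
      rw [hc, map_zero] at h1
      have h2 := congr(α.map (rs hW) *ᵥ $h1)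
      rw [mulVec_zero, mulVec_mulVec, h.left_inv_map, one_mulVec] at h2
      simpa using (congr_fun h2 (σ i)).symm
    · ext s
      rw [Submodule.mem_span_range_iff_exists_fun, h.mem_iff_exists hW]
      constructor
      · rintro ⟨c, rfl⟩
        exact ⟨_, hcol c⟩
      · rintro ⟨c, hc⟩
        refine ⟨c ∘ σ, (crd b _).injective ((hcol _).trans ?_)⟩
        rw [hc, Function.comp_assoc, Equiv.self_comp_symm, Function.comp_id]
  · intro x
    obtain ⟨U, hx, e, α, h⟩ := H x
    refine ⟨U, hx, ker b U α, fun W hW ↦ ⟨?_, ?_⟩⟩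
    · rw [Submodule.disjoint_def]
      intro s hs hs'
      rw [mem_ker_of_le hW] at hs'
      have := (h.mem_iff hW).1 hs
      rw [hs', mulVec_zero] at this
      simpa using this
    · rw [codisjoint_iff, eq_top_iff]
      intro s _
      set t := (crd b _).symm (e.map (rs hW) *ᵥ (α.map (rs hW) *ᵥ crd b _ s))
      refine Submodule.mem_sup.2 ⟨t, ?_, s - t, ?_, by simp⟩
      · rw [h.mem_iff_exists hW]
        exact ⟨_, LinearEquiv.apply_symm_apply _ _⟩
      · rw [mem_ker_of_le hW, map_sub, mulVec_sub, sub_eq_zero]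
        simp only [t, LinearEquiv.apply_symm_apply]
        rw [mulVec_mulVec (α.map (rs hW) *ᵥ crd b _ s), h.left_inv_map, one_mulVec]

end Submod

end PeriodSpace

namespace PeriodSpace

variable {p : ℕ} [Fact p.Prime]

/-! ## Graphs -/

namespace Submod

open Matrix

variable {S T R : FpScheme p} {V : Type*} [AddCommGroup V] [Module (ZMod p) V]
variable {ι : Type*} [Fintype ι] [DecidableEq ι] (b : Module.Basis (ι ⊕ ι) (ZMod p) V)

/-- Over `U`, the submodule `K` is the graph of the matrix `A` with respect to the decomposition
of `V` given by the two halves of the basis `b`. -/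
def IsGraphOn (K : Submod S V) (U : S.left.Opens) (A : Matrix ι ι Γ(S.left, U)) : Prop :=
  IsFrameOn b K U (fromRows 1 A) (fromCols 1 0)

/-- The submodule with a given frame over `U`. -/
def ofFrame {J κ : Type*} [Fintype J] [DecidableEq J] [Fintype κ] (b : Module.Basis J (ZMod p) V)
    (U : S.left.Opens) (e : Matrix J κ Γ(S.left, U)) (α : Matrix κ J Γ(S.left, U)) : Submod S V :=
  ker b U (1 - e * α)

theorem isFrameOn_ofFrame {J κ : Type*} [Fintype J] [DecidableEq J] [Fintype κ] [DecidableEq κ]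
    (b : Module.Basis J (ZMod p) V) {U : S.left.Opens} {e : Matrix J κ Γ(S.left, U)}
    {α : Matrix κ J Γ(S.left, U)} (h : α * e = 1) :
    IsFrameOn b (ofFrame b U e α) U e α where
  left_inv := h
  mem_iff {W} hW s := by
    rw [ofFrame, mem_ker_of_le hW, Matrix.map_sub _ (fun _ _ ↦ map_sub _ _ _), sub_mulVec,
      Matrix.map_mul, Matrix.map_one _ (map_zero _) (map_one _), one_mulVec, sub_eq_zero,
      ← mulVec_mulVec]

namespace IsGraphOn

variable {b} {K L : Submod S V} {U : S.left.Opens} {A A' : Matrix ι ι Γ(S.left, U)}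

theorem mem_iff (H : IsGraphOn b K U A) {W : S.left.Opens} (h : W ≤ U) {s : Sec S V W} :
    s ∈ K.obj W ↔
      (fun i ↦ crd b _ s (.inr i)) = A.map (rs h) *ᵥ (fun i ↦ crd b _ s (.inl i)) := by
  have e1 : (fromCols 1 0 : Matrix ι (ι ⊕ ι) Γ(S.left, U)).map (rs h) *ᵥ crd b _ s =
      fun i ↦ crd b _ s (.inl i) := by
    rw [fromCols_map, Matrix.map_one _ (map_zero _) (map_one _), Matrix.map_zero _ (map_zero _)]
    ext i
    simp [fromCols_mulVec, Function.comp_def]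
  rw [IsFrameOn.mem_iff H h, e1, fromRows_map, fromRows_mulVec,
    Matrix.map_one _ (map_zero _) (map_one _), one_mulVec]
  constructor
  · intro hs
    ext i
    rw [hs]
    simp
  · intro hs
    ext (i | i)
    · rfl
    · exact congr_fun hs i

theorem of_mem_iff (H : ∀ {W : S.left.Opens} (h : W ≤ U) {s : Sec S V W}, s ∈ K.obj W ↔
      (fun i ↦ crd b _ s (.inr i)) = A.map (rs h) *ᵥ (fun i ↦ crd b _ s (.inl i))) :
    IsGraphOn b K U A := by
  have hinv : (fromCols 1 0 : Matrix ι (ι ⊕ ι) Γ(S.left, U)) *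
      (fromRows 1 A : Matrix (ι ⊕ ι) ι Γ(S.left, U)) = 1 := by
    simp [fromCols_mul_fromRows]
  have hL : IsGraphOn b (ofFrame b U (fromRows 1 A) (fromCols 1 0)) U A := isFrameOn_ofFrame b hinv
  refine ⟨hinv, fun h s ↦ ?_⟩
  rw [← IsFrameOn.mem_iff hL h, H h, hL.mem_iff h]

theorem restrict (H : IsGraphOn b K U A) {W : S.left.Opens} (h : W ≤ U) :
    IsGraphOn b K W (A.map (rs h)) :=
  of_mem_iff fun h' s ↦ by rw [H.mem_iff (h'.trans h), map_rs_rs]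

/-- The `j`-th column of the graph of a matrix. -/
def col (b : Module.Basis (ι ⊕ ι) (ZMod p) V) {O : Type*} [CommRing O] [Algebra (ZMod p) O]
    (A : Matrix ι ι O) (j : ι) : O ⊗[ZMod p] V :=
  (crd b _).symm (fun x ↦ (fromRows 1 A : Matrix (ι ⊕ ι) ι O) x j)

theorem crd_col_inl {O : Type*} [CommRing O] [Algebra (ZMod p) O] (A : Matrix ι ι O) (i j : ι) :
    crd b _ (col b A j) (.inl i) = (1 : Matrix ι ι O) i j := by
  simp [col]

theorem crd_col_inr {O : Type*} [CommRing O] [Algebra (ZMod p) O] (A : Matrix ι ι O) (i j : ι) :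
    crd b _ (col b A j) (.inr i) = A i j := by
  simp [col]

theorem col_mem (H : IsGraphOn b K U A) (j : ι) : col b A j ∈ K.obj U := IsFrameOn.col_mem H j

theorem eq_sum_col (H : IsGraphOn b K U A) {s : Sec S V U} (hs : s ∈ K.obj U) :
    s = ∑ j, crd b _ s (.inl j) • col b A j := by
  apply (crd b _).injective
  rw [map_sum]
  have := (H.mem_iff le_rfl).1 hs
  rw [map_rs_refl] at this
  ext (i | i)
  · simp [crd_col_inl, Matrix.one_apply]
  · rw [congr_fun this i]
    simp [crd_col_inr, mulVec, dotProduct, mul_comm]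

theorem unique (H : IsGraphOn b K U A) (H' : IsGraphOn b K U A') : A = A' := by
  ext i j
  have := congr_fun ((H'.mem_iff le_rfl).1 (H.col_mem j)) i
  rw [map_rs_refl] at this
  simpa [crd_col_inl, crd_col_inr, mulVec, dotProduct, Matrix.one_apply] using this

theorem pullback {f : S ⟶ T} {K : Submod T V} {U : T.left.Opens} {A : Matrix ι ι Γ(T.left, U)}
    (H : IsGraphOn b K U A) : IsGraphOn b (K.pullback f) (f.left ⁻¹ᵁ U) (A.map (pl f U)) := by
  have := IsFrameOn.pullback (f := f) H
  rwa [fromRows_map, fromCols_map, Matrix.map_one _ (map_zero _) (map_one _),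
    Matrix.map_zero _ (map_zero _)] at this

theorem eq_of_top {A : Matrix ι ι Γ(S.left, ⊤)} (H : IsGraphOn b K ⊤ A) (H' : IsGraphOn b L ⊤ A) :
    K = L := by
  ext U s
  rw [H.mem_iff le_top, H'.mem_iff le_top]

/-- Being a graph is a local property. -/
theorem exists_of_local
    (H : ∀ x ∈ U, ∃ W ≤ U, x ∈ W ∧ ∃ A : Matrix ι ι Γ(S.left, W), IsGraphOn b K W A) :
    ∃ A : Matrix ι ι Γ(S.left, U), IsGraphOn b K U A := by
  choose W hWU hxW A hA using fun x : U ↦ H x x.2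
  have hcov : U ≤ iSup W := fun x hx ↦ Opens.mem_iSup.2 ⟨⟨x, hx⟩, hxW _⟩
  have hglue (i j : ι) : ∃ a : Γ(S.left, U), ∀ x, rs (hWU x) a = A x i j := by
    refine (S.left.sheaf.existsUnique_gluing' W U (fun x ↦ homOfLE (hWU x)) hcov
      (fun x ↦ A x i j) fun x y ↦ ?_).exists
    exact congr($(((hA x).restrict inf_le_left).unique ((hA y).restrict inf_le_right)) i j)
  choose a ha using hglue
  refine ⟨.of a, of_mem_iff fun {U'} h s ↦ ?_⟩
  have hres (x : U) (hx : x.1 ∈ U') (W' : S.left.Opens) (h' : W' ≤ U') (h'' : W' ≤ W x) :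
      Sec.res h' s ∈ K.obj W' ↔ ∀ i, rs h' (crd b _ s (.inr i)) =
        rs h' (((Matrix.of a).map (rs h) *ᵥ (fun i ↦ crd b _ s (.inl i))) i) := by
    rw [(hA x).mem_iff h'', funext_iff]
    refine forall_congr' fun i ↦ ?_
    rw [RingHom.map_mulVec, map_rs_rs, crd_res]
    have : (A x).map (rs h'') = (Matrix.of a).map (rs (h'.trans h)) := by
      ext i j
      simp only [Matrix.map_apply, Matrix.of_apply]
      rw [← ha, rs_rs]
    rw [this]
    rfl
  constructor
  · intro hs
    funext i
    refine section_ext_of_local fun x hx ↦ ?_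
    refine ⟨U' ⊓ W ⟨x, h hx⟩, inf_le_left, ⟨hx, hxW _⟩, ?_⟩
    exact (hres ⟨x, h hx⟩ hx _ inf_le_left inf_le_right).1 (K.res_mem _ hs) i
  · intro hs
    refine K.mem_of_local fun x hx ↦ ?_
    refine ⟨U' ⊓ W ⟨x, h hx⟩, inf_le_left, ⟨hx, hxW _⟩, ?_⟩
    rw [hres ⟨x, h hx⟩ hx _ inf_le_left inf_le_right]
    intro i
    exact congr(rs _ ($hs i))

end IsGraphOn

/-- The largest open subset over which `K` is a graph. -/
def graphDomain (K : Submod S V) : S.left.Opens :=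
  sSup {U | ∃ A : Matrix ι ι Γ(S.left, U), IsGraphOn b K U A}

variable {b}

theorem exists_isGraphOn_graphDomain (K : Submod S V) :
    ∃ A : Matrix ι ι Γ(S.left, graphDomain b K), IsGraphOn b K (graphDomain b K) A := by
  refine IsGraphOn.exists_of_local fun x hx ↦ ?_
  obtain ⟨U, hU, hx⟩ := Opens.mem_sSup.1 hx
  exact ⟨U, le_sSup hU, hx, hU⟩

theorem IsGraphOn.le_graphDomain {K : Submod S V} {U : S.left.Opens}
    {A : Matrix ι ι Γ(S.left, U)} (H : IsGraphOn b K U A) : U ≤ graphDomain b K :=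
  le_sSup ⟨A, H⟩

theorem IsFrameOn.isGraphOn {K : Submod S V} {U : S.left.Opens} {e : Matrix (ι ⊕ ι) ι Γ(S.left, U)}
    {α : Matrix ι (ι ⊕ ι) Γ(S.left, U)} (H : IsFrameOn b K U e α) (h : IsUnit e.toRows₁.det) :
    IsGraphOn b K U (e.toRows₂ * e.toRows₁⁻¹) := by
  refine .of_mem_iff fun {W} hW s ↦ ?_
  rw [H.mem_iff_exists hW]
  have h1 : e.toRows₁⁻¹ * e.toRows₁ = 1 := Matrix.nonsing_inv_mul _ h
  have h2 : e.toRows₁ * e.toRows₁⁻¹ = 1 := Matrix.mul_nonsing_inv _ h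
  have he : e.map (rs hW) = fromRows (e.toRows₁.map (rs hW)) (e.toRows₂.map (rs hW)) := by
    ext (i | i) j <;> rfl
  rw [he]
  constructor
  · rintro ⟨c, hc⟩
    rw [fromRows_mulVec] at hc
    rw [hc]
    simp only [Sum.elim_inl, Sum.elim_inr]
    rw [mulVec_mulVec, ← Matrix.map_mul, Matrix.mul_assoc, h1,
      Matrix.mul_one]
  · intro hs
    refine ⟨e.toRows₁⁻¹.map (rs hW) *ᵥ fun i ↦ crd b _ s (.inl i), ?_⟩
    rw [fromRows_mulVec, mulVec_mulVec, mulVec_mulVec, ← Matrix.map_mul, ← Matrix.map_mul, h2,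
      Matrix.map_one _ (map_zero _) (map_one _), one_mulVec, ← hs]
    ext (i | i) <;> rfl

theorem IsFrameOn.isUnit_det {K : Submod S V} {U : S.left.Opens}
    {e : Matrix (ι ⊕ ι) ι Γ(S.left, U)} {α : Matrix ι (ι ⊕ ι) Γ(S.left, U)}
    (H : IsFrameOn b K U e α) {A : Matrix ι ι Γ(S.left, U)} (H' : IsGraphOn b K U A) :
    IsUnit e.toRows₁.det := by
  have h (j : ι) := H.mem_iff_exists'.1 (H'.col_mem j)
  choose c hc using h
  have : e.toRows₁ * Matrix.of (fun i j ↦ c j i) = 1 := by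
    ext i j
    rw [← IsGraphOn.crd_col_inl (b := b) A i j, hc]
    rfl
  rw [← Matrix.isUnit_iff_isUnit_det]
  exact IsUnit.of_mul_eq_one _ this

theorem mem_graphDomain_of_pullback {f : S ⟶ T} {K : Submod T V} {U : T.left.Opens}
    {e : Matrix (ι ⊕ ι) ι Γ(T.left, U)} {α : Matrix ι (ι ⊕ ι) Γ(T.left, U)}
    (H : IsFrameOn b K U e α) {W : S.left.Opens} {A : Matrix ι ι Γ(S.left, W)}
    (H' : IsGraphOn b (K.pullback f) W A) {x : S.left} (hx : f.left x ∈ U) (hxW : x ∈ W) :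
    f.left x ∈ graphDomain b K := by
  have h1 := ((H.pullback (f := f)).restrict (inf_le_left : f.left ⁻¹ᵁ U ⊓ W ≤ _)).isUnit_det
    (H'.restrict inf_le_right)
  have h2 : (((e.map (pl f U)).map (rs (inf_le_left : f.left ⁻¹ᵁ U ⊓ W ≤ _))).toRows₁).det =
      rs (inf_le_left : f.left ⁻¹ᵁ U ⊓ W ≤ _) (pl f U e.toRows₁.det) := by
    rw [RingHom.map_det, RingHom.map_det]
    rfl
  rw [h2] at h1
  have h3 : f.left x ∈ T.left.basicOpen e.toRows₁.det := by
    change x ∈ f.left ⁻¹ᵁ (T.left.basicOpen e.toRows₁.det)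
    rw [Scheme.preimage_basicOpen]
    refine (S.left.mem_basicOpen _ _ hx).2 ?_
    have := h1.map (S.left.presheaf.germ (f.left ⁻¹ᵁ U ⊓ W) x ⟨hx, hxW⟩).hom
    exact (TopCat.Presheaf.germ_res_apply S.left.presheaf
      (homOfLE (inf_le_left : f.left ⁻¹ᵁ U ⊓ W ≤ _)) x ⟨hx, hxW⟩ _) ▸ this
  have hle : T.left.basicOpen e.toRows₁.det ≤ U := T.left.basicOpen_le _
  refine ((H.restrict hle).isGraphOn ?_).le_graphDomain h3
  have h4 : ((e.map (rs hle)).toRows₁).det = rs hle e.toRows₁.det := by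
    rw [RingHom.map_det]
    rfl
  rw [h4]
  exact RingedSpace.isUnit_res_basicOpen _ _

end Submod

end PeriodSpace

namespace PeriodSpace

variable {p : ℕ} [Fact p.Prime]

/-! ## Adapted bases and the equations of the charts -/

section Adapted

variable {m : ℕ}

/-- The Gram matrix of an adapted basis: an orthogonal basis of an anisotropic plane, followed by
hyperbolic pairs. -/
def gram (c d : ZMod p) : Option (Fin m) ⊕ Option (Fin m) → Option (Fin m) ⊕ Option (Fin m) → ZMod p
  | .inl none, .inl none => -(c * d)
  | .inr none, .inr none => c
  | .inl (some i), .inr (some j) => if i = j then 1 else 0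
  | .inr (some i), .inl (some j) => if i = j then 1 else 0
  | _, _ => 0

variable {V : Type*} [AddCommGroup V] [Module (ZMod p) V]

/-- A basis of `V` which is adapted to the bilinear form `B`. -/
structure IsAdapted (B : LinearMap.BilinForm (ZMod p) V) (c d : ZMod p)
    (b : Module.Basis (Option (Fin m) ⊕ Option (Fin m)) (ZMod p) V) : Prop where
  apply_eq : ∀ x y, B (b x) (b y) = gram c d x y
  ne_zero : c ≠ 0
  not_isSquare : ¬ IsSquare d

/-- The equations which express that the graph of `A` is a characteristic subspace. -/
structure ChartEqs (c d : ZMod p) {O : Type*} [CommRing O] [Algebra (ZMod p) O]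
    (A : Matrix (Option (Fin m)) (Option (Fin m)) O) : Prop where
  sq_eq : A none none ^ 2 = algebraMap _ O d
  row_eq : ∀ i, algebraMap _ O c * A none none * A none (some i) + A (some i) none = 0
  add_eq : ∀ i j, algebraMap _ O c * A none (some i) * A none (some j) +
    A (some j) (some i) + A (some i) (some j) = 0
  frob_eq : ∀ i j, -2 * A none none * (A i j ^ p - A i j) =
    (A i none ^ p - A i none) * (A none j ^ p - A none j)

theorem map_algebraMap_zmod {O O' : Type*} [CommRing O] [CommRing O'] [Algebra (ZMod p) O]
    [Algebra (ZMod p) O'] (f : O →+* O') (c : ZMod p) :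
    f (algebraMap _ O c) = algebraMap _ O' c :=
  congr($(Subsingleton.elim (f.comp (algebraMap _ O)) (algebraMap _ O')) c)

theorem ChartEqs.map {c d : ZMod p} {O O' : Type*} [CommRing O] [CommRing O'] [Algebra (ZMod p) O]
    [Algebra (ZMod p) O'] {A : Matrix (Option (Fin m)) (Option (Fin m)) O} (H : ChartEqs c d A)
    (f : O →+* O') : ChartEqs c d (A.map f) where
  sq_eq := by simpa [map_algebraMap_zmod] using congr(f $H.sq_eq)
  row_eq i := by simpa [map_algebraMap_zmod] using congr(f $(H.row_eq i))
  add_eq i j := by simpa [map_algebraMap_zmod] using congr(f $(H.add_eq i j))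
  frob_eq i j := by simpa [map_algebraMap_zmod, map_ofNat] using congr(f $(H.frob_eq i j))

open Matrix Submod.IsGraphOn

variable {B : LinearMap.BilinForm (ZMod p) V} {c d : ZMod p}
  {b : Module.Basis (Option (Fin m) ⊕ Option (Fin m)) (ZMod p) V}

section Ring

variable {O : Type*} [CommRing O] [Algebra (ZMod p) O]

theorem isUnit_algebraMap_zmod {c : ZMod p} (hc : c ≠ 0) : IsUnit (algebraMap (ZMod p) O c) :=
  (IsUnit.mk0 c hc).map _

theorem two_ne_zero_zmod (hp : 3 ≤ p) : (2 : ZMod p) ≠ 0 := by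
  intro h
  have : (p : ℕ) ∣ 2 := (ZMod.natCast_eq_zero_iff 2 p).1 (by exact_mod_cast h)
  have := Nat.le_of_dvd (by norm_num) this
  omega

theorem isUnit_two (hp : 3 ≤ p) : IsUnit (2 : O) := by
  have := isUnit_algebraMap_zmod (O := O) (two_ne_zero_zmod hp)
  rwa [map_ofNat] at this

theorem pow_prime_eq_neg (hp : 3 ≤ p) (hd : ¬ IsSquare d) {a : O} (ha : a ^ 2 = algebraMap _ O d) :
    a ^ p = -a := by
  have hd0 : d ≠ 0 := by
    rintro rfl
    exact hd (IsSquare.zero)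
  have h1 : d ^ (p / 2) = -1 := by
    refine (ZMod.pow_div_two_eq_neg_one_or_one p hd0).resolve_left fun h ↦ hd ?_
    exact (ZMod.euler_criterion p hd0).2 h
  have h2 : p = 2 * (p / 2) + 1 := by
    have := Nat.Prime.eq_two_or_odd (Fact.out : p.Prime)
    omega
  rw [h2, pow_succ, pow_mul, ha, ← map_pow, h1]
  simp

theorem IsAdapted.baseChange_eq (hb : IsAdapted B c d b) (s t : O ⊗[ZMod p] V) :
    B.baseChange O s t = algebraMap _ O c * crd b O s (.inr none) * crd b O t (.inr none) -
      algebraMap _ O (c * d) * crd b O s (.inl none) * crd b O t (.inl none) +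
      ∑ i, (crd b O s (.inl (some i)) * crd b O t (.inr (some i)) +
        crd b O s (.inr (some i)) * crd b O t (.inl (some i))) := by
  rw [baseChange_eq_sum b]
  simp only [hb.apply_eq, Fintype.sum_sum_type, Fintype.sum_option, gram, map_neg, map_zero,
    mul_zero, Finset.sum_const_zero, add_zero, zero_add, apply_ite (algebraMap (ZMod p) O), map_one, mul_ite,
    mul_one, Finset.sum_ite_eq, Finset.mem_univ, if_true, Finset.sum_add_distrib]
  ring

theorem IsAdapted.col_eqs (hb : IsAdapted B c d b)
    (A : Matrix (Option (Fin m)) (Option (Fin m)) O) :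
    B.baseChange O (col b A none) (col b A none) =
      algebraMap _ O c * (A none none ^ 2 - algebraMap _ O d) ∧
    (∀ i, B.baseChange O (col b A none) (col b A (some i)) =
      algebraMap _ O c * A none none * A none (some i) + A (some i) none) ∧
    (∀ i, B.baseChange O (col b A (some i)) (col b A none) =
      algebraMap _ O c * A none none * A none (some i) + A (some i) none) ∧
    (∀ i j, B.baseChange O (col b A (some i)) (col b A (some j)) =
      algebraMap _ O c * A none (some i) * A none (some j) +
        A (some j) (some i) + A (some i) (some j)) := by
  simp only [hb.baseChange_eq, crd_col_inl, crd_col_inr, Matrix.one_apply, map_mul]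
  refine ⟨?_, fun i ↦ ?_, fun i ↦ ?_, fun i j ↦ ?_⟩ <;>
    simp [Finset.sum_add_distrib] <;> ring

theorem IsAdapted.col_eqs_iff (hb : IsAdapted B c d b)
    (A : Matrix (Option (Fin m)) (Option (Fin m)) O) :
    (∀ i j, B.baseChange O (col b A i) (col b A j) = 0) ↔
      A none none ^ 2 = algebraMap _ O d ∧
      (∀ i, algebraMap _ O c * A none none * A none (some i) + A (some i) none = 0) ∧
      (∀ i j, algebraMap _ O c * A none (some i) * A none (some j) +
        A (some j) (some i) + A (some i) (some j) = 0) := by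
  obtain ⟨h1, h2, h3, h4⟩ := hb.col_eqs A
  have hc : algebraMap _ O c * (A none none ^ 2 - algebraMap _ O d) = 0 ↔
      A none none ^ 2 = algebraMap _ O d := by
    rw [IsUnit.mul_right_eq_zero (isUnit_algebraMap_zmod hb.ne_zero), sub_eq_zero]
  simp only [Option.forall, h1, h2, h3, h4, hc, forall_and]
  tauto

/-- A frame of `K + F^*K`, when `K` is the graph of `A`. -/
def frobFrame (A : Matrix (Option (Fin m)) (Option (Fin m)) O) :
    Matrix (Option (Fin m) ⊕ Option (Fin m)) (Option (Fin m) ⊕ Unit) O :=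
  fromBlocks 1 0 A (of fun i _ ↦ A i none ^ p - A i none)

/-- A left inverse of `frobFrame A`, when `η` is an inverse of its first entry. -/
def frobCoframe (A : Matrix (Option (Fin m)) (Option (Fin m)) O) (η : O) :
    Matrix (Option (Fin m) ⊕ Unit) (Option (Fin m) ⊕ Option (Fin m)) O :=
  fromBlocks 1 0 (of fun _ j ↦ -η * A none j) (of fun _ i ↦ if i = none then η else 0)

theorem symm_frobFrame_inl (A : Matrix (Option (Fin m)) (Option (Fin m)) O)
    (j : Option (Fin m)) :
    (crd b O).symm (fun x ↦ frobFrame (p := p) A x (.inl j)) = col b A j := by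
  refine congrArg _ (funext ?_)
  rintro (i | i) <;> rfl

theorem symm_frobFrame_inr (A : Matrix (Option (Fin m)) (Option (Fin m)) O) (u : Unit) :
    (crd b O).symm (fun x ↦ frobFrame (p := p) A x (.inr u)) =
      frob V O (col b A none) - col b A none := by
  rw [LinearEquiv.symm_apply_eq, map_sub]
  ext (i | i)
  · rw [Pi.sub_apply, crd_frob, crd_col_inl, Matrix.one_apply]
    split_ifs <;> simp [frobFrame, (Fact.out : p.Prime).ne_zero]
  · rw [Pi.sub_apply, crd_frob, crd_col_inr]
    rfl

theorem frobCoframe_mul_frobFrame (A : Matrix (Option (Fin m)) (Option (Fin m)) O) {η : O}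
    (h : η * (A none none ^ p - A none none) = 1) :
    frobCoframe A η * frobFrame (p := p) A = 1 := by
  rw [frobCoframe, frobFrame, fromBlocks_multiply, ← fromBlocks_one]
  congr 1
  · simp
  · simp
  · ext i j
    simp [Matrix.mul_apply]
  · ext i j
    simp [Matrix.mul_apply, h]

theorem frob_col_iff (A : Matrix (Option (Fin m)) (Option (Fin m)) O) (η : O)
    (j : Option (Fin m)) :
    crd b O (frob V O (col b A j)) =
      frobFrame (p := p) A *ᵥ (frobCoframe A η *ᵥ crd b O (frob V O (col b A j))) ↔
    ∀ i, A i j ^ p - A i j = (A i none ^ p - A i none) * (η * (A none j ^ p - A none j)) := by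
  have hp0 : p ≠ 0 := (Fact.out : p.Prime).ne_zero
  have h1 : crd b O (frob V O (col b A j)) =
      Sum.elim (fun i ↦ (1 : Matrix (Option (Fin m)) (Option (Fin m)) O) i j)
        (fun i ↦ A i j ^ p) := by
    ext (i | i)
    · rw [crd_frob, crd_col_inl, Matrix.one_apply]
      split_ifs with h <;> simp [h, hp0, Matrix.one_apply]
    · rw [crd_frob, crd_col_inr]
      rfl
  have h2 : frobCoframe A η *ᵥ crd b O (frob V O (col b A j)) =
      Sum.elim (fun i ↦ (1 : Matrix (Option (Fin m)) (Option (Fin m)) O) i j)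
        (fun _ ↦ η * (A none j ^ p - A none j)) := by
    rw [h1, frobCoframe, fromBlocks_mulVec]
    congr 1
    · ext i
      simp [Function.comp_def]
    · ext i
      simp [Function.comp_def, mulVec, dotProduct, Matrix.one_apply]
      ring
  rw [h2, h1, frobFrame, fromBlocks_mulVec]
  constructor
  · intro h i
    have := congr_fun h (.inr i)
    simp [Function.comp_def, mulVec, dotProduct, Matrix.one_apply] at this
    rw [this]
    ring
  · intro h
    ext (i | i)
    · simp [Function.comp_def]
    · simp [Function.comp_def, mulVec, dotProduct, Matrix.one_apply]
      rw [← h i]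
      ring

end Ring

namespace Submod

variable {S T : FpScheme p} {K L : Submod S V} {U : S.left.Opens}

theorem IsFrameOn.obj_le {J κ : Type*} [Fintype J] [Fintype κ] [DecidableEq κ]
    {b : Module.Basis J (ZMod p) V} {e : Matrix J κ Γ(S.left, U)} {α : Matrix κ J Γ(S.left, U)}
    (H : IsFrameOn b L U e α) (hc : ∀ i, (crd b _).symm (fun j ↦ e j i) ∈ K.obj U)
    {W : S.left.Opens} (h : W ≤ U) : L.obj W ≤ K.obj W := by
  intro s hs
  rw [H.mem_iff_exists h] at hs
  obtain ⟨c, hs⟩ := hs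
  have : s = ∑ i, c i • Sec.res h ((crd b _).symm (fun j ↦ e j i)) := by
    apply (crd b _).injective
    rw [hs, map_sum]
    ext j
    simp only [map_smul, crd_res, LinearEquiv.apply_symm_apply, Finset.sum_apply,
      Pi.smul_apply, Function.comp_apply, mulVec, dotProduct, Matrix.map_apply, smul_eq_mul]
    exact Finset.sum_congr rfl fun i _ ↦ mul_comm _ _
  rw [this]
  exact sum_mem fun i _ ↦ Submodule.smul_mem _ _ (K.res_mem h (hc i))

theorem res_col {ι : Type*} [Fintype ι] [DecidableEq ι] {b : Module.Basis (ι ⊕ ι) (ZMod p) V}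
    {W : S.left.Opens} (h : W ≤ U) (A : Matrix ι ι Γ(S.left, U)) (j : ι) :
    Sec.res h (col b A j) = col b (A.map (rs h)) j := by
  apply (crd b _).injective
  rw [crd_res]
  ext (i | i)
  · simp only [Function.comp_apply, crd_col_inl, Matrix.one_apply]
    split_ifs <;> simp
  · simp [Function.comp_apply, crd_col_inr]

theorem frob_eq_of_isUnit {O : Type*} [CommRing O] {A : Matrix (Option (Fin m)) (Option (Fin m)) O}
    {η : O} (h : η * (A none none ^ p - A none none) = 1) (i j : Option (Fin m)) :
    A i j ^ p - A i j = (A i none ^ p - A i none) * (η * (A none j ^ p - A none j)) ↔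
      (A none none ^ p - A none none) * (A i j ^ p - A i j) =
        (A i none ^ p - A i none) * (A none j ^ p - A none j) := by
  constructor
  · intro h'
    linear_combination (A none none ^ p - A none none) * h' +
      ((A i none ^ p - A i none) * (A none j ^ p - A none j)) * h
  · intro h'
    linear_combination η * h' - (A i j ^ p - A i j) * h

/-- A graph over all of `S` is a characteristic subspace if and only if its matrix satisfies the
equations of the chart. -/
theorem IsGraphOn.isCharacteristic_iff (hp : 3 ≤ p) (hb : IsAdapted B c d b)
    {A : Matrix (Option (Fin m)) (Option (Fin m)) Γ(S.left, ⊤)} (H : IsGraphOn b K ⊤ A) :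
    K.IsCharacteristic B (m + 1) ↔ ChartEqs c d A := by
  have hη (h : A none none ^ 2 = algebraMap _ Γ(S.left, ⊤) d) :
      A none none ^ p - A none none = -2 * A none none ∧
      ∃ η, η * (A none none ^ p - A none none) = 1 := by
    have h1 : A none none ^ p - A none none = -2 * A none none := by
      rw [pow_prime_eq_neg hp hb.not_isSquare h]
      ring
    refine ⟨h1, ?_⟩
    have hd : d ≠ 0 := by
      rintro rfl
      exact hb.not_isSquare IsSquare.zero
    have h3 : IsUnit (A none none) := by
      rw [← isUnit_pow_iff two_ne_zero, h]
      exact isUnit_algebraMap_zmod hd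
    have h4 : IsUnit (-2 * A none none) := (isUnit_two hp).neg.mul h3
    obtain ⟨η, hη⟩ := h4.exists_left_inv
    exact ⟨η, by rw [h1, hη]⟩
  constructor
  · intro hK
    obtain ⟨h1, h2, h3⟩ := (hb.col_eqs_iff A).1 fun i j ↦
      hK.isotropic ⊤ _ (H.col_mem i) _ (H.col_mem j)
    refine ⟨h1, h2, h3, fun i j ↦ ?_⟩
    obtain ⟨h4, η, hη⟩ := hη h1
    rw [← h4, ← frob_eq_of_isUnit hη]
    refine section_ext_of_local fun x _ ↦ ?_
    obtain ⟨U, hx, e, α, he⟩ := exists_isFrameOn b hK.locallyFree_addFrob hK.summand_addFrob x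
    refine ⟨U, le_top, hx, ?_⟩
    have hη' : rs le_top η * ((A.map (rs (le_top : U ≤ ⊤))) none none ^ p -
        (A.map (rs (le_top : U ≤ ⊤))) none none) = 1 := by
      simpa using congr(rs (le_top : U ≤ ⊤) $hη)
    have HU := H.restrict (le_top : U ≤ ⊤)
    have hL := isFrameOn_ofFrame b (frobCoframe_mul_frobFrame _ hη')
    have hle : (ofFrame b U (frobFrame (p := p) (A.map (rs le_top)))
        (frobCoframe (A.map (rs le_top)) (rs le_top η))).obj U ≤ K.addFrob.obj U := by
      refine hL.obj_le ?_ le_rfl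
      rintro (j | j)
      · rw [symm_frobFrame_inl]
        exact le_addFrob K _ (HU.col_mem j)
      · rw [symm_frobFrame_inr]
        exact sub_mem (frob_mem_addFrob (HU.col_mem none)) (le_addFrob K _ (HU.col_mem none))
    have heq := hL.obj_eq_of_le he (by simp) hle le_rfl
    have hmem := heq ▸ frob_mem_addFrob (HU.col_mem j)
    have := (hL.mem_iff le_rfl).1 hmem
    rw [map_rs_refl, map_rs_refl, frob_col_iff] at this
    have := this i
    simp only [Matrix.map_apply, ← map_pow, ← map_sub, ← map_mul] at this
    exact this
  · intro hA
    obtain ⟨h4, η, hη⟩ := hη hA.sq_eq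
    have hL := isFrameOn_ofFrame b (frobCoframe_mul_frobFrame _ hη)
    have hfr (j : Option (Fin m)) : frob V _ (col b A j) ∈
        (ofFrame b ⊤ (frobFrame (p := p) A) (frobCoframe A η)).obj ⊤ := by
      rw [hL.mem_iff le_rfl, map_rs_refl, map_rs_refl, frob_col_iff]
      intro i
      rw [frob_eq_of_isUnit hη, h4]
      exact hA.frob_eq i j
    have hcol (j : Option (Fin m)) : col b A j ∈
        (ofFrame b ⊤ (frobFrame (p := p) A) (frobCoframe A η)).obj ⊤ := by
      rw [← symm_frobFrame_inl]
      exact hL.col_mem (.inl j)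
    have heq : K.addFrob = ofFrame b ⊤ (frobFrame (p := p) A) (frobCoframe A η) := by
      apply le_antisymm
      · rw [addFrob_le_iff]
        constructor
        · intro W s hs
          rw [(H.restrict (le_top : W ≤ ⊤)).eq_sum_col hs]
          refine sum_mem fun j _ ↦ Submodule.smul_mem _ _ ?_
          rw [← res_col]
          exact res_mem _ _ (hcol j)
        · intro W s hs
          rw [mem_frobPreimage, (H.restrict (le_top : W ≤ ⊤)).eq_sum_col hs, map_sum]
          refine sum_mem fun j _ ↦ ?_
          rw [frob_smul, ← res_col, Sec.frob_res]
          exact Submodule.smul_mem _ _ (res_mem _ _ (hfr j))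
      · intro W
        refine hL.obj_le ?_ le_top
        rintro (j | j)
        · rw [symm_frobFrame_inl]
          exact le_addFrob K _ (H.col_mem j)
        · rw [symm_frobFrame_inr]
          exact sub_mem (frob_mem_addFrob (H.col_mem none)) (le_addFrob K _ (H.col_mem none))
    have h5 : K.IsLocallyFreeOfRank (m + 1) ∧ K.IsLocallyDirectSummand :=
      locallyFree_of_isFrameOn b (ι := Option (Fin m)) (by simp) fun x ↦ ⟨⊤, trivial, _, _, H⟩
    have h6 : K.addFrob.IsLocallyFreeOfRank (m + 1 + 1) ∧ K.addFrob.IsLocallyDirectSummand :=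
      locallyFree_of_isFrameOn b (ι := Option (Fin m) ⊕ Unit) (by simp)
        fun x ↦ ⟨⊤, trivial, _, _, heq ▸ hL⟩
    refine ⟨fun W s hs t ht ↦ ?_, h5.1, h5.2, h6.1, h6.2⟩
    have HW := H.restrict (le_top : W ≤ ⊤)
    have hAW := hA.map (rs (le_top : W ≤ ⊤))
    have h0 := (hb.col_eqs_iff (A.map (rs le_top))).2 ⟨hAW.sq_eq, hAW.row_eq, hAW.add_eq⟩
    rw [HW.eq_sum_col hs, HW.eq_sum_col ht, LinearMap.BilinForm.sum_left]
    refine Finset.sum_eq_zero fun i _ ↦ ?_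
    rw [LinearMap.BilinForm.sum_right]
    refine Finset.sum_eq_zero fun j _ ↦ ?_
    rw [LinearMap.BilinForm.smul_left, LinearMap.BilinForm.smul_right, h0, mul_zero, mul_zero]

end Submod

end Adapted

end PeriodSpace

namespace PeriodSpace

variable {p : ℕ} [Fact p.Prime]

/-! ## Existence of adapted bases -/

section Existence

variable {V : Type*} [AddCommGroup V] [Module (ZMod p) V] [Module.Finite (ZMod p) V]
  {B : LinearMap.BilinForm (ZMod p) V}

theorem exists_ne_zero_orthogonal (B : LinearMap.BilinForm (ZMod p) V) {ι : Type*} [Fintype ι]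
    (w : ι → V) (h : Fintype.card ι < Module.finrank (ZMod p) V) :
    ∃ v ≠ 0, ∀ i, B v (w i) = 0 := by
  have := LinearMap.ker_ne_bot_of_finrank_lt (f := LinearMap.pi fun i ↦ B.flip (w i))
    (by simpa using h)
  obtain ⟨v, hv, hv0⟩ := (Submodule.ne_bot_iff _).1 this
  exact ⟨v, hv0, fun i ↦ congr_fun (LinearMap.mem_ker.1 hv) i⟩

/-- Orthogonal families of isotropic vectors `n` and `n'` which are dual to each other. -/
structure IsHyperbolic (B : LinearMap.BilinForm (ZMod p) V) {j : ℕ} (n n' : Fin j → V) : Prop where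
  left : ∀ i k, B (n i) (n k) = 0
  right : ∀ i k, B (n' i) (n' k) = 0
  dual : ∀ i k, B (n i) (n' k) = if i = k then 1 else 0

theorem IsHyperbolic.exists_partner (hp : 3 ≤ p) (hsymm : B.IsSymm) (hnondeg : B.Nondegenerate)
    {j : ℕ} {n n' : Fin j → V} (H : IsHyperbolic B n n') {v : V} (hv0 : v ≠ 0) (hv : B v v = 0)
    (h1 : ∀ i, B v (n i) = 0) (h2 : ∀ i, B v (n' i) = 0) :
    ∃ v', B v v' = 1 ∧ B v' v' = 0 ∧ (∀ i, B v' (n i) = 0) ∧ ∀ i, B v' (n' i) = 0 := by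
  have hs (x y : V) : B x y = B y x := hsymm.eq x y
  obtain ⟨u, hu⟩ : ∃ u, B v u ≠ 0 := by
    by_contra! hcon
    exact hv0 (hnondeg.1 v hcon)
  set w := (B v u)⁻¹ • (u - ∑ i, B u (n' i) • n i - ∑ i, B u (n i) • n' i) with hw
  have hvw : B v w = 1 := by
    simp [hw, h1, h2, hu]
  have hwn (i : Fin j) : B w (n i) = 0 := by
    simp [hw, H.left, hs (n' _) (n i), H.dual]
  have hwn' (i : Fin j) : B w (n' i) = 0 := by
    simp [hw, H.right, H.dual]
  refine ⟨w - (B w w / 2) • v, ?_, ?_, fun i ↦ ?_, fun i ↦ ?_⟩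
  · simp [hvw, hv]
  · have := two_ne_zero_zmod hp
    simp only [map_sub, map_smul, LinearMap.sub_apply, LinearMap.smul_apply, hs w v, hvw, hv,
      smul_eq_mul]
    field_simp
    ring
  · simp [hwn, h1]
  · simp [hwn', h2]

theorem IsHyperbolic.exists_isotropic (hp : 3 ≤ p) (hsymm : B.IsSymm)
    {j : ℕ} {n n' : Fin j → V} (hj : 2 * j + 2 < Module.finrank (ZMod p) V) :
    ∃ v ≠ 0, B v v = 0 ∧ (∀ i, B v (n i) = 0) ∧ ∀ i, B v (n' i) = 0 := by
  have hs (x y : V) : B x y = B y x := hsymm.eq x y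
  obtain ⟨w₁, hw₁, h₁⟩ := exists_ne_zero_orthogonal B (Sum.elim n n') (by simp; omega)
  obtain ⟨w₂, hw₂, h₂⟩ := exists_ne_zero_orthogonal B (Sum.elim (Sum.elim n n') ![w₁])
    (by simp; omega)
  obtain ⟨w₃, hw₃, h₃⟩ := exists_ne_zero_orthogonal B (Sum.elim (Sum.elim n n') ![w₁, w₂])
    (by simp; omega)
  simp only [Sum.forall, Sum.elim_inl, Sum.elim_inr, Fin.forall_fin_one, Fin.forall_fin_two,
    Matrix.cons_val_zero, Matrix.cons_val_one] at h₁ h₂ h₃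
  by_cases e₁ : B w₁ w₁ = 0
  · exact ⟨w₁, hw₁, e₁, h₁⟩
  by_cases e₂ : B w₂ w₂ = 0
  · exact ⟨w₂, hw₂, e₂, h₂.1⟩
  by_cases e₃ : B w₃ w₃ = 0
  · exact ⟨w₃, hw₃, e₃, h₃.1⟩
  have hdeg : (Polynomial.C (B w₁ w₁) * Polynomial.X ^ 2 + Polynomial.C (B w₃ w₃)).degree = 2 := by
    simpa using Polynomial.degree_quadratic (a := B w₁ w₁) (b := 0) (c := B w₃ w₃) e₁
  have hdeg' : (Polynomial.C (B w₂ w₂) * Polynomial.X ^ 2).degree = 2 :=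
    Polynomial.degree_C_mul_X_pow 2 e₂
  obtain ⟨x, y, hxy⟩ := FiniteField.exists_root_sum_quadratic hdeg hdeg' (by
    rw [ZMod.card]
    exact Nat.odd_iff.1 ((Fact.out : p.Prime).odd_of_ne_two (by omega)))
  simp only [Polynomial.eval_add, Polynomial.eval_mul, Polynomial.eval_C, Polynomial.eval_pow,
    Polynomial.eval_X] at hxy
  refine ⟨x • w₁ + y • w₂ + w₃, fun h0 ↦ e₃ ?_, ?_, fun i ↦ ?_, fun i ↦ ?_⟩
  · have := congr(B w₃ $h0)
    simpa [h₃.2] using this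
  · simp only [map_add, map_smul, LinearMap.add_apply, LinearMap.smul_apply, smul_eq_mul,
      h₃.2, h₂.2, hs w₁ w₂, hs w₁ w₃, hs w₂ w₃]
    linear_combination hxy
  · simp [h₁, h₂, h₃]
  · simp [h₁, h₂, h₃]

theorem exists_isHyperbolic (hp : 3 ≤ p) (hsymm : B.IsSymm) (hnondeg : B.Nondegenerate)
    {κ : Type*} [Field κ] [Algebra (ZMod p) κ] (X : Submodule κ (κ ⊗[ZMod p] V))
    (hX : ∀ s ∈ X, ∀ t ∈ X, B.baseChange κ s t = 0)
    (j : ℕ) (hj : 2 * j < Module.finrank (ZMod p) V) (heven : Even (Module.finrank (ZMod p) V)) :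
    ∃ n n' : Fin j → V, IsHyperbolic B n n' ∧
      ∀ a : Fin j → κ, ∑ i, a i ⊗ₜ[ZMod p] n i ∈ X → a = 0 := by
  have hs (x y : V) : B x y = B y x := hsymm.eq x y
  induction j with
  | zero =>
    exact ⟨Fin.elim0, Fin.elim0, ⟨fun i ↦ i.elim0, fun i ↦ i.elim0, fun i ↦ i.elim0⟩,
      fun a _ ↦ funext fun i ↦ i.elim0⟩
  | succ j ih =>
    obtain ⟨n, n', H, hn⟩ := ih (by omega)
    obtain ⟨v, hv0, hvv, hvn, hvn'⟩ := IsHyperbolic.exists_isotropic (n := n) (n' := n') hp hsymm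
      (by obtain ⟨r, hr⟩ := heven; omega)
    obtain ⟨v', hvv', hv'v', hv'n, hv'n'⟩ := H.exists_partner hp hsymm hnondeg hv0 hvv hvn hvn'
    have key (v v' : V) (hvv : B v v = 0) (hvv' : B v v' = 1) (hv'v' : B v' v' = 0)
        (hvn : ∀ i, B v (n i) = 0) (hvn' : ∀ i, B v (n' i) = 0) (hv'n : ∀ i, B v' (n i) = 0)
        (hv'n' : ∀ i, B v' (n' i) = 0)
        (hK : ∀ a : Fin j → κ, ∑ i, a i ⊗ₜ[ZMod p] n i + 1 ⊗ₜ v ∉ X) :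
        ∃ n n' : Fin (j + 1) → V, IsHyperbolic B n n' ∧
          ∀ a : Fin (j + 1) → κ, ∑ i, a i ⊗ₜ[ZMod p] n i ∈ X → a = 0 := by
      refine ⟨Fin.snoc n v, Fin.snoc n' v', ⟨?_, ?_, ?_⟩, fun a ha ↦ ?_⟩
      · simp [Fin.forall_fin_succ', H.left, hvn, hs _ v, hvv]
      · simp [Fin.forall_fin_succ', H.right, hv'n', hs _ v', hv'v']
      · simp [Fin.forall_fin_succ', H.dual, hvv', hvn', hs (n _) v', hv'n, Fin.castSucc_ne_last,
          (Fin.castSucc_ne_last _).symm]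
      · rw [Fin.sum_univ_castSucc] at ha
        simp only [Fin.snoc_castSucc, Fin.snoc_last] at ha
        have hlast : a (Fin.last j) = 0 := by
          by_contra h0
          refine hK (fun i ↦ (a (Fin.last j))⁻¹ * a i.castSucc) ?_
          have := X.smul_mem (a (Fin.last j))⁻¹ ha
          simpa [smul_add, Finset.smul_sum, TensorProduct.smul_tmul', h0] using this
        rw [hlast, TensorProduct.zero_tmul, add_zero] at ha
        have := hn _ ha
        ext i
        refine Fin.lastCases hlast (fun i ↦ congr_fun this i) i
    by_cases hK : ∀ a : Fin j → κ, ∑ i, a i ⊗ₜ[ZMod p] n i + 1 ⊗ₜ v ∉ X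
    · exact key v v' hvv hvv' hv'v' hvn hvn' hv'n hv'n' hK
    by_cases hK' : ∀ a : Fin j → κ, ∑ i, a i ⊗ₜ[ZMod p] n i + 1 ⊗ₜ v' ∉ X
    · exact key v' v hv'v' (by rw [hs, hvv']) hvv hv'n hv'n' hvn hvn' hK'
    push Not at hK hK'
    obtain ⟨a, ha⟩ := hK
    obtain ⟨a', ha'⟩ := hK'
    have hnv (i) : B (n i) v' = 0 := by rw [hs, hv'n]
    have := hX _ ha _ ha'
    simp [LinearMap.BilinForm.add_right, LinearMap.BilinForm.baseChange_tmul, H.left, hvn, hnv, hvv'] at this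

/-- Every totally isotropic subspace over an extension field is transverse to the second half of
some adapted basis. -/
theorem exists_isAdapted (hp : 3 ≤ p) {m : ℕ} (hdim : Module.finrank (ZMod p) V = 2 * (m + 1))
    (hsymm : B.IsSymm) (hnondeg : B.Nondegenerate) (hnonneutral : ¬ IsNeutral B (m + 1))
    {κ : Type*} [Field κ] [Algebra (ZMod p) κ] (X : Submodule κ (κ ⊗[ZMod p] V))
    (hX : ∀ s ∈ X, ∀ t ∈ X, B.baseChange κ s t = 0) :
    ∃ (c d : ZMod p) (b : Module.Basis (Option (Fin m) ⊕ Option (Fin m)) (ZMod p) V),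
      IsAdapted B c d b ∧ ∀ s ∈ X, (∀ i, crd b κ s (.inl i) = 0) → s = 0 := by
  have hs (x y : V) : B x y = B y x := hsymm.eq x y
  obtain ⟨n, n', H, hn⟩ := exists_isHyperbolic hp hsymm hnondeg X hX m (by omega)
    (by rw [hdim]; exact even_two_mul _)
  obtain ⟨f₁, hf₁, h₁⟩ := exists_ne_zero_orthogonal B (Sum.elim n n') (by simp; omega)
  obtain ⟨f₂, hf₂, h₂⟩ := exists_ne_zero_orthogonal B (Sum.elim (Sum.elim n n') ![f₁])
    (by simp; omega)
  simp only [Sum.forall, Sum.elim_inl, Sum.elim_inr, Fin.forall_fin_one,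
    Matrix.cons_val_zero] at h₁ h₂
  have haniso (v : V) (hv0 : v ≠ 0) (hvn : ∀ i, B v (n i) = 0) (hvn' : ∀ i, B v (n' i) = 0) :
      B v v ≠ 0 := by
    intro hvv
    obtain ⟨v', hvv', hv'v', hv'n, hv'n'⟩ := H.exists_partner hp hsymm hnondeg hv0 hvv hvn hvn'
    refine hnonneutral ⟨Submodule.span _ (Set.range (Fin.snoc n v : Fin (m + 1) → V)), ?_, ?_⟩
    · rw [finrank_span_eq_card, Fintype.card_fin]
      rw [Fintype.linearIndependent_iff]
      intro a ha
      rw [Fin.sum_univ_castSucc] at ha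
      simp only [Fin.snoc_castSucc, Fin.snoc_last] at ha
      refine Fin.lastCases ?_ fun i ↦ ?_
      · simpa [hs (n _) v', hv'n, hvv'] using congr(B $ha v')
      · simpa [H.dual, hvn'] using congr(B $ha (n' i))
    · intro x hx y hy
      induction hx, hy using Submodule.span_induction₂ with
      | mem_mem x y hx hy =>
        obtain ⟨i, rfl⟩ := hx
        obtain ⟨k, rfl⟩ := hy
        revert i k
        simp [Fin.forall_fin_succ', H.left, hvn, hs _ v, hvv]
      | zero_left => simp
      | zero_right => simp
      | add_left _ _ _ _ _ _ h h' => simp [h, h']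
      | add_right _ _ _ _ _ _ h h' => simp [h, h']
      | smul_left _ _ _ _ _ h => simp [h]
      | smul_right _ _ _ _ _ h => simp [h]
  have hc := haniso f₁ hf₁ h₁.1 h₁.2
  set c := B f₁ f₁
  set d := -(B f₂ f₂ / c) with hd
  let w : Option (Fin m) ⊕ Option (Fin m) → V :=
    Sum.elim (fun i ↦ i.elim f₂ n') (fun i ↦ i.elim f₁ n)
  have hw (x y) : B (w x) (w y) = gram c d x y := by
    have h3 : B f₂ f₂ = -(c * d) := by rw [hd]; field_simp
    obtain (_ | i) | (_ | i) := x <;> obtain (_ | k) | (_ | k) := y <;>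
      simp [w, gram, h₂, h₁, h3, H.left, H.right, H.dual, hs (n _) f₁, hs (n' _) f₁, hs (n _) f₂,
        hs (n' _) f₂, hs f₁ f₂, hs (n' _) (n _), c,
        eq_comm]
  have hdsq : ¬ IsSquare d := by
    rintro ⟨r, hr⟩
    refine haniso (r • f₁ + f₂) (fun h0 ↦ haniso f₂ hf₂ h₂.1.1 h₂.1.2 ?_) (fun i ↦ ?_)
      (fun i ↦ ?_) ?_
    · simpa [h₂.2] using congr(B f₂ $h0)
    · simp [h₁, h₂]
    · simp [h₁, h₂]
    · have h3 : B f₂ f₂ = -(c * d) := by rw [hd]; field_simp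
      simp only [map_add, map_smul, LinearMap.add_apply, LinearMap.smul_apply, smul_eq_mul, h₂.2,
        hs f₁ f₂, h3, hr]
      ring
  have hd0 : d ≠ 0 := by
    rintro h0
    exact hdsq (h0 ▸ IsSquare.zero)
  have hli : LinearIndependent (ZMod p) w := by
    rw [Fintype.linearIndependent_iff]
    intro a ha
    have h4 (y) : ∑ x, a x * gram c d x y = 0 := by
      simpa [hw] using congr(B $ha (w y))
    rintro ((_ | i) | (_ | i))
    · simpa [gram, hc, hd0] using h4 (.inl none)
    · simpa [gram] using h4 (.inr (some i))
    · simpa [gram, hc] using h4 (.inr none)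
    · simpa [gram] using h4 (.inl (some i))
  let b := basisOfLinearIndependentOfCardEqFinrank hli (by simp [hdim]; ring)
  have hbw (x) : b x = w x := by simp [b]
  have hb : IsAdapted B c d b := ⟨fun x y ↦ by rw [hbw, hbw, hw], hc, hdsq⟩
  refine ⟨c, d, b, hb, fun s hsX hs0 ↦ ?_⟩
  have h5 := hX s hsX s hsX
  rw [hb.baseChange_eq] at h5
  simp only [hs0, mul_zero, zero_mul, add_zero, Finset.sum_const_zero, sub_zero, mul_eq_zero] at h5
  have h6 : crd b κ s (.inr none) = 0 := by
    have := (isUnit_algebraMap_zmod (O := κ) hc).ne_zero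
    tauto
  have h7 : s = ∑ i, crd b κ s (.inr (some i)) ⊗ₜ[ZMod p] n i := by
    conv_lhs => rw [← (crd b κ).symm_apply_apply s, crd_symm_apply]
    simp [hs0, h6, hbw, w]
  have h8 := hn _ (h7 ▸ hsX)
  rw [h7]
  exact Finset.sum_eq_zero fun i _ ↦ by
    rw [show crd b κ s (.inr (some i)) = 0 from congr_fun h8 i, TensorProduct.zero_tmul]

end Existence

end PeriodSpace

namespace PeriodSpace

/-! ## The coordinate ring of a chart -/

section ReducedPolynomials

open MvPolynomial

variable {ι A : Type*} [CommRing A]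

/-- The ideal generated by the Artin–Schreier polynomials `X_q ^ p - X_q - f_q`. -/
def artinSchreierIdeal (p : ℕ) (f : ι → A) : Ideal (MvPolynomial ι A) :=
  Ideal.span (Set.range fun q ↦ X q ^ p - X q - C (f q))

theorem monomial_mul_X_mem {p : ℕ} (hp : 2 ≤ p) (f : ι → A) (s : ι →₀ ℕ) (hs : ∀ i, s i ≤ p - 1)
    (a : A) (q : ι) : monomial s a * X q ∈
      restrictDegree ι A (p - 1) ⊔ (artinSchreierIdeal p f).restrictScalars A := by
  classical
  have hmon (s : ι →₀ ℕ) (hs : ∀ i, s i ≤ p - 1) (a : A) :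
      monomial s a ∈ restrictDegree ι A (p - 1) := by
    rw [mem_restrictDegree]
    intro t ht i
    rw [Finset.mem_singleton.1 (support_monomial_subset ht)]
    exact hs i
  by_cases h : s q + 1 ≤ p - 1
  · refine Submodule.mem_sup_left ?_
    rw [← pow_one (X q), ← monomial_add_single]
    refine hmon _ (fun i ↦ ?_) a
    rw [Finsupp.add_apply, Finsupp.single_apply]
    split_ifs with hi
    · exact hi ▸ h
    · exact hs i
  · have hsq : s q + 1 = p := by have := hs q; omega
    have h1 : monomial s a * X q = monomial (s.erase q) a * (X q ^ p - X q - C (f q)) +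
        (monomial (s.erase q + Finsupp.single q 1) a + monomial (s.erase q) (a * f q)) := by
      have h2 : monomial s a = monomial (s.erase q) a * X q ^ s q := by
        rw [← monomial_add_single, add_comm, Finsupp.single_add_erase]
      have h3 : monomial (s.erase q) (a * f q) = monomial (s.erase q) a * C (f q) := by
        rw [mul_comm _ (C _), C_mul_monomial, mul_comm]
      rw [monomial_add_single, h2, h3, mul_assoc, ← pow_succ, hsq]
      ring
    rw [h1]
    refine add_mem (Submodule.mem_sup_right ?_) (Submodule.mem_sup_left (add_mem (hmon _ ?_ _)
      (hmon _ ?_ _)))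
    · exact Ideal.mul_mem_left _ _ (Ideal.subset_span ⟨q, rfl⟩)
    · intro i
      rw [Finsupp.add_apply, Finsupp.single_apply, Finsupp.erase_apply]
      split_ifs with hi hi' hi'
      · omega
      · exact absurd hi.symm hi'
      · exact absurd hi'.symm hi
      · simpa using hs i
    · intro i
      rw [Finsupp.erase_apply]
      split_ifs
      · omega
      · exact hs i

theorem exists_reduced {p : ℕ} (hp : 2 ≤ p) (f : ι → A) (P : MvPolynomial ι A) :
    ∃ P' : MvPolynomial ι A, (∀ q, P'.degreeOf q < p) ∧ P - P' ∈ artinSchreierIdeal p f := by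
  classical
  have key : P ∈ restrictDegree ι A (p - 1) ⊔ (artinSchreierIdeal p f).restrictScalars A := by
    induction P using MvPolynomial.induction_on with
    | C a =>
      refine Submodule.mem_sup_left ?_
      rw [mem_restrictDegree]
      intro s hs i
      rw [C_apply] at hs
      rw [Finset.mem_singleton.1 (support_monomial_subset hs)]
      simp
    | add P Q hP hQ => exact add_mem hP hQ
    | mul_X P q hP =>
      obtain ⟨r, hr, i, hi, rfl⟩ := Submodule.mem_sup.1 hP
      rw [add_mul]
      refine add_mem ?_ (Submodule.mem_sup_right (Ideal.mul_mem_right _ _ hi))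
      rw [r.as_sum, Finset.sum_mul]
      refine sum_mem fun s hs ↦ monomial_mul_X_mem hp f s ?_ _ q
      exact (mem_restrictDegree _ _ _).1 hr s hs
  obtain ⟨r, hr, i, hi, rfl⟩ := Submodule.mem_sup.1 key
  refine ⟨r, fun q ↦ ?_, by simpa using hi⟩
  have : r.degreeOf q ≤ p - 1 :=
    degreeOf_le_iff.2 fun s hs ↦ (mem_restrictDegree _ _ _).1 hr s hs q
  omega

end ReducedPolynomials

section ArtinSchreier

variable {p : ℕ} [Fact p.Prime]

theorem exists_zmod_of_pow_eq {Ω : Type*} [Field Ω] [CharP Ω p] [Algebra (ZMod p) Ω] {x : Ω}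
    (hx : x ^ p = x) : ∃ n : ZMod p, algebraMap _ Ω n = x := by
  have hroots := FiniteField.roots_X_pow_card_sub_X (ZMod p)
  rw [ZMod.card] at hroots
  by_contra! hcon
  have hp1 : 1 < p := (Fact.out : p.Prime).one_lt
  have hne : (Polynomial.X ^ p - Polynomial.X : Polynomial Ω) ≠ 0 :=
    FiniteField.X_pow_card_sub_X_ne_zero Ω hp1
  classical
  have hsub : insert x (Finset.univ.image (algebraMap (ZMod p) Ω)) ⊆
      (Polynomial.X ^ p - Polynomial.X : Polynomial Ω).roots.toFinset := by
    intro y hy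
    rw [Multiset.mem_toFinset, Polynomial.mem_roots hne]
    rw [Finset.mem_insert, Finset.mem_image] at hy
    obtain rfl | ⟨n, -, rfl⟩ := hy
    · simp [hx]
    · simp [← map_pow, ZMod.pow_card]
  have h1 := Finset.card_le_card hsub
  rw [Finset.card_insert_of_notMem (by simpa using hcon),
    Finset.card_image_of_injective _ (algebraMap (ZMod p) Ω).injective, Finset.card_univ,
    ZMod.card] at h1
  have h2 := (Multiset.toFinset_card_le _).trans
    (Polynomial.card_roots' (Polynomial.X ^ p - Polynomial.X : Polynomial Ω))
  rw [FiniteField.X_pow_card_sub_X_natDegree_eq Ω hp1] at h2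
  omega

/-- Independent Artin–Schreier extensions: a reduced polynomial which vanishes at the roots of
`X ^ p - X - f_q` is zero. -/
theorem eq_zero_of_aeval_eq_zero {F Ω ι : Type*} [Field F] [Field Ω] [Algebra F Ω] [IsGalois F Ω]
    [CharP Ω p] [Algebra (ZMod p) F] [Algebra (ZMod p) Ω] [Fintype ι]
    {f : ι → F}
    (hf : ∀ (n : ι → ZMod p) (y : F), y ^ p - y = ∑ q, n q • f q → n = 0)
    {s : ι → Ω} (hs : ∀ q, s q ^ p - s q = algebraMap F Ω (f q))
    {P : MvPolynomial ι F} (hdeg : ∀ q, P.degreeOf q < p) (hP : MvPolynomial.aeval s P = 0) :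
    P = 0 := by
  classical
  have hχ (g : Gal(Ω/F)) (q : ι) : ∃ n : ZMod p, algebraMap _ Ω n = g (s q) - s q := by
    apply exists_zmod_of_pow_eq
    have h1 := congr(g $(hs q))
    rw [map_sub, map_pow, g.commutes, ← hs q] at h1
    rw [sub_pow_char]
    linear_combination h1
  choose χ hχ using hχ
  have hg (g : Gal(Ω/F)) (q : ι) : g (s q) = s q + algebraMap _ Ω (χ g q) := by
    rw [hχ]; ring
  have hgz (g : Gal(Ω/F)) (n : ZMod p) : g (algebraMap _ Ω n) = algebraMap _ Ω n :=
    map_algebraMap_zmod (g : Ω →+* Ω) n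
  have hinj : Function.Injective (algebraMap (ZMod p) Ω) := (algebraMap (ZMod p) Ω).injective
  let N : AddSubgroup (ι → ZMod p) :=
    { carrier := Set.range χ
      add_mem' := by
        rintro _ _ ⟨g, rfl⟩ ⟨h, rfl⟩
        refine ⟨g * h, funext fun q ↦ hinj ?_⟩
        rw [hχ, AlgEquiv.mul_apply, hg h, map_add, hg g, hgz, Pi.add_apply, map_add]
        ring
      zero_mem' := ⟨1, funext fun q ↦ hinj (by rw [hχ]; simp)⟩
      neg_mem' := by
        rintro _ ⟨g, rfl⟩
        refine ⟨g⁻¹, funext fun q ↦ hinj ?_⟩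
        have h1 : g⁻¹ (g (s q)) = s q := by
          rw [← AlgEquiv.mul_apply, inv_mul_cancel, AlgEquiv.one_apply]
        rw [hg g, map_add, hgz] at h1
        rw [hχ, Pi.neg_apply, map_neg]
        linear_combination h1 }
  have htop : N = ⊤ := by
    by_contra hne
    have hlt : AddSubgroup.toZModSubmodule p N < ⊤ := by
      rw [lt_top_iff_ne_top]
      intro h
      apply hne
      rw [← (AddSubgroup.toZModSubmodule p).injective.eq_iff, h]
      exact (map_top _).symm
    obtain ⟨l, hl0, hl⟩ := Submodule.exists_le_ker_of_lt_top _ hlt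
    have hlsum (v : ι → ZMod p) : l v = ∑ q, v q * l (Pi.single q 1) := by
      conv_lhs => rw [← Finset.univ_sum_single v, map_sum]
      refine Finset.sum_congr rfl fun q _ ↦ ?_
      rw [← smul_eq_mul, ← map_smul]
      congr 1
      ext i
      simp [Pi.single_apply]
    have hfix : (∑ q, algebraMap _ Ω (l (Pi.single q 1)) * s q) ∈ (⊥ : IntermediateField F Ω) := by
      rw [InfiniteGalois.mem_bot_iff_fixed]
      intro g
      have h1 : l (χ g) = 0 := hl ⟨g, rfl⟩
      rw [hlsum] at h1
      have h2 := congr(algebraMap (ZMod p) Ω $h1)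
      simp only [map_sum, map_mul, map_zero] at h2
      simp only [map_sum, map_mul, hgz, hg, mul_add, Finset.sum_add_distrib]
      rw [add_eq_left, ← h2]
      exact Finset.sum_congr rfl fun q _ ↦ mul_comm _ _
    obtain ⟨y, hy⟩ := IntermediateField.mem_bot.1 hfix
    have h3 := hf (fun q ↦ l (Pi.single q 1)) y ((algebraMap F Ω).injective ?_)
    · refine hl0 (LinearMap.ext fun v ↦ ?_)
      rw [hlsum]
      exact Finset.sum_eq_zero fun q _ ↦ by
        rw [show l (Pi.single q 1) = 0 from congr_fun h3 q, mul_zero]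
    · rw [map_sub, map_pow, hy, sum_pow_char, ← Finset.sum_sub_distrib, map_sum]
      refine Finset.sum_congr rfl fun q _ ↦ ?_
      rw [mul_pow, ← map_pow, ZMod.pow_card, ← mul_sub, hs, Algebra.smul_def, map_mul,
        map_algebraMap_zmod]
  have hmap : MvPolynomial.map (algebraMap F Ω) P = 0 := by
    refine MvPolynomial.eq_zero_of_eval_zero_at_prod_finset _
      (fun q ↦ Finset.univ.image fun n : ZMod p ↦ s q + algebraMap _ Ω n) (fun q ↦ ?_)
      fun x hx ↦ ?_
    · have h1 : Function.Injective fun n : ZMod p ↦ s q + algebraMap _ Ω n :=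
        (add_right_injective (s q)).comp hinj
      rw [Finset.card_image_of_injective _ h1, Finset.card_univ, ZMod.card]
      refine lt_of_le_of_lt ?_ (hdeg q)
      exact MvPolynomial.degreeOf_le_iff.2 fun t ht ↦
        MvPolynomial.degreeOf_le_iff.1 le_rfl t (MvPolynomial.support_map_subset _ _ ht)
    · simp only [Finset.mem_image, Finset.mem_univ, true_and] at hx
      choose n hn using hx
      obtain ⟨g, rfl⟩ : n ∈ N := htop ▸ AddSubgroup.mem_top n
      have hx' : x = fun q ↦ g (s q) := funext fun q ↦ by rw [← hn, hg]
      rw [MvPolynomial.eval_map, ← MvPolynomial.aeval_def, hx']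
      exact (MvPolynomial.comp_aeval_apply s g.toAlgHom P).symm.trans (by rw [hP, map_zero])
  exact MvPolynomial.map_injective _ (algebraMap F Ω).injective (by rw [hmap, map_zero])

end ArtinSchreier

end PeriodSpace

namespace PeriodSpace

section ChartRing

open MvPolynomial

variable (p : ℕ) [Fact p.Prime] (k : Type*) [Field k] (m : ℕ)

/-- Pairs of indices `i < j`. -/
abbrev Pairs (m : ℕ) := {q : Fin m × Fin m // q.1 < q.2}

/-- The polynomial `X_i X_j ^ p - X_i ^ p X_j`. -/
def relPoly {m : ℕ} (q : Pairs m) : MvPolynomial (Fin m) k :=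
  X q.1.1 * X q.1.2 ^ p - X q.1.1 ^ p * X q.1.2

/-- The coordinate ring of a chart of the period space. -/
abbrev ChartRing := MvPolynomial (Pairs m) (MvPolynomial (Fin m) k) ⧸
  artinSchreierIdeal p (relPoly p k (m := m))

variable {p k m}

theorem relPoly_isHomogeneous (q : Pairs m) : (relPoly p k q).IsHomogeneous (p + 1) := by
  refine IsHomogeneous.sub ?_ ?_
  · rw [add_comm]
    exact (isHomogeneous_X _ _).mul (by simpa using (isHomogeneous_X k q.1.2).pow p)
  · exact IsHomogeneous.mul (by simpa using (isHomogeneous_X k q.1.1).pow p) (isHomogeneous_X _ _)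

theorem coeff_relPoly (q q' : Pairs m) :
    coeff (Finsupp.single q.1.1 1 + Finsupp.single q.1.2 p) (relPoly p k q') =
      if q = q' then 1 else 0 := by
  have hp1 : p ≠ 1 := (Fact.out : p.Prime).ne_one
  have hp0 : p ≠ 0 := (Fact.out : p.Prime).ne_zero
  have hmon (i j : Fin m) (a b : ℕ) :
      (X i ^ a * X j ^ b : MvPolynomial (Fin m) k) =
        monomial (Finsupp.single i a + Finsupp.single j b) 1 := by
    rw [X_pow_eq_monomial, X_pow_eq_monomial, monomial_mul, one_mul]
  obtain ⟨⟨i, j⟩, hij⟩ := q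
  obtain ⟨⟨i', j'⟩, hij'⟩ := q'
  have h1 := hmon i' j' 1 p
  have h2 := hmon i' j' p 1
  rw [pow_one] at h1 h2
  simp only at hij hij'
  rw [relPoly, coeff_sub, h1, h2, coeff_monomial, coeff_monomial]
  have hne : ¬ (Finsupp.single i' p + Finsupp.single j' 1 =
      Finsupp.single i 1 + Finsupp.single j p) := by
    intro h
    have e1 := DFunLike.congr_fun h i
    have e2 := DFunLike.congr_fun h j
    simp only [Finsupp.add_apply, Finsupp.single_apply, hij.ne, hij.ne', if_true, if_false] at e1 e2
    split_ifs at e1 e2 <;> omega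
  have heq : (Finsupp.single i' 1 + Finsupp.single j' p =
      Finsupp.single i 1 + Finsupp.single j p) ↔ i = i' ∧ j = j' := by
    constructor
    · intro h
      have e1 := DFunLike.congr_fun h i
      have e2 := DFunLike.congr_fun h j
      simp only [Finsupp.add_apply, Finsupp.single_apply, hij.ne, hij.ne', if_true,
        if_false] at e1 e2
      split_ifs at e1 e2 <;> omega
    · rintro ⟨rfl, rfl⟩
      rfl
  simp only [hne, if_false, sub_zero, heq, Subtype.mk.injEq, Prod.mk.injEq]

variable [Algebra (ZMod p) k]

theorem relPoly_independent {F : Type*} [Field F] [Algebra (MvPolynomial (Fin m) k) F]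
    [IsFractionRing (MvPolynomial (Fin m) k) F] [Algebra (ZMod p) F]
    (n : Pairs m → ZMod p) (y : F)
    (h : y ^ p - y = ∑ q, n q • algebraMap (MvPolynomial (Fin m) k) F (relPoly p k q)) : n = 0 := by
  have hp1 : 1 < p := (Fact.out : p.Prime).one_lt
  set r : MvPolynomial (Fin m) k := ∑ q, C (algebraMap (ZMod p) k (n q)) * relPoly p k q with hr
  have hrF : algebraMap _ F r = ∑ q, n q • algebraMap (MvPolynomial (Fin m) k) F (relPoly p k q) := by
    rw [hr, map_sum]
    refine Finset.sum_congr rfl fun q _ ↦ ?_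
    rw [map_mul, Algebra.smul_def]
    congr 1
    exact map_algebraMap_zmod (((algebraMap (MvPolynomial (Fin m) k) F)).comp C) (n q)
  have hint : IsIntegral (MvPolynomial (Fin m) k) y := by
    refine ⟨Polynomial.X ^ p - (Polynomial.X + Polynomial.C r), ?_, ?_⟩
    · refine Polynomial.monic_X_pow_sub ?_
      rw [Polynomial.degree_X_add_C]
      exact_mod_cast hp1
    · simp only [Polynomial.eval₂_sub, Polynomial.eval₂_add, Polynomial.eval₂_pow,
        Polynomial.eval₂_X, Polynomial.eval₂_C, hrF, ← h]
      ring
  obtain ⟨a, rfl⟩ := IsIntegrallyClosed.isIntegral_iff.1 hint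
  have ha : a ^ p - a = r := by
    apply IsFractionRing.injective (MvPolynomial (Fin m) k) F
    rw [hrF, ← h, map_sub, map_pow]
  have hhom : r.IsHomogeneous (p + 1) := by
    refine IsHomogeneous.sum _ _ _ fun q _ ↦ ?_
    simpa using (isHomogeneous_C _ _).mul (relPoly_isHomogeneous q)
  have hr0 : r = 0 := by
    by_contra hne
    have h1 := hhom.totalDegree hne
    by_cases hD : a.totalDegree = 0
    · have h2 : r.totalDegree ≤ 0 := by
        rw [← ha]
        refine (totalDegree_sub _ _).trans (max_le ?_ hD.le)
        refine (totalDegree_pow _ _).trans ?_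
        rw [hD, mul_zero]
      omega
    · have ha0 : a ≠ 0 := by
        rintro rfl
        simp at hD
      have hpow (n : ℕ) : (a ^ n).totalDegree = n * a.totalDegree := by
        induction n with
        | zero => simp
        | succ n ih =>
          rw [pow_succ, totalDegree_mul_of_isDomain (pow_ne_zero n ha0) ha0, ih]
          ring
      have h2 : r.totalDegree = p * a.totalDegree := by
        rw [← ha, sub_eq_add_neg, totalDegree_add_eq_left_of_totalDegree_lt, hpow]
        rw [totalDegree_neg, hpow]
        exact (Nat.lt_mul_iff_one_lt_left (Nat.pos_of_ne_zero hD)).2 hp1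
      have h3 : p ∣ p + 1 := ⟨a.totalDegree, by rw [← h1, h2]⟩
      have h4 := (Nat.dvd_add_right (dvd_refl p)).1 h3
      have := Nat.le_of_dvd one_pos h4
      omega
  funext q
  have h5 := congr(coeff (Finsupp.single q.1.1 1 + Finsupp.single q.1.2 p) $hr0)
  rw [hr, coeff_sum] at h5
  simpa [coeff_C_mul, coeff_relPoly] using h5

variable [CharP k p]

universe u in
theorem exists_field_chartRing (p : ℕ) [Fact p.Prime] (k : Type u) [Field k] (m : ℕ)
    [Algebra (ZMod p) k] [CharP k p] :
    ∃ (Ω : Type u) (_ : Field Ω) (φ : ChartRing p k m →+* Ω), Function.Injective φ ∧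
      Function.Injective (φ.comp (algebraMap (MvPolynomial (Fin m) k) (ChartRing p k m))) := by
  let F := FractionRing (MvPolynomial (Fin m) k)
  let Ω := SeparableClosure F
  have : CharP F p := IsFractionRing.charP_of_isFractionRing (MvPolynomial (Fin m) k) p
  have : CharP Ω p := charP_of_injective_algebraMap (algebraMap F Ω).injective p
  let : Algebra (ZMod p) F := ZMod.algebra F p
  let : Algebra (ZMod p) Ω := ZMod.algebra Ω p
  have : IsGalois F Ω := separableClosure.isGalois F (AlgebraicClosure F)
  have hroot (a : F) : ∃ s : Ω, s ^ p - s = algebraMap F Ω a := by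
    have hp1 : 1 < p := (Fact.out : p.Prime).one_lt
    have hdeg : (Polynomial.X ^ p - (Polynomial.X + Polynomial.C (algebraMap F Ω a)) :
        Polynomial Ω).degree = (p : WithBot ℕ) := by
      rw [Polynomial.degree_sub_eq_left_of_degree_lt, Polynomial.degree_X_pow]
      rw [Polynomial.degree_X_pow, Polynomial.degree_X_add_C]
      exact_mod_cast hp1
    obtain ⟨s, hs⟩ := IsSepClosed.exists_root
      (Polynomial.X ^ p - (Polynomial.X + Polynomial.C (algebraMap F Ω a)))
      (by rw [hdeg]; exact_mod_cast (by omega : p ≠ 0)) (by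
        refine ⟨0, -1, ?_⟩
        simp [Polynomial.derivative_X_pow])
    refine ⟨s, ?_⟩
    simp only [Polynomial.IsRoot, Polynomial.eval_sub, Polynomial.eval_pow, Polynomial.eval_X,
      Polynomial.eval_add, Polynomial.eval_C] at hs
    linear_combination hs
  choose s hs using fun q : Pairs m ↦ hroot (algebraMap _ F (relPoly p k q))
  let ev : MvPolynomial (Pairs m) (MvPolynomial (Fin m) k) →+* Ω :=
    (aeval s : MvPolynomial (Pairs m) F →ₐ[F] Ω).toRingHom.comp
      (map (algebraMap (MvPolynomial (Fin m) k) F))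
  have hker : ∀ P, P ∈ artinSchreierIdeal p (relPoly p k) → ev P = 0 := by
    intro P hP
    have : artinSchreierIdeal p (relPoly p k) ≤ RingHom.ker ev := by
      rw [artinSchreierIdeal, Ideal.span_le]
      rintro _ ⟨q, rfl⟩
      rw [SetLike.mem_coe, RingHom.mem_ker]
      simp [ev, hs]
    exact this hP
  refine ⟨Ω, inferInstance, Ideal.Quotient.lift _ ev hker, ?_, ?_⟩
  · rw [injective_iff_map_eq_zero]
    intro x hx
    obtain ⟨P, rfl⟩ := Ideal.Quotient.mk_surjective x
    obtain ⟨P', hdeg, hP'⟩ := exists_reduced (Fact.out : p.Prime).two_le (relPoly p k) P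
    have h1 : Ideal.Quotient.mk (artinSchreierIdeal p (relPoly p k)) P =
        Ideal.Quotient.mk _ P' := Ideal.Quotient.eq.2 hP'
    rw [h1] at hx ⊢
    rw [Ideal.Quotient.lift_mk] at hx
    have h2 : map (algebraMap (MvPolynomial (Fin m) k) F) P' = 0 := by
      refine eq_zero_of_aeval_eq_zero (p := p) (f := fun q ↦ algebraMap _ F (relPoly p k q))
        (fun n y h ↦ relPoly_independent n y h) hs (fun q ↦ ?_) hx
      refine lt_of_le_of_lt ?_ (hdeg q)
      exact degreeOf_le_iff.2 fun t ht ↦ degreeOf_le_iff.1 le_rfl t (support_map_subset _ _ ht)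
    have h3 : P' = 0 := map_injective _ (IsFractionRing.injective (MvPolynomial (Fin m) k) F)
      (by rw [h2, map_zero])
    rw [h3, map_zero]
  · have : (Ideal.Quotient.lift _ ev hker).comp
        (algebraMap (MvPolynomial (Fin m) k) (ChartRing p k m)) =
          (algebraMap F Ω).comp (algebraMap _ F) := by
      refine ringHom_ext (fun x ↦ ?_) fun i ↦ ?_
      · change ev (C (C x)) = _
        simp [ev]
      · change ev (C (X i)) = _
        simp [ev]
    rw [this]
    exact (algebraMap F Ω).injective.comp (IsFractionRing.injective (MvPolynomial (Fin m) k) F)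

instance : IsDomain (ChartRing p k m) := by
  obtain ⟨Ω, _, φ, hφ, -⟩ := exists_field_chartRing p k m
  exact hφ.isDomain

theorem algebraMap_chartRing_injective :
    Function.Injective (algebraMap (MvPolynomial (Fin m) k) (ChartRing p k m)) := by
  obtain ⟨Ω, _, φ, -, hφ⟩ := exists_field_chartRing p k m
  exact Function.Injective.of_comp (f := φ) hφ

end ChartRing

end PeriodSpace

namespace PeriodSpace

/-! ## Purely inseparable rationality of the function field of a chart -/

section PurelyInseparable

variable {p : ℕ} [Fact p.Prime] {k Q : Type*} [Field k] [Field Q] [Algebra k Q] [CharP Q p]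

/-- A subfield is closed under extraction of `p`-th roots. -/
def IsRootClosed (p : ℕ) (M : IntermediateField k Q) : Prop := ∀ x, x ^ p ∈ M → x ∈ M

/-- The subfield of the elements a power `x ^ (p ^ n)` of which lies in `E`. -/
def rootClosure (E : IntermediateField k Q) : IntermediateField k Q :=
  (perfectClosure E Q).restrictScalars k

theorem mem_rootClosure {E : IntermediateField k Q} {x : Q} :
    x ∈ rootClosure E ↔ ∃ n : ℕ, x ^ p ^ n ∈ E := by
  have : CharP E p := ((algebraMap E Q).charP_iff (algebraMap E Q).injective p).2 inferInstance
  rw [rootClosure, IntermediateField.mem_restrictScalars, mem_perfectClosure_iff_pow_mem p]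
  simp

theorem le_rootClosure (p : ℕ) [Fact p.Prime] [CharP Q p] (E : IntermediateField k Q) :
    E ≤ rootClosure E :=
  fun x hx ↦ (mem_rootClosure (p := p)).2 ⟨0, by simpa using hx⟩

theorem isRootClosed_rootClosure (E : IntermediateField k Q) : IsRootClosed p (rootClosure E) := by
  intro x hx
  obtain ⟨n, hn⟩ := (mem_rootClosure (p := p)).1 hx
  exact (mem_rootClosure (p := p)).2 ⟨n + 1, by rwa [pow_succ', pow_mul]⟩

variable [Algebra (ZMod p) Q] [PerfectRing Q p]

/-- Elements `T_i` with `T_i ^ p - T_i = c_i * w` can be replaced by a single element. -/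
theorem exists_generator (r : ℕ) (c T : Fin r → Q) (w : Q) (hc : LinearIndependent (ZMod p) c)
    (hT : ∀ i, T i ^ p - T i = c i * w) : ∃ a : Q, ∀ M : IntermediateField k Q, IsRootClosed p M →
      (∀ i, c i ∈ M) → (a ∈ M ↔ w ∈ M ∧ ∀ i, T i ∈ M) := by
  induction r generalizing w with
  | zero => exact ⟨w, fun M _ _ ↦ ⟨fun h ↦ ⟨h, fun i ↦ i.elim0⟩, fun h ↦ h.1⟩⟩
  | succ r ih =>
    have h0 : c 0 ≠ 0 := hc.ne_zero 0
    choose δ hδ using fun i : Fin r ↦ surjective_frobenius Q p (c i.succ / c 0)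
    simp only [frobenius_def] at hδ
    have hδc (i : Fin r) : c i.succ = δ i ^ p * c 0 := by rw [hδ, div_mul_cancel₀ _ h0]
    have hlin : LinearIndependent (ZMod p) fun i ↦ δ i - δ i ^ p := by
      rw [Fintype.linearIndependent_iff]
      intro g hg
      simp only [smul_sub, Finset.sum_sub_distrib, sub_eq_zero] at hg
      obtain ⟨n, hn⟩ := exists_zmod_of_pow_eq (p := p) (x := ∑ i, g i • δ i) (by
        rw [sum_pow_char, hg]
        refine Finset.sum_congr rfl fun i _ ↦ ?_
        rw [smul_pow, ZMod.pow_card])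
      have h1 : ∑ i, (Fin.cons (-n) g : Fin (r + 1) → ZMod p) i • c i = 0 := by
        rw [Fin.sum_univ_succ]
        simp only [Fin.cons_zero, Fin.cons_succ, hδc, neg_smul, Algebra.smul_def n, hn, hg]
        rw [Finset.sum_mul]
        simp only [smul_mul_assoc]
        exact neg_add_cancel _
      intro i
      simpa using Fintype.linearIndependent_iff.1 hc _ h1 i.succ
    obtain ⟨a, ha⟩ := ih (fun i ↦ δ i - δ i ^ p) (fun i ↦ T i.succ - δ i * T 0) (T 0) hlin
      fun i ↦ by
        have h1 := hT i.succ
        have h2 := hT 0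
        rw [sub_pow_char, mul_pow]
        rw [hδc] at h1
        linear_combination h1 - δ i ^ p * h2
    refine ⟨a, fun M hM hcM ↦ ?_⟩
    have hδM (i : Fin r) : δ i ∈ M := hM _ (by rw [hδ]; exact div_mem (hcM _) (hcM _))
    rw [ha M hM fun i ↦ sub_mem (hδM i) (pow_mem (hδM i) _)]
    constructor
    · rintro ⟨h1, h2⟩
      refine ⟨?_, fun i ↦ ?_⟩
      · have : w = (T 0 ^ p - T 0) / c 0 := by rw [hT, mul_div_cancel_left₀ _ h0]
        rw [this]
        exact div_mem (sub_mem (pow_mem h1 _) h1) (hcM 0)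
      · induction i using Fin.cases with
        | zero => exact h1
        | succ i =>
          have := add_mem (h2 i) (mul_mem (hδM i) h1)
          rwa [sub_add_cancel] at this
    · rintro ⟨-, h2⟩
      exact ⟨h2 0, fun i ↦ sub_mem (h2 _) (mul_mem (hδM i) (h2 0))⟩

variable [Algebra (ZMod p) k] {m : ℕ}

theorem linearIndependent_sub_pow {u : Fin m → Q} (hu : AlgebraicIndependent k u) {z : Fin m → Q}
    (hz : ∀ i, z i ^ p = u i) : LinearIndependent (ZMod p) fun i ↦ z i - z i ^ p ^ 2 := by
  rw [Fintype.linearIndependent_iff]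
  intro g hg
  have h1 : MvPolynomial.aeval u (∑ i, MvPolynomial.C (algebraMap (ZMod p) k (g i)) *
      (MvPolynomial.X i - MvPolynomial.X i ^ p ^ 2)) = 0 := by
    have h2 := congr($hg ^ p)
    rw [sum_pow_char, zero_pow (Fact.out : p.Prime).ne_zero] at h2
    rw [← h2, map_sum]
    refine Finset.sum_congr rfl fun i _ ↦ ?_
    have h3 : algebraMap k Q (algebraMap (ZMod p) k (g i)) = algebraMap (ZMod p) Q (g i) :=
      map_algebraMap_zmod _ _
    rw [smul_pow, ZMod.pow_card, sub_pow_char, hz, pow_right_comm, hz, map_mul,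
      MvPolynomial.algHom_C, h3, Algebra.smul_def]
    simp
  have h4 := hu.eq_zero_of_aeval_eq_zero _ h1
  intro i
  have h5 := congr(MvPolynomial.coeff (Finsupp.single i 1) $h4)
  rw [MvPolynomial.coeff_sum] at h5
  have hp2 : p ^ 2 ≠ 1 := (Nat.one_lt_pow two_ne_zero (Fact.out : p.Prime).one_lt).ne'
  have h6 (j : Fin m) : MvPolynomial.coeff (Finsupp.single i 1)
      (MvPolynomial.C (algebraMap (ZMod p) k (g j)) *
        (MvPolynomial.X j - MvPolynomial.X j ^ p ^ 2)) =
          if j = i then algebraMap (ZMod p) k (g j) else 0 := by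
    rw [MvPolynomial.coeff_C_mul, MvPolynomial.coeff_sub, MvPolynomial.coeff_X,
      MvPolynomial.coeff_X_pow]
    have : ¬ (Finsupp.single j (p ^ 2) = Finsupp.single i 1) := by
      intro h
      rcases (Finsupp.single_eq_single_iff _ _ _ _).1 h with h | h
      · exact hp2 h.2
      · exact one_ne_zero h.2
    simp [this, Finsupp.single_left_inj (one_ne_zero : (1 : ℕ) ≠ 0)]
  simp only [h6, Finset.sum_ite_eq', Finset.mem_univ, if_true, MvPolynomial.coeff_zero] at h5
  exact (algebraMap (ZMod p) k).injective (by rw [h5, map_zero])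

theorem exists_generators {u : Fin m → Q} (hu : AlgebraicIndependent k u) {S : Pairs m → Q}
    (hS : ∀ q, S q ^ p - S q = u q.1.1 * u q.1.2 ^ p - u q.1.1 ^ p * u q.1.2) (j : ℕ) (hj : j ≤ m) :
    ∃ t : Fin j → Q, ∀ M : IntermediateField k Q, IsRootClosed p M →
      ((∀ i, t i ∈ M) ↔
        (∀ i : Fin m, (i : ℕ) < j → u i ∈ M) ∧ ∀ q : Pairs m, (q.1.2 : ℕ) < j → S q ∈ M) := by
  induction j with
  | zero => exact ⟨Fin.elim0, fun M _ ↦ ⟨fun _ ↦ ⟨by simp, by simp⟩, fun _ i ↦ i.elim0⟩⟩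
  | succ j ih =>
    obtain ⟨t, ht⟩ := ih (by omega)
    choose z hz using fun i ↦ surjective_frobenius Q p (u i)
    simp only [frobenius_def] at hz
    let e : Fin j → Fin m := Fin.castLE (by omega)
    let j' : Fin m := ⟨j, by omega⟩
    have he (i : Fin j) : e i < j' := i.2
    let q (i : Fin j) : Pairs m := ⟨(e i, j'), he i⟩
    obtain ⟨a, ha⟩ := exists_generator (p := p) (k := k) j (fun i ↦ z (e i) - z (e i) ^ p ^ 2)
      (fun i ↦ S (q i) - z (e i) * u j') (u j')
      ((linearIndependent_sub_pow hu hz).comp e (Fin.castLE_injective _)) fun i ↦ by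
        have h1 := hS (q i)
        simp only [q] at h1
        rw [sub_pow_char, mul_pow, hz, sq p, pow_mul, hz]
        linear_combination h1
    refine ⟨Fin.snoc t a, fun M hM ↦ ?_⟩
    rw [Fin.forall_fin_succ']
    simp only [Fin.snoc_castSucc, Fin.snoc_last]
    rw [ht M hM]
    have hzM (i : Fin m) (h : u i ∈ M) : z i ∈ M := hM _ (by rwa [hz])
    constructor
    · rintro ⟨⟨h1, h2⟩, h3⟩
      have hz' (i : Fin j) : z (e i) ∈ M := hzM _ (h1 _ i.2)
      rw [ha M hM fun i ↦ sub_mem (hz' i) (pow_mem (hz' i) _)] at h3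
      refine ⟨fun i hi ↦ ?_, fun q' hq ↦ ?_⟩
      · obtain hi | hi := Nat.lt_succ_iff_lt_or_eq.1 hi
        · exact h1 i hi
        · obtain rfl : i = j' := Fin.ext hi
          exact h3.1
      · obtain hi | hi := Nat.lt_succ_iff_lt_or_eq.1 hq
        · exact h2 q' hi
        · obtain ⟨⟨i₁, i₂⟩, hq'⟩ := q'
          obtain rfl : i₂ = j' := Fin.ext hi
          have h4 := add_mem (h3.2 ⟨i₁, hq'⟩) (mul_mem (hz' ⟨i₁, hq'⟩) h3.1)
          rwa [sub_add_cancel] at h4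
    · rintro ⟨h1, h2⟩
      refine ⟨⟨fun i hi ↦ h1 i (by omega), fun q hq ↦ h2 q (by omega)⟩, ?_⟩
      have hz' (i : Fin j) : z (e i) ∈ M := hzM _ (h1 _ (i.2.trans (Nat.lt_succ_self j)))
      rw [ha M hM fun i ↦ sub_mem (hz' i) (pow_mem (hz' i) _)]
      have hj' : u j' ∈ M := h1 _ (Nat.lt_succ_self j)
      exact ⟨hj', fun i ↦ sub_mem (h2 _ (Nat.lt_succ_self j)) (mul_mem (hz' i) hj')⟩

end PurelyInseparable

section FunctionField

variable {p : ℕ} [Fact p.Prime] {k K K' : Type*} [Field k] [CharP k p] [Field K] [Field K']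
  [Algebra k K] [Algebra k K'] {m : ℕ} [Algebra (MvPolynomial (Fin m) k) K']
  [IsScalarTower k (MvPolynomial (Fin m) k) K'] [IsFractionRing (MvPolynomial (Fin m) k) K']

/-- The field generated by `u` and `S` has a purely inseparable extension which is a field of
rational functions. -/
theorem exists_isPurelyInseparable_algHom (hk : ∀ c : k, c ^ p ^ 2 = c) {u : Fin m → K}
    (hu : AlgebraicIndependent k u) {S : Pairs m → K}
    (hS : ∀ q, S q ^ p - S q = u q.1.1 * u q.1.2 ^ p - u q.1.1 ^ p * u q.1.2)
    (hgen : IntermediateField.adjoin k (Set.range u ∪ Set.range S) = ⊤) :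
    ∃ φ : K →ₐ[k] K', (φ : K →+* K').IsPurelyInseparable := by
  let Q := AlgebraicClosure K
  have : CharP K p := charP_of_injective_algebraMap (algebraMap k K).injective p
  have : CharP Q p := charP_of_injective_algebraMap (algebraMap K Q).injective p
  let : Algebra (ZMod p) Q := ZMod.algebra Q p
  let : Algebra (ZMod p) k := ZMod.algebra k p
  let i : K →ₐ[k] Q := IsScalarTower.toAlgHom k K Q
  have hi : Function.Injective i := (algebraMap K Q).injective
  obtain ⟨t, ht⟩ := exists_generators (p := p) (k := k) (u := i ∘ u) (hu.map' hi) (S := i ∘ S)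
    (fun q ↦ by
      have := congr(i $(hS q))
      simpa using this) m le_rfl
  have hL (M : IntermediateField k Q) :
      ((∀ j, i (u j) ∈ M) ∧ ∀ q, i (S q) ∈ M) ↔ i.fieldRange ≤ M := by
    constructor
    · rintro ⟨h1, h2⟩
      have h3 : (⊤ : IntermediateField k K) ≤ M.comap i := by
        rw [← hgen, IntermediateField.adjoin_le_iff]
        rintro _ (⟨j, rfl⟩ | ⟨q, rfl⟩)
        exacts [h1 j, h2 q]
      rintro _ ⟨x, rfl⟩
      exact h3 (IntermediateField.mem_top (x := x))
    · exact fun h ↦ ⟨fun j ↦ h ⟨_, rfl⟩, fun q ↦ h ⟨_, rfl⟩⟩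
  have hcl (M : IntermediateField k Q) (hM : IsRootClosed p M) :
      (∀ j, t j ∈ M) ↔ i.fieldRange ≤ M := by
    rw [ht M hM, ← hL]
    simp
  let E := IntermediateField.adjoin k (Set.range t)
  have hEL : E ≤ rootClosure i.fieldRange := by
    rw [IntermediateField.adjoin_le_iff]
    rintro _ ⟨j, rfl⟩
    exact (hcl _ (isRootClosed_rootClosure (p := p) _)).2 (le_rootClosure p _) j
  have hLE : i.fieldRange ≤ rootClosure E :=
    (hcl _ (isRootClosed_rootClosure (p := p) _)).1 fun j ↦ le_rootClosure p _
      (IntermediateField.subset_adjoin k _ ⟨j, rfl⟩)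
  have halg : Algebra.IsAlgebraic E Q := by
    let f : K →+* rootClosure E := (i : K →+* Q).codRestrict (rootClosure E) fun x ↦ hLE ⟨x, rfl⟩
    let := f.toAlgebra
    have : IsScalarTower K (rootClosure E) Q := .of_algebraMap_eq fun _ ↦ rfl
    have h1 : Algebra.IsAlgebraic (rootClosure E) Q := .tower_top (K := K) _
    have h2 : Algebra.IsAlgebraic (perfectClosure E Q) Q := h1
    exact .trans E (perfectClosure E Q) Q
  have htr : AlgebraicIndependent k t := by
    have halg' : Algebra.IsAlgebraic (Algebra.adjoin k (Set.range t)) Q :=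
      IntermediateField.isAlgebraic_adjoin_iff_top.1 halg
    refine (Algebra.IsAlgebraic.isTranscendenceBasis_of_lift_le_trdeg_of_finite k t ?_).1
    exact (hu.map' hi).lift_cardinalMk_le_trdeg
  let F (N : ℕ) : Q →ₐ[k] Q :=
    { iterateFrobenius Q p (2 * N) with
      commutes' := fun c ↦ by
        change algebraMap k Q c ^ p ^ (2 * N) = _
        rw [← map_pow]
        congr 1
        induction N with
        | zero => simp
        | succ N ih => rw [mul_add, pow_add, pow_mul, ih, mul_one, hk] }
  have hF (N : ℕ) (x : Q) : F N x = x ^ p ^ (2 * N) := rfl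
  obtain ⟨N, hN⟩ : ∃ N, i.fieldRange ≤ E.comap (F N) := by
    have h1 (x : K) := (mem_rootClosure (p := p)).1 (hLE (x := i x) ⟨x, rfl⟩)
    choose n hn using h1
    have h2 (x : K) (N : ℕ) (hN : n x ≤ N) : i x ∈ E.comap (F N) := by
      change i x ^ p ^ (2 * N) ∈ E
      rw [show 2 * N = n x + (2 * N - n x) by omega, pow_add, pow_mul]
      exact pow_mem (hn x) _
    refine ⟨∑ j, n (u j) + ∑ q, n (S q), (hL _).1 ⟨fun j ↦ h2 _ _ ?_, fun q ↦ h2 _ _ ?_⟩⟩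
    · exact (Finset.single_le_sum (f := fun j ↦ n (u j)) (fun _ _ ↦ Nat.zero_le _)
        (Finset.mem_univ j)).trans (Nat.le_add_right _ _)
    · exact (Finset.single_le_sum (f := fun q ↦ n (S q)) (fun _ _ ↦ Nat.zero_le _)
        (Finset.mem_univ q)).trans (Nat.le_add_left _ _)
  let φ₀ : K →ₐ[k] E := ((F N).comp i).codRestrict E.toSubalgebra fun x ↦ hN ⟨x, rfl⟩
  have hφ₀ (x : K) : (φ₀ x : Q) = i x ^ p ^ (2 * N) := rfl
  let e : E ≃ₐ[k] K' := htr.aevalEquivField.symm.trans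
    ((FractionRing.algEquiv (MvPolynomial (Fin m) k) K').restrictScalars k)
  refine ⟨(e : E →ₐ[k] K').comp φ₀, ?_⟩
  let : Algebra K K' := ((e : E →ₐ[k] K').comp φ₀ : K →+* K').toAlgebra
  change IsPurelyInseparable K K'
  rw [isPurelyInseparable_iff_pow_mem K p]
  intro y
  obtain ⟨y, rfl⟩ := e.surjective y
  obtain ⟨n, x, hx⟩ := (mem_rootClosure (p := p)).1 (hEL y.2)
  refine ⟨n + 2 * N, x, ?_⟩
  change e (φ₀ x) = _
  rw [← map_pow]
  congr 1
  apply Subtype.ext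
  rw [hφ₀]
  change i x = _ at hx
  rw [hx, ← pow_mul, ← pow_add]
  rfl

end FunctionField

section ChartRing

open MvPolynomial

variable {p : ℕ} [Fact p.Prime] {k : Type*} [Field k] [CharP k p] {m : ℕ}

variable (p k) in
/-- The coordinates `u_i` of the chart. -/
def chartU (i : Fin m) : ChartRing p k m := Ideal.Quotient.mk _ (C (X i))

variable (p k) in
/-- The coordinates `S_ij` of the chart. -/
def chartS (q : Pairs m) : ChartRing p k m := Ideal.Quotient.mk _ (X q)

theorem chartRing_ringHom_ext {A : Type*} [CommRing A] {f g : ChartRing p k m →+* A}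
    (h : ∀ c, f (algebraMap k _ c) = g (algebraMap k _ c))
    (hu : ∀ i, f (chartU p k i) = g (chartU p k i))
    (hS : ∀ q, f (chartS p k q) = g (chartS p k q)) : f = g := by
  refine Ideal.Quotient.ringHom_ext (ringHom_ext (fun x ↦ ?_) hS)
  have : (f.comp (Ideal.Quotient.mk _)).comp C = (g.comp (Ideal.Quotient.mk _)).comp C :=
    ringHom_ext h hu
  exact congr($this x)

theorem chartRing_relation (q : Pairs m) :
    (chartS p k q) ^ p - chartS p k q =
      chartU p k q.1.1 * chartU p k q.1.2 ^ p -
        chartU p k q.1.1 ^ p * chartU p k q.1.2 := by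
  have h : Ideal.Quotient.mk (artinSchreierIdeal p (relPoly p k (m := m)))
      (X q ^ p - X q - C (relPoly p k q)) = 0 :=
    Ideal.Quotient.eq_zero_iff_mem.2 (Ideal.subset_span ⟨q, rfl⟩)
  rw [map_sub, sub_eq_zero] at h
  simpa [relPoly, chartU, chartS] using h

theorem exists_isPurelyInseparable_ringHom (hk : ∀ c : k, c ^ p ^ 2 = c) (K K' : Type*) [Field K]
    [Field K'] [Algebra (ChartRing p k m) K] [IsFractionRing (ChartRing p k m) K]
    [Algebra (MvPolynomial (Fin m) k) K'] [IsFractionRing (MvPolynomial (Fin m) k) K'] :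
    ∃ φ : K →+* K', φ.IsPurelyInseparable ∧
      ∀ c, φ (algebraMap (ChartRing p k m) K (algebraMap k _ c)) =
        algebraMap (MvPolynomial (Fin m) k) K' (C c) := by
  let : Algebra (ZMod p) k := ZMod.algebra k p
  let : Algebra k K := ((algebraMap (ChartRing p k m) K).comp (algebraMap k _)).toAlgebra
  let : Algebra k K' := ((algebraMap (MvPolynomial (Fin m) k) K').comp C).toAlgebra
  have : IsScalarTower k (MvPolynomial (Fin m) k) K' := .of_algebraMap_eq fun _ ↦ rfl
  have : @IsScalarTower k (ChartRing p k m) K Algebra.toSMul Algebra.toSMul Algebra.toSMul :=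
    .of_algebraMap_eq fun _ ↦ rfl
  let u (i : Fin m) : K := algebraMap (ChartRing p k m) K (chartU p k i)
  let S (q : Pairs m) : K := algebraMap (ChartRing p k m) K (chartS p k q)
  have hinj : Function.Injective (algebraMap (ChartRing p k m) K) := IsFractionRing.injective _ _
  have hu : AlgebraicIndependent k u := by
    rw [algebraicIndependent_iff_injective_aeval]
    convert hinj.comp (algebraMap_chartRing_injective (p := p) (k := k) (m := m)) using 1
    have h1 : (aeval u : MvPolynomial (Fin m) k →ₐ[k] K) =
        ((IsScalarTower.toAlgHom k (ChartRing p k m) K).comp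
          (IsScalarTower.toAlgHom k (MvPolynomial (Fin m) k) (ChartRing p k m))) := by
      refine algHom_ext fun i ↦ ?_
      rw [aeval_X]
      rfl
    exact congr(⇑$h1)
  have hgen : IntermediateField.adjoin k (Set.range u ∪ Set.range S) = ⊤ := by
    rw [eq_top_iff]
    intro x _
    set E := IntermediateField.adjoin k (Set.range u ∪ Set.range S)
    have hR (P : MvPolynomial (Pairs m) (MvPolynomial (Fin m) k)) :
        algebraMap (ChartRing p k m) K (Ideal.Quotient.mk _ P) ∈ E := by
      induction P using MvPolynomial.induction_on with
      | C P =>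
        induction P using MvPolynomial.induction_on with
        | C c => exact E.algebraMap_mem c
        | add P P' h h' => simpa using add_mem h h'
        | mul_X P i h =>
          rw [map_mul, map_mul, map_mul]
          exact mul_mem h (IntermediateField.subset_adjoin k _ (Or.inl ⟨i, rfl⟩))
      | add P P' h h' => simpa using add_mem h h'
      | mul_X P q h =>
        rw [map_mul, map_mul]
        exact mul_mem h (IntermediateField.subset_adjoin k _ (Or.inr ⟨q, rfl⟩))
    obtain ⟨a, b, -, rfl⟩ := IsFractionRing.div_surjective (A := ChartRing p k m) x
    obtain ⟨a, rfl⟩ := Ideal.Quotient.mk_surjective a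
    obtain ⟨b, rfl⟩ := Ideal.Quotient.mk_surjective b
    exact div_mem (hR a) (hR b)
  obtain ⟨φ, hφ⟩ := exists_isPurelyInseparable_algHom (K' := K') hk hu (S := S)
    (fun q ↦ by simpa using congr(algebraMap (ChartRing p k m) K $(chartRing_relation q))) hgen
  exact ⟨φ, hφ, φ.commutes⟩

end ChartRing

end PeriodSpace

namespace PeriodSpace

/-! ## The universal matrix over the coordinate ring of a chart -/

section QuadraticExtension

open Polynomial

variable {p : ℕ} [Fact p.Prime] {d : ZMod p}

theorem irreducible_X_sq_sub_C (hd : ¬ IsSquare d) : Irreducible (X ^ 2 - C d : (ZMod p)[X]) := by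
  refine X_pow_sub_C_irreducible_of_prime Nat.prime_two fun b hb ↦ hd ⟨b, ?_⟩
  rw [← hb, sq]

theorem exists_algEquiv_galoisField (hd : ¬ IsSquare d) {θ : GaloisField p 2}
    (hθ : θ ^ 2 = algebraMap _ _ d) :
    ∃ e : AdjoinRoot (X ^ 2 - C d : (ZMod p)[X]) ≃ₐ[ZMod p] GaloisField p 2,
      e (AdjoinRoot.root _) = θ := by
  have hirr := irreducible_X_sq_sub_C hd
  have : Fact (Irreducible (X ^ 2 - C d : (ZMod p)[X])) := ⟨hirr⟩
  have h0 : (X ^ 2 - C d : (ZMod p)[X]) ≠ 0 := hirr.ne_zero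
  let f : AdjoinRoot (X ^ 2 - C d : (ZMod p)[X]) →ₐ[ZMod p] GaloisField p 2 :=
    AdjoinRoot.liftAlgHom _ (Algebra.ofId _ _) θ (by simp [hθ])
  have hfin : Module.Finite (ZMod p) (AdjoinRoot (X ^ 2 - C d : (ZMod p)[X])) :=
    (AdjoinRoot.powerBasis h0).finite
  have hrank : Module.finrank (ZMod p) (AdjoinRoot (X ^ 2 - C d : (ZMod p)[X])) =
      Module.finrank (ZMod p) (GaloisField p 2) := by
    rw [GaloisField.finrank _ two_ne_zero, (AdjoinRoot.powerBasis h0).finrank,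
      AdjoinRoot.powerBasis_dim, natDegree_X_pow_sub_C]
  have hinj : Function.Injective f := f.toRingHom.injective
  have hsurj : Function.Surjective f :=
    (LinearMap.injective_iff_surjective_of_finrank_eq_finrank (f := f.toLinearMap) hrank).1 hinj
  exact ⟨AlgEquiv.ofBijective f ⟨hinj, hsurj⟩, by
    exact AdjoinRoot.liftAlgHom_root (X ^ 2 - C d) (Algebra.ofId _ _) θ (by simp [hθ])⟩

theorem exists_sq_eq (d : ZMod p) : ∃ θ : GaloisField p 2, θ ^ 2 = algebraMap _ _ d := by
  by_cases hd : IsSquare d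
  · obtain ⟨r, rfl⟩ := hd
    exact ⟨algebraMap _ _ r, by rw [map_mul, sq]⟩
  have hirr := irreducible_X_sq_sub_C hd
  have : Fact (Irreducible (X ^ 2 - C d : (ZMod p)[X])) := ⟨hirr⟩
  have h0 : (X ^ 2 - C d : (ZMod p)[X]) ≠ 0 := hirr.ne_zero
  have hfin : Module.Finite (ZMod p) (AdjoinRoot (X ^ 2 - C d : (ZMod p)[X])) :=
    (AdjoinRoot.powerBasis h0).finite
  have hcard : Nat.card (AdjoinRoot (X ^ 2 - C d : (ZMod p)[X])) = p ^ 2 := by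
    rw [Module.natCard_eq_pow_finrank (K := ZMod p), Nat.card_zmod,
      (AdjoinRoot.powerBasis h0).finrank, AdjoinRoot.powerBasis_dim, natDegree_X_pow_sub_C]
  let e := GaloisField.algEquivGaloisField p 2 hcard
  refine ⟨e (AdjoinRoot.root _), ?_⟩
  have h := AdjoinRoot.eval₂_root (X ^ 2 - C d : (ZMod p)[X])
  rw [eval₂_sub, eval₂_pow, eval₂_X, eval₂_C, sub_eq_zero] at h
  rw [← map_pow, h]
  exact e.commutes d

theorem exists_galoisField_ringHom (hd : ¬ IsSquare d) {θ : GaloisField p 2}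
    (hθ : θ ^ 2 = algebraMap _ _ d) {O : Type*} [CommRing O] [Algebra (ZMod p) O] {a : O}
    (ha : a ^ 2 = algebraMap _ _ d) : ∃ f : GaloisField p 2 →+* O, f θ = a := by
  obtain ⟨e, he⟩ := exists_algEquiv_galoisField hd hθ
  refine ⟨((AdjoinRoot.liftAlgHom _ (Algebra.ofId _ _) a
    (by simp [ha])).comp e.symm.toAlgHom).toRingHom, ?_⟩
  rw [← he]
  simp

theorem galoisField_ringHom_ext (hd : ¬ IsSquare d) {θ : GaloisField p 2}
    (hθ : θ ^ 2 = algebraMap _ _ d) {O : Type*} [CommRing O] {f g : GaloisField p 2 →+* O}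
    (h : f θ = g θ) : f = g := by
  obtain ⟨e, he⟩ := exists_algEquiv_galoisField hd hθ
  have h1 : f.comp e.toAlgHom.toRingHom = g.comp e.toAlgHom.toRingHom := by
    refine AdjoinRoot.ringHom_ext (Subsingleton.elim _ _) ?_
    simpa [he] using h
  ext x
  obtain ⟨y, rfl⟩ := e.surjective x
  exact congr($h1 y)

theorem galoisField_pow (x : GaloisField p 2) : x ^ p ^ 2 = x := by
  have := Fintype.ofFinite (GaloisField p 2)
  have h := FiniteField.pow_card x
  rwa [Fintype.card_eq_nat_card, GaloisField.card p 2 two_ne_zero] at h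

end QuadraticExtension

section UniversalMatrix

variable {p : ℕ} [Fact p.Prime] {m : ℕ}

/-- The alternating matrix of the coordinates `S_ij`. -/
def chartAlt (p : ℕ) [Fact p.Prime] (k : Type*) [Field k] (i j : Fin m) : ChartRing p k m :=
  if h : i < j then chartS p k ⟨(i, j), h⟩ else if h : j < i then -chartS p k ⟨(j, i), h⟩ else 0

theorem chartAlt_of_lt {k : Type*} [Field k] {i j : Fin m} (h : i < j) :
    chartAlt p k i j = chartS p k ⟨(i, j), h⟩ := by
  rw [chartAlt, dif_pos h]

theorem chartAlt_swap {k : Type*} [Field k] (i j : Fin m) :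
    chartAlt p k i j = -chartAlt p k j i := by
  rcases lt_trichotomy i j with h | rfl | h
  · simp [chartAlt, h, h.not_gt]
  · simp [chartAlt]
  · simp [chartAlt, h, h.not_gt]

theorem chartAlt_relation {k : Type*} [Field k] [CharP k p] [Algebra (ZMod p) k] (i j : Fin m) :
    chartAlt p k i j ^ p - chartAlt p k i j = chartU p k i * chartU p k j ^ p -
      chartU p k i ^ p * chartU p k j := by
  have key (i j : Fin m) (h : i < j) : chartAlt p k i j ^ p - chartAlt p k i j =
      chartU p k i * chartU p k j ^ p - chartU p k i ^ p * chartU p k j := by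
    rw [chartAlt_of_lt h, chartRing_relation]
  rcases lt_trichotomy i j with h | rfl | h
  · exact key i j h
  · simp [chartAlt, (Fact.out : p.Prime).ne_zero, mul_comm]
  · have h1 := key j i h
    have : CharP (ChartRing p k m) p :=
      charP_of_injective_algebraMap (algebraMap k (ChartRing p k m)).injective p
    have h2 : (-chartAlt p k j i) ^ p = -(chartAlt p k j i ^ p) :=
      map_neg (frobenius (ChartRing p k m) p) _
    rw [chartAlt_swap, h2]
    linear_combination -h1

/-- The solution of the equations of a chart with given parameters. -/
def paramMatrix (c : ZMod p) {O : Type*} [CommRing O] [Algebra (ZMod p) O] (a : O) (u : Fin m → O)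
    (S : Fin m → Fin m → O) : Matrix (Option (Fin m)) (Option (Fin m)) O
  | none, none => a
  | none, some i => u i
  | some i, none => -(algebraMap _ _ c * a * u i)
  | some j, some i => algebraMap _ _ (c / 2) * (S i j - u i * u j)

/-- The matrix over the coordinate ring of the chart, the graph of which is the universal
characteristic subspace. -/
def chartMatrix (m : ℕ) (c : ZMod p) (θ : GaloisField p 2) :
    Matrix (Option (Fin m)) (Option (Fin m)) (ChartRing p (GaloisField p 2) m) :=
  paramMatrix c (algebraMap _ _ θ) (chartU p _) (chartAlt p _)

variable {c d : ZMod p} {θ : GaloisField p 2}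

theorem algebraMap_half (hp : 3 ≤ p) (O : Type*) [CommRing O] [Algebra (ZMod p) O] (c : ZMod p) :
    2 * algebraMap _ O (c / 2) = algebraMap _ O c := by
  rw [← map_ofNat (algebraMap (ZMod p) O) 2, ← map_mul, mul_div_cancel₀ _ (two_ne_zero_zmod hp)]

theorem algebraMap_zmod_pow (O : Type*) [CommRing O] [Algebra (ZMod p) O] (c : ZMod p) :
    algebraMap _ O c ^ p = algebraMap _ O c := by
  rw [← map_pow, ZMod.pow_card]

theorem paramMatrix_eqs (hp : 3 ≤ p) (hd : ¬ IsSquare d) {O : Type*} [CommRing O]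
    [Algebra (ZMod p) O] {a : O} {u : Fin m → O} {S : Fin m → Fin m → O}
    (ha : a ^ 2 = algebraMap _ _ d) (hS : ∀ i j, S i j = -S j i)
    (hS' : ∀ i j, S i j ^ p - S i j = u i * u j ^ p - u i ^ p * u j) :
    ChartEqs c d (paramMatrix c a u S) := by
  have hap := pow_prime_eq_neg hp hd ha
  have hodd : Odd p := (Fact.out : p.Prime).odd_of_ne_two (by omega)
  have hc2 := algebraMap_half hp O c
  refine ⟨ha, fun i ↦ ?_, fun i j ↦ ?_, ?_⟩
  · simp only [paramMatrix]
    ring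
  · simp only [paramMatrix]
    rw [hS j i, ← hc2]
    ring
  · rintro (_ | j) (_ | i)
    · simp only [paramMatrix, hap]
      ring
    · simp only [paramMatrix, hap]
      ring
    · simp only [paramMatrix, hap, hodd.neg_pow, mul_pow, algebraMap_zmod_pow]
      ring
    · simp only [paramMatrix, hap, hodd.neg_pow, mul_pow, algebraMap_zmod_pow, sub_eq_add_neg,
        add_pow_prime]
      rw [← hc2]
      linear_combination (-2) * a * algebraMap _ O (c / 2) * hS' i j

theorem chartMatrix_eqs (hp : 3 ≤ p) (hd : ¬ IsSquare d) (hθ : θ ^ 2 = algebraMap _ _ d) :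
    ChartEqs c d (chartMatrix m c θ) := by
  refine paramMatrix_eqs hp hd ?_ chartAlt_swap chartAlt_relation
  rw [← map_pow, hθ]
  exact map_algebraMap_zmod _ d

theorem exists_chart_ringHom (hp : 3 ≤ p) (hc : c ≠ 0) (hd : ¬ IsSquare d)
    (hθ : θ ^ 2 = algebraMap _ _ d)
    {O : Type*} [CommRing O] [Algebra (ZMod p) O] {A : Matrix (Option (Fin m)) (Option (Fin m)) O}
    (hA : ChartEqs c d A) :
    ∃ g : ChartRing p (GaloisField p 2) m →+* O, (chartMatrix m c θ).map g = A := by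
  obtain ⟨κ, hκ⟩ := exists_galoisField_ringHom hd hθ hA.sq_eq
  set a := A none none with ha
  have h20 := two_ne_zero_zmod hp
  have hodd : Odd p := (Fact.out : p.Prime).odd_of_ne_two (by omega)
  have hcc : algebraMap _ O (c / 2) * algebraMap _ O (2 / c) = 1 := by
    rw [← map_mul, div_mul_div_cancel₀ h20, div_self hc, map_one]
  have hc2 := algebraMap_half hp O c
  have hap := pow_prime_eq_neg hp hd hA.sq_eq
  have hd0 : d ≠ 0 := fun h ↦ hd (h ▸ IsSquare.zero)
  have haunit : IsUnit a := by
    have h := isUnit_algebraMap_zmod (O := O) hd0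
    rw [← hA.sq_eq, sq] at h
    exact isUnit_of_mul_isUnit_left h
  let u (i : Fin m) : O := A none (some i)
  have hrow (i : Fin m) : A (some i) none = -(algebraMap _ O c * a * u i) := by
    linear_combination hA.row_eq i
  have hs (i j : Fin m) : A (some j) (some i) ^ p - A (some j) (some i) =
      -(algebraMap _ O (c / 2) * ((u j ^ p + u j) * (u i ^ p - u i))) := by
    have h1 := hA.frob_eq (some j) (some i)
    rw [hrow, hodd.neg_pow, mul_pow, mul_pow, algebraMap_zmod_pow, hap, ← hc2] at h1
    refine (((isUnit_two (O := O) hp).mul haunit)).mul_left_cancel ?_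
    linear_combination -h1
  let S (q : Pairs m) : O := algebraMap _ O (2 / c) * A (some q.1.2) (some q.1.1) +
    u q.1.1 * u q.1.2
  have hS (q : Pairs m) : S q ^ p - S q = u q.1.1 * u q.1.2 ^ p - u q.1.1 ^ p * u q.1.2 := by
    have h1 := hs q.1.1 q.1.2
    simp only [S]
    rw [add_pow_prime, mul_pow, mul_pow, algebraMap_zmod_pow]
    linear_combination algebraMap _ O (2 / c) * h1 -
      ((u q.1.2 ^ p + u q.1.2) * (u q.1.1 ^ p - u q.1.1)) * hcc
  let ev := MvPolynomial.eval₂Hom (MvPolynomial.eval₂Hom κ u) S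
  have hker : ∀ P, P ∈ artinSchreierIdeal p (relPoly p (GaloisField p 2)) → ev P = 0 := by
    intro P hP
    have : artinSchreierIdeal p (relPoly p (GaloisField p 2)) ≤ RingHom.ker ev := by
      rw [artinSchreierIdeal, Ideal.span_le]
      rintro _ ⟨q, rfl⟩
      rw [SetLike.mem_coe, RingHom.mem_ker]
      simp [ev, hS, relPoly]
    exact this hP
  let g : ChartRing p (GaloisField p 2) m →+* O := Ideal.Quotient.lift _ ev hker
  have hgk (x : GaloisField p 2) : g (algebraMap _ _ x) = κ x := by
    change ev (MvPolynomial.C (MvPolynomial.C x)) = _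
    simp [ev]
  have hgu (i : Fin m) : g (chartU p _ i) = u i := by
    change ev (MvPolynomial.C (MvPolynomial.X i)) = _
    simp [ev]
  have hgS (q : Pairs m) : g (chartS p _ q) = S q := by
    change ev (MvPolynomial.X q) = _
    simp [ev]
  have hgc (x : ZMod p) : g (algebraMap _ _ x) = algebraMap _ O x := map_algebraMap_zmod g x
  have hlt (i j : Fin m) (h : i < j) : algebraMap _ O (c / 2) * g (chartAlt p _ i j) =
      A (some j) (some i) + algebraMap _ O (c / 2) * (u i * u j) := by
    rw [chartAlt_of_lt h, hgS]
    linear_combination A (some j) (some i) * hcc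
  refine ⟨g, ?_⟩
  ext i j
  rw [Matrix.map_apply]
  match i, j with
  | none, none => exact (hgk θ).trans hκ
  | none, some i => exact hgu i
  | some i, none => simp [chartMatrix, paramMatrix, hgk, hgu, hgc, hκ, hrow]
  | some j, some i =>
    simp only [chartMatrix, paramMatrix, map_mul, map_sub, hgu, hgc]
    have h1 := hA.add_eq i j
    rcases lt_trichotomy i j with h | rfl | h
    · linear_combination hlt i j h
    · have h2 : chartAlt p (GaloisField p 2) i i = 0 := by simp [chartAlt]
      rw [h2, map_zero]
      refine (isUnit_two (O := O) hp).mul_left_cancel ?_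
      linear_combination -h1 - (u i * u i) * hc2
    · rw [chartAlt_swap, map_neg]
      linear_combination -hlt j i h - h1 - u i * u j * hc2

theorem chart_ringHom_ext (hp : 3 ≤ p) (hc : c ≠ 0) (hd : ¬ IsSquare d)
    (hθ : θ ^ 2 = algebraMap _ _ d) {O : Type*} [CommRing O]
    {f g : ChartRing p (GaloisField p 2) m →+* O}
    (h : (chartMatrix m c θ).map f = (chartMatrix m c θ).map g) : f = g := by
  have h' (i j) : f (chartMatrix m c θ i j) = g (chartMatrix m c θ i j) := congr_fun₂ h i j
  have hu (i : Fin m) : f (chartU p _ i) = g (chartU p _ i) := h' none (some i)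
  refine chartRing_ringHom_ext (fun x ↦ ?_) hu fun q ↦ ?_
  · exact congr($(galoisField_ringHom_ext hd hθ (f := f.comp (algebraMap _ _))
      (g := g.comp (algebraMap _ _)) (h' none none)) x)
  · have hc2 : IsUnit (algebraMap (ZMod p) (ChartRing p (GaloisField p 2) m) (c / 2)) :=
      isUnit_algebraMap_zmod (div_ne_zero hc (two_ne_zero_zmod hp))
    have h1 := h' (some q.1.2) (some q.1.1)
    have h2 : f (algebraMap (ZMod p) _ (c / 2)) = g (algebraMap (ZMod p) _ (c / 2)) :=
      congr($(Subsingleton.elim (f.comp (algebraMap (ZMod p) _)) (g.comp (algebraMap (ZMod p) _))) _)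
    simp only [chartMatrix, paramMatrix, chartAlt_of_lt q.2, map_mul, map_sub, hu, h2] at h1
    simpa using (hc2.map g).mul_left_cancel h1

end UniversalMatrix

end PeriodSpace

namespace PeriodSpace

variable {p : ℕ} [Fact p.Prime]

/-! ## Open immersions -/

section OpenImmersion

variable {S T : FpScheme p} {V : Type*} [AddCommGroup V] [Module (ZMod p) V]
variable (f : S ⟶ T) [IsOpenImmersion f.left]

/-- Functions on an open subset `U` of `S`, as functions on the open subset `f(U)` of `T`. -/
abbrev dn (U : S.left.Opens) : Γ(S.left, U) →+* Γ(T.left, f.left ''ᵁ U) :=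
  (f.left.appIso U).inv.hom

theorem dn_rs {U W : S.left.Opens} (h : W ≤ U) (a : Γ(S.left, U)) :
    dn f W (rs h a) = rs (f.left.image_mono h) (dn f U a) :=
  congr($(f.left.appIso_inv_naturality (homOfLE h).op) a)

theorem dn_pl (U : T.left.Opens) (a : Γ(T.left, U)) :
    dn f (f.left ⁻¹ᵁ U) (pl f U a) = rs (f.left.image_preimage_le U) a :=
  congr($(f.left.app_appIso_inv U) a)

theorem pl_dn (U : S.left.Opens) (a : Γ(S.left, U)) :
    pl f (f.left ''ᵁ U) (dn f U a) = rs (f.left.preimage_image_eq U).le a :=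
  congr($(f.left.appIso_inv_app U) a)

theorem pl_injective {W : T.left.Opens} (hW : W ≤ f.left.opensRange) :
    Function.Injective (pl f W) := by
  intro a a' h
  have h1 := congr(dn f _ $h)
  have hle : W ≤ f.left ''ᵁ f.left ⁻¹ᵁ W := by
    rw [f.left.image_preimage_eq_opensRange_inf]
    exact le_inf hW le_rfl
  have h2 := congr(rs hle $h1)
  rwa [dn_pl, dn_pl, rs_rs, rs_rs, rs_refl] at h2

/-- Sections over an open subset `U` of `S`, as sections over `f(U)`. -/
def Sec.down (U : S.left.Opens) : Sec S V U →ₗ[ZMod p] Sec T V (f.left ''ᵁ U) :=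
  mapCoeff V (dn f U)

theorem Sec.down_smul {U : S.left.Opens} (a : Γ(S.left, U)) (s : Sec S V U) :
    Sec.down f U (a • s) = dn f U a • Sec.down f U s :=
  mapCoeff_smul _ _ _

theorem Sec.down_res {U W : S.left.Opens} (h : W ≤ U) (s : Sec S V U) :
    Sec.down f W (Sec.res h s) = Sec.res (f.left.image_mono h) (Sec.down f U s) := by
  simp only [Sec.down, Sec.res, mapCoeff_mapCoeff]
  congr 1
  exact congr(mapCoeff V $(RingHom.ext (dn_rs f h)))

theorem Sec.down_pull (U : T.left.Opens) (s : Sec T V U) :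
    Sec.down f (f.left ⁻¹ᵁ U) (Sec.pull f U s) = Sec.res (f.left.image_preimage_le U) s := by
  simp only [Sec.down, Sec.res, Sec.pull, mapCoeff_mapCoeff]
  congr 1
  exact congr(mapCoeff V $(RingHom.ext (dn_pl f U)))

theorem Sec.pull_down (U : S.left.Opens) (s : Sec S V U) :
    Sec.pull f (f.left ''ᵁ U) (Sec.down f U s) =
      Sec.res (f.left.preimage_image_eq U).le s := by
  simp only [Sec.down, Sec.res, Sec.pull, mapCoeff_mapCoeff]
  congr 1
  exact congr(mapCoeff V $(RingHom.ext (pl_dn f U)))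

namespace Submod

/-- The restriction of a submodule along an open immersion. -/
def openRestrict (K : Submod T V) : Submod S V where
  obj U :=
    { carrier := {s | Sec.down f U s ∈ K.obj (f.left ''ᵁ U)}
      add_mem' := fun h h' ↦ by simpa using add_mem h h'
      zero_mem' := by simp
      smul_mem' := fun a s h ↦ by
        simpa [Sec.down_smul] using Submodule.smul_mem _ _ h }
  res_mem {U W} h s hs := by
    change Sec.down f _ (Sec.res h s) ∈ K.obj _
    rw [Sec.down_res]
    exact K.res_mem _ hs
  mem_of_local {U s} H := by
    refine K.mem_of_local ?_
    rintro _ ⟨x, hx, rfl⟩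
    obtain ⟨W, h, hxW, hW⟩ := H x hx
    refine ⟨f.left ''ᵁ W, f.left.image_mono h, ⟨x, hxW, rfl⟩, ?_⟩
    rw [← Sec.down_res]
    exact hW

theorem pullback_eq_openRestrict (K : Submod T V) : K.pullback f = openRestrict f K := by
  apply le_antisymm
  · rw [pullback_le_iff]
    intro U s hs
    change Sec.down f _ (Sec.pull f U s) ∈ K.obj _
    rw [Sec.down_pull]
    exact K.res_mem _ hs
  · intro U s hs
    have h := pull_mem_pullback f (K := K) hs
    have h1 := (K.pullback f).res_mem (f.left.preimage_image_eq U).ge h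
    rwa [Sec.pull_down, Sec.res_res, Sec.res_refl] at h1

variable {f}

theorem mem_pullback_iff_down {K : Submod T V} {U : S.left.Opens} {s : Sec S V U} :
    s ∈ (K.pullback f).obj U ↔ Sec.down f U s ∈ K.obj (f.left ''ᵁ U) := by
  rw [pullback_eq_openRestrict]
  rfl

theorem pull_mem_pullback_iff {K : Submod T V} {W : T.left.Opens} (hW : W ≤ f.left.opensRange)
    {s : Sec T V W} : Sec.pull f W s ∈ (K.pullback f).obj (f.left ⁻¹ᵁ W) ↔ s ∈ K.obj W := by
  refine ⟨fun h ↦ ?_, pull_mem_pullback f⟩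
  rw [mem_pullback_iff_down, Sec.down_pull] at h
  have hle : W ≤ f.left ''ᵁ f.left ⁻¹ᵁ W := by
    rw [f.left.image_preimage_eq_opensRange_inf]
    exact le_inf hW le_rfl
  have h1 := K.res_mem hle h
  rwa [Sec.res_res, Sec.res_refl] at h1

open Matrix

variable {J : Type*} [Fintype J] {b : Module.Basis J (ZMod p) V}
variable {ι : Type*} [Fintype ι] [DecidableEq ι]

theorem map_dn_rs_pl {L L' : Type*} {U : S.left.Opens} {W : T.left.Opens} (h : W ≤ f.left ''ᵁ U)
    (P : Matrix L L' Γ(S.left, U)) : ((P.map (dn f U)).map (rs h)).map (pl f W) =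
      P.map (rs ((f.left.preimage_mono h).trans (f.left.preimage_image_eq U).le)) := by
  ext i j
  simp only [Matrix.map_apply]
  rw [pl_rs, pl_dn, rs_rs]

theorem IsFrameOn.of_pullback {K : Submod T V} {U : S.left.Opens} {e : Matrix J ι Γ(S.left, U)}
    {α : Matrix ι J Γ(S.left, U)} (H : IsFrameOn b (K.pullback f) U e α) :
    IsFrameOn b K (f.left ''ᵁ U) (e.map (dn f U)) (α.map (dn f U)) where
  left_inv := H.left_inv_map _
  mem_iff {W} h s := by
    have hW : W ≤ f.left.opensRange := h.trans (f.left.image_le_opensRange U)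
    have hWU : f.left ⁻¹ᵁ W ≤ U := (f.left.preimage_mono h).trans (f.left.preimage_image_eq U).le
    rw [← pull_mem_pullback_iff hW, H.mem_iff hWU, crd_pull]
    have hinj : Function.Injective fun v : J → Γ(T.left, W) ↦ pl f W ∘ v :=
      (pl_injective f hW).comp_left
    rw [← hinj.eq_iff]
    simp only [comp_mulVec, map_dn_rs_pl]

end Submod

end OpenImmersion

/-! ## Characteristic subspaces: pullback, and local nature -/

section Local

variable {S T : FpScheme p} {V : Type*} [AddCommGroup V] [Module (ZMod p) V]

namespace Submod

/-- Submodules are determined by their pullbacks to an open covering. -/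
theorem ext_of_openCover {K L : Submod T V}
    (H : ∀ x : T.left, ∃ (S : FpScheme p) (f : S ⟶ T), IsOpenImmersion f.left ∧
      x ∈ Set.range f.left ∧ K.pullback f = L.pullback f) : K = L := by
  refine ext_of_local fun x ↦ ?_
  obtain ⟨S, f, _, hx, h⟩ := H x
  refine ⟨f.left.opensRange, hx, fun W hW ↦ ?_⟩
  ext s
  rw [← pull_mem_pullback_iff hW, h, pull_mem_pullback_iff hW]

theorem mem_obj_comp_iff {R : FpScheme p} {g : R ⟶ S} {f : S ⟶ T} {K : Submod R V}
    {W : T.left.Opens} {t : Sec T V W} : Sec.pull (g ≫ f) W t ∈ K.obj ((g ≫ f).left ⁻¹ᵁ W) ↔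
      Sec.pull g _ (Sec.pull f W t) ∈ K.obj (g.left ⁻¹ᵁ f.left ⁻¹ᵁ W) := by
  rw [Sec.pull_comp]
  rfl

theorem mem_obj_congr {R S' : FpScheme p} {g : R ⟶ S} {f : S ⟶ T} {g' : R ⟶ S'} {f' : S' ⟶ T}
    (h : g ≫ f = g' ≫ f') {K : Submod R V} {W : T.left.Opens} {t : Sec T V W} :
    Sec.pull g _ (Sec.pull f W t) ∈ K.obj (g.left ⁻¹ᵁ f.left ⁻¹ᵁ W) ↔
      Sec.pull g' _ (Sec.pull f' W t) ∈ K.obj (g'.left ⁻¹ᵁ f'.left ⁻¹ᵁ W) := by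
  rw [← mem_obj_comp_iff, ← mem_obj_comp_iff, h]

theorem exists_fiberProduct {S' : FpScheme p} (f : S ⟶ T) (f' : S' ⟶ T) [IsOpenImmersion f.left] :
    ∃ (R : FpScheme p) (g : R ⟶ S) (g' : R ⟶ S'), g ≫ f = g' ≫ f' ∧
      ∃ _ : IsOpenImmersion g'.left, ∀ ⦃y⦄, f'.left y ∈ f.left.opensRange →
        y ∈ g'.left.opensRange := by
  let R : FpScheme p := Over.mk (Limits.pullback.fst f.left f'.left ≫ S.hom)
  let g : R ⟶ S := Over.homMk (Limits.pullback.fst f.left f'.left) rfl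
  let g' : R ⟶ S' := Over.homMk (Limits.pullback.snd f.left f'.left) (by
    change _ = Limits.pullback.fst f.left f'.left ≫ S.hom
    rw [← Over.w f, ← Over.w f', Limits.pullback.condition_assoc])
  refine ⟨R, g, g', Over.OverMorphism.ext Limits.pullback.condition,
    inferInstanceAs (IsOpenImmersion (Limits.pullback.snd f.left f'.left)), fun y hy ↦ ?_⟩
  change y ∈ Set.range (Limits.pullback.snd f.left f'.left)
  rw [Scheme.Pullback.range_snd]
  exact hy

/-- Gluing of submodules. -/
theorem exists_glue {I : Type*} {S : I → FpScheme p} (f : ∀ i, S i ⟶ T)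
    (hf : ∀ i, IsOpenImmersion (f i).left) (L : ∀ i, Submod (S i) V)
    (hL : ∀ i j (R : FpScheme p) (g : R ⟶ S i) (g' : R ⟶ S j), g ≫ f i = g' ≫ f j →
      (L i).pullback g = (L j).pullback g') :
    ∃ K : Submod T V, ∀ i, K.pullback (f i) = L i := by
  let K : Submod T V := sInf (Set.range fun i ↦ pushforward (f i) (L i))
  refine ⟨K, fun i ↦ le_antisymm ?_ ?_⟩
  · rw [pullback_le_iff]
    exact (isGLB_sInf _).1 ⟨i, rfl⟩
  · intro U s hs
    have hi := hf i
    rw [mem_pullback_iff_down, mem_sInf_obj]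
    rintro _ ⟨j, rfl⟩
    have hj := hf j
    rw [mem_pushforward]
    obtain ⟨R, g, g', hw, hg', hle⟩ := exists_fiberProduct (f i) (f j)
    have hle' : (f j).left ⁻¹ᵁ (f i).left ''ᵁ U ≤ g'.left.opensRange := fun y hy ↦
      hle ((f i).left.image_le_opensRange U hy)
    rw [← pull_mem_pullback_iff hle', ← hL i j R g g' hw, ← mem_obj_congr hw, Sec.pull_down]
    exact pull_mem_pullback g ((L i).res_mem _ hs)

end Submod

theorem baseChange_mapCoeff {A A' : Type*} [CommRing A] [CommRing A'] [Algebra (ZMod p) A]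
    [Algebra (ZMod p) A'] (B : LinearMap.BilinForm (ZMod p) V) (f : A →+* A')
    (s t : A ⊗[ZMod p] V) :
    B.baseChange A' (mapCoeff V f s) (mapCoeff V f t) = f (B.baseChange A s t) := by
  have hf (n : ZMod p) (a : A) : f (n • a) = n • f a :=
    map_smul (f.toAddMonoidHom.toZModLinearMap p) n a
  induction s with
  | zero => simp
  | add x y hx hy => simp [hx, hy]
  | tmul x v =>
    induction t with
    | zero => simp
    | add x y hx hy => simp [hx, hy]
    | tmul y w => simp [mapCoeff_tmul, hf]

variable [Module.Finite (ZMod p) V] {B : LinearMap.BilinForm (ZMod p) V} {σ : ℕ}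

namespace Submod

theorem IsTotallyIsotropic.pullback {K : Submod T V} (h : K.IsTotallyIsotropic B)
    {r : ℕ} (h₁ : K.IsLocallyFreeOfRank r) (h₂ : K.IsLocallyDirectSummand) (f : S ⟶ T) :
    (K.pullback f).IsTotallyIsotropic B := by
  intro W s hs t ht
  refine section_ext_of_local fun x hx ↦ ?_
  let b := Module.finBasis (ZMod p) V
  obtain ⟨U, hxU, e, α, H⟩ := exists_isFrameOn b h₁ h₂ (f.left x)
  refine ⟨W ⊓ f.left ⁻¹ᵁ U, inf_le_left, ⟨hx, hxU⟩, ?_⟩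
  have hle : W ⊓ f.left ⁻¹ᵁ U ≤ f.left ⁻¹ᵁ U := inf_le_right
  let ε (i : Fin r) : Sec S V (W ⊓ f.left ⁻¹ᵁ U) :=
    Sec.res hle (Sec.pull f U ((crd b _).symm fun j ↦ e j i))
  have hε (i j : Fin r) : B.baseChange _ (ε i) (ε j) = 0 := by
    simp only [ε, Sec.res, Sec.pull]
    rw [baseChange_mapCoeff, baseChange_mapCoeff, h U _ (H.col_mem i) _ (H.col_mem j), map_zero,
      map_zero]
  have key (s : Sec S V W) (hs : s ∈ (K.pullback f).obj W) :
      ∃ c : Fin r → Γ(S.left, W ⊓ f.left ⁻¹ᵁ U), Sec.res inf_le_left s = ∑ i, c i • ε i := by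
    obtain ⟨c, hc⟩ := ((H.pullback (f := f)).mem_iff_exists hle).1
      ((K.pullback f).res_mem (inf_le_left : W ⊓ f.left ⁻¹ᵁ U ≤ W) hs)
    refine ⟨c, (crd b _).injective ?_⟩
    rw [hc, map_sum]
    ext j
    simp only [ε, map_smul, crd_res, crd_pull, LinearEquiv.apply_symm_apply, Finset.sum_apply,
      Pi.smul_apply, Function.comp_apply, Matrix.mulVec, dotProduct, Matrix.map_apply, smul_eq_mul]
    exact Finset.sum_congr rfl fun i _ ↦ mul_comm _ _
  obtain ⟨c, hc⟩ := key s hs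
  obtain ⟨c', hc'⟩ := key t ht
  have h1 : rs (inf_le_left : W ⊓ f.left ⁻¹ᵁ U ≤ W) (B.baseChange _ s t) = 0 := by
    rw [← baseChange_mapCoeff]
    change B.baseChange _ (Sec.res inf_le_left s) (Sec.res inf_le_left t) = 0
    rw [hc, hc', LinearMap.BilinForm.sum_left]
    refine Finset.sum_eq_zero fun i _ ↦ ?_
    rw [LinearMap.BilinForm.sum_right]
    refine Finset.sum_eq_zero fun j _ ↦ ?_
    rw [LinearMap.BilinForm.smul_left, LinearMap.BilinForm.smul_right, hε, mul_zero, mul_zero]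
  exact h1.trans (map_zero (rs _)).symm

theorem isLocallyFree_pullback {K : Submod T V} {r : ℕ} (h₁ : K.IsLocallyFreeOfRank r)
    (h₂ : K.IsLocallyDirectSummand) (f : S ⟶ T) :
    (K.pullback f).IsLocallyFreeOfRank r ∧ (K.pullback f).IsLocallyDirectSummand := by
  refine locallyFree_of_isFrameOn (Module.finBasis (ZMod p) V) (Fintype.card_fin r) fun x ↦ ?_
  obtain ⟨U, hxU, e, α, H⟩ := exists_isFrameOn (Module.finBasis (ZMod p) V) h₁ h₂ (f.left x)
  exact ⟨_, hxU, _, _, H.pullback⟩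

theorem IsCharacteristic.pullback {K : Submod T V} (h : K.IsCharacteristic B σ) (f : S ⟶ T) :
    (K.pullback f).IsCharacteristic B σ := by
  obtain ⟨h1, h2⟩ := isLocallyFree_pullback h.locallyFree h.summand f
  obtain ⟨h3, h4⟩ := isLocallyFree_pullback h.locallyFree_addFrob h.summand_addFrob f
  rw [← addFrob_pullback] at h3 h4
  exact ⟨h.isotropic.pullback h.locallyFree h.summand f, h1, h2, h3, h4⟩

theorem isLocallyFree_of_local {K : Submod T V} {r : ℕ}
    (H : ∀ x : T.left, ∃ (S : FpScheme p) (f : S ⟶ T), IsOpenImmersion f.left ∧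
      x ∈ Set.range f.left ∧
      (K.pullback f).IsLocallyFreeOfRank r ∧ (K.pullback f).IsLocallyDirectSummand) :
    K.IsLocallyFreeOfRank r ∧ K.IsLocallyDirectSummand := by
  refine locallyFree_of_isFrameOn (Module.finBasis (ZMod p) V) (Fintype.card_fin r) fun x ↦ ?_
  obtain ⟨S, f, _, ⟨y, rfl⟩, h₁, h₂⟩ := H x
  obtain ⟨U, hxU, e, α, H⟩ := exists_isFrameOn (Module.finBasis (ZMod p) V) h₁ h₂ y
  exact ⟨f.left ''ᵁ U, ⟨y, hxU, rfl⟩, _, _, H.of_pullback⟩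

/-- Being characteristic is a local property. -/
theorem isCharacteristic_of_local {K : Submod T V}
    (H : ∀ x : T.left, ∃ (S : FpScheme p) (f : S ⟶ T), IsOpenImmersion f.left ∧
      x ∈ Set.range f.left ∧ (K.pullback f).IsCharacteristic B σ) :
    K.IsCharacteristic B σ := by
  obtain ⟨h1, h2⟩ := isLocallyFree_of_local (K := K) (r := σ) fun x ↦ by
    obtain ⟨S, f, h, hx, hK⟩ := H x
    exact ⟨S, f, h, hx, hK.locallyFree, hK.summand⟩
  obtain ⟨h3, h4⟩ := isLocallyFree_of_local (K := K.addFrob) (r := σ + 1) fun x ↦ by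
    obtain ⟨S, f, h, hx, hK⟩ := H x
    refine ⟨S, f, h, hx, ?_⟩
    rw [← addFrob_pullback]
    exact ⟨hK.locallyFree_addFrob, hK.summand_addFrob⟩
  refine ⟨fun U s hs t ht ↦ ?_, h1, h2, h3, h4⟩
  refine section_ext_of_local fun x hx ↦ ?_
  obtain ⟨S, f, h, hxf, hK⟩ := H x
  have hle : U ⊓ f.left.opensRange ≤ U := inf_le_left
  refine ⟨U ⊓ f.left.opensRange, hle, ⟨hx, hxf⟩, pl_injective f inf_le_right ?_⟩
  have h5 := hK.isotropic _ _ (pull_mem_pullback f (K.res_mem hle hs)) _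
    (pull_mem_pullback f (K.res_mem hle ht))
  simp only [Sec.res, Sec.pull] at h5
  rw [baseChange_mapCoeff, baseChange_mapCoeff] at h5
  exact h5.trans (by rw [map_zero, map_zero])

end Submod

end Local

end PeriodSpace

namespace PeriodSpace

variable {p : ℕ} [Fact p.Prime]

/-! ## The charts of the period space -/

section Charts

/-- An adapted basis, together with a square root of the parameter `d`. -/
structure Chart {V : Type*} [AddCommGroup V] [Module (ZMod p) V]
    (B : LinearMap.BilinForm (ZMod p) V) (m : ℕ) where
  /-- The first parameter of the Gram matrix. -/
  c : ZMod p
  /-- The second parameter of the Gram matrix. -/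
  d : ZMod p
  /-- The basis. -/
  b : Module.Basis (Option (Fin m) ⊕ Option (Fin m)) (ZMod p) V
  isAdapted : IsAdapted B c d b
  /-- A square root of `d`. -/
  θ : GaloisField p 2
  θ_sq : θ ^ 2 = algebraMap _ _ d

variable (p) in
/-- The scheme of a chart. -/
def chartScheme (m : ℕ) : FpScheme p :=
  Over.mk (Spec.map (CommRingCat.ofHom
    (algebraMap (ZMod p) (ChartRing p (GaloisField p 2) m))))

variable (p) in
/-- The elements of the chart ring, as functions on the scheme of the chart. -/
def chartFun (m : ℕ) : ChartRing p (GaloisField p 2) m →+* Γ((chartScheme p m).left, ⊤) :=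
  (Scheme.ΓSpecIso (CommRingCat.of (ChartRing p (GaloisField p 2) m))).inv.hom

theorem hom_spec_zmod_ext {n : ℕ} {X : Scheme.{0}} (f g : X ⟶ Spec (CommRingCat.of (ZMod n))) :
    f = g :=
  ext_to_Spec (CommRingCat.hom_ext (Subsingleton.elim (α := ZMod n →+* Γ(X, ⊤)) _ _))

variable {m : ℕ} {T : FpScheme p}

/-- The pullback of functions along a morphism to the scheme of a chart. -/
def chartPull (f : T ⟶ chartScheme p m) : ChartRing p (GaloisField p 2) m →+* Γ(T.left, ⊤) :=
  f.left.appTop.hom.comp (chartFun p m)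

theorem chartScheme_hom_ext {f g : T ⟶ chartScheme p m} (h : chartPull f = chartPull g) :
    f = g := by
  apply Over.OverMorphism.ext
  refine ext_to_Spec (R := ChartRing p (GaloisField p 2) m) (CommRingCat.hom_ext ?_)
  exact h

theorem exists_hom_chartScheme (g : ChartRing p (GaloisField p 2) m →+* Γ(T.left, ⊤)) :
    ∃ f : T ⟶ chartScheme p m, chartPull f = g := by
  let f : T.left ⟶ Spec (.of (ChartRing p (GaloisField p 2) m)) :=
    ΓSpec.adjunction.homEquiv T.left (.op (.of (ChartRing p (GaloisField p 2) m)))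
      (CommRingCat.ofHom g).op
  refine ⟨Over.homMk f (hom_spec_zmod_ext _ _), ?_⟩
  exact congr($(ΓSpecIso_inv_ΓSpec_adjunction_homEquiv (CommRingCat.ofHom g)).hom)

variable {V : Type*} [AddCommGroup V] [Module (ZMod p) V] {B : LinearMap.BilinForm (ZMod p) V}

open Submod Matrix

namespace Chart

variable (C : Chart B m)

/-- The universal matrix, as a matrix of functions on the scheme of the chart. -/
def matrix : Matrix (Option (Fin m)) (Option (Fin m)) Γ((chartScheme p m).left, ⊤) :=
  (chartMatrix m C.c C.θ).map (chartFun p m)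

/-- The universal characteristic subspace over the scheme of a chart. -/
def submod : Submod (chartScheme p m) V :=
  ofFrame C.b ⊤ (fromRows 1 C.matrix) (fromCols 1 0)

theorem isGraphOn : IsGraphOn C.b C.submod ⊤ C.matrix :=
  isFrameOn_ofFrame C.b (by simp [fromCols_mul_fromRows])

theorem isCharacteristic (hp : 3 ≤ p) : C.submod.IsCharacteristic B (m + 1) :=
  (C.isGraphOn.isCharacteristic_iff hp C.isAdapted).2
    ((chartMatrix_eqs hp C.isAdapted.not_isSquare C.θ_sq).map _)

theorem isGraphOn_pullback (f : T ⟶ chartScheme p m) :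
    IsGraphOn C.b (C.submod.pullback f) ⊤
      ((chartMatrix m C.c C.θ).map (chartPull f)) := by
  exact C.isGraphOn.pullback (f := f)

theorem hom_ext (hp : 3 ≤ p) {f g : T ⟶ chartScheme p m}
    (h : C.submod.pullback f = C.submod.pullback g) : f = g := by
  refine chartScheme_hom_ext (chart_ringHom_ext hp C.isAdapted.ne_zero C.isAdapted.not_isSquare
    C.θ_sq ?_)
  have h1 := C.isGraphOn_pullback f
  rw [h] at h1
  exact h1.unique (C.isGraphOn_pullback g)

theorem exists_hom (hp : 3 ≤ p) {L : Submod T V} (hL : L.IsCharacteristic B (m + 1))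
    {A : Matrix (Option (Fin m)) (Option (Fin m)) Γ(T.left, ⊤)} (H : IsGraphOn C.b L ⊤ A) :
    ∃ f : T ⟶ chartScheme p m, C.submod.pullback f = L ∧
      (chartMatrix m C.c C.θ).map (chartPull f) = A := by
  obtain ⟨g, hg⟩ := exists_chart_ringHom hp C.isAdapted.ne_zero C.isAdapted.not_isSquare C.θ_sq
    ((H.isCharacteristic_iff hp C.isAdapted).1 hL)
  obtain ⟨f, hf⟩ := exists_hom_chartScheme g
  refine ⟨f, ?_, by rw [hf, hg]⟩
  have h1 := C.isGraphOn_pullback f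
  rw [hf, hg] at h1
  exact h1.eq_of_top H

end Chart

theorem Submod.IsFrameOn.reindex {J ι ι' : Type*} [Fintype J] [Fintype ι] [DecidableEq ι]
    [Fintype ι'] [DecidableEq ι'] {b : Module.Basis J (ZMod p) V} {K : Submod T V}
    {U : T.left.Opens} {e : Matrix J ι Γ(T.left, U)} {α : Matrix ι J Γ(T.left, U)}
    (H : IsFrameOn b K U e α) (σ : ι' ≃ ι) :
    IsFrameOn b K U (e.submatrix id σ) (α.submatrix σ id) where
  left_inv := by
    rw [← Matrix.submatrix_mul _ _ _ _ _ Function.bijective_id, H.left_inv,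
      Matrix.submatrix_one_equiv]
  mem_iff {W} h s := by
    rw [H.mem_iff h, mulVec_mulVec, mulVec_mulVec, ← Matrix.map_mul, ← Matrix.map_mul,
      Matrix.submatrix_mul_equiv, Matrix.submatrix_id_id]

theorem evaluation_rs {U W : T.left.Opens} (h : W ≤ U) {x : T.left} (hx : x ∈ W)
    (a : Γ(T.left, U)) :
    T.left.evaluation W x hx (rs h a) = T.left.evaluation U x (h hx) a := by
  rw [← Scheme.germ_residue, ← Scheme.germ_residue]
  exact congr(T.left.residue x $(TopCat.Presheaf.germ_res_apply T.left.presheaf (homOfLE h) x hx a))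

variable [Module.Finite (ZMod p) V]

/-- Every point has a neighbourhood over which a given characteristic subspace is a graph with
respect to some adapted basis. -/
theorem exists_mem_graphDomain (hp : 3 ≤ p) (hdim : Module.finrank (ZMod p) V = 2 * (m + 1))
    (hsymm : B.IsSymm) (hnondeg : B.Nondegenerate) (hnonneutral : ¬ IsNeutral B (m + 1))
    {L : Submod T V} (hL : L.IsCharacteristic B (m + 1)) (x : T.left) :
    ∃ C : Chart B m, x ∈ graphDomain C.b L := by
  let κ := T.left.residueField x
  let ev (U : T.left.Opens) (hx : x ∈ U) : Γ(T.left, U) →+* κ := (T.left.evaluation U x hx).hom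
  let : Algebra (ZMod p) κ := ((ev ⊤ trivial).comp (algebraMap (ZMod p) _)).toAlgebra
  let P : Set (κ ⊗[ZMod p] V) := {t | ∃ (U : T.left.Opens) (hx : x ∈ U) (s : Sec T V U),
    s ∈ L.obj U ∧ mapCoeff V (ev U hx) s = t}
  have hres {U W : T.left.Opens} (h : W ≤ U) (hx : x ∈ W) (s : Sec T V U) :
      mapCoeff V (ev W hx) (Sec.res h s) = mapCoeff V (ev U (h hx)) s := by
    rw [Sec.res, mapCoeff_mapCoeff]
    congr 1
    exact congr(mapCoeff V $(RingHom.ext (evaluation_rs h hx)))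
  have hP : ∀ s ∈ P, ∀ t ∈ P, B.baseChange κ s t = 0 := by
    rintro _ ⟨U, hx, s, hs, rfl⟩ _ ⟨U', hx', t, ht, rfl⟩
    rw [← hres (inf_le_left : U ⊓ U' ≤ U) ⟨hx, hx'⟩, ← hres (inf_le_right : U ⊓ U' ≤ U') ⟨hx, hx'⟩,
      baseChange_mapCoeff, hL.isotropic _ _ (L.res_mem _ hs) _ (L.res_mem _ ht), map_zero]
  have hX : ∀ s ∈ Submodule.span κ P, ∀ t ∈ Submodule.span κ P, B.baseChange κ s t = 0 := by
    intro s hs t ht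
    induction hs using Submodule.span_induction with
    | zero => simp
    | add s s' _ _ h h' => rw [map_add, LinearMap.add_apply, h, h', add_zero]
    | smul a s _ h => rw [map_smul, LinearMap.smul_apply, h, smul_zero]
    | mem s hs =>
      induction ht using Submodule.span_induction with
      | zero => simp
      | add s s' _ _ h h' => rw [map_add, h, h', add_zero]
      | smul a s _ h => rw [map_smul, h, smul_zero]
      | mem t ht => exact hP s hs t ht
  obtain ⟨c, d, b, hb, hinj⟩ := exists_isAdapted hp hdim hsymm hnondeg hnonneutral _ hX
  obtain ⟨θ, hθ⟩ := exists_sq_eq d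
  refine ⟨⟨c, d, b, hb, θ, hθ⟩, ?_⟩
  obtain ⟨U, hxU, e₀, α₀, H₀⟩ := exists_isFrameOn b hL.locallyFree hL.summand x
  have H := H₀.reindex (Fintype.equivFinOfCardEq (by simp) : Option (Fin m) ≃ Fin (m + 1))
  set e := e₀.submatrix id (Fintype.equivFinOfCardEq (by simp) : Option (Fin m) ≃ Fin (m + 1))
  have hdet : ev U hxU e.toRows₁.det ≠ 0 := by
    intro h0
    rw [RingHom.map_det] at h0
    obtain ⟨v, hv0, hv⟩ := Matrix.exists_mulVec_eq_zero_iff.2 h0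
    have hs : (crd b κ).symm ((e.map (ev U hxU)) *ᵥ v) ∈ Submodule.span κ P := by
      have h1 : (crd b κ).symm ((e.map (ev U hxU)) *ᵥ v) =
          ∑ i, v i • mapCoeff V (ev U hxU) ((crd b _).symm fun j ↦ e j i) := by
        rw [LinearEquiv.symm_apply_eq, map_sum]
        ext j
        simp only [map_smul, crd_mapCoeff, LinearEquiv.apply_symm_apply, Finset.sum_apply,
          Pi.smul_apply, Function.comp_apply, Matrix.mulVec, dotProduct, Matrix.map_apply,
          smul_eq_mul]
        exact Finset.sum_congr rfl fun i _ ↦ mul_comm _ _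
      rw [h1]
      exact sum_mem fun i _ ↦ Submodule.smul_mem _ _
        (Submodule.subset_span ⟨U, hxU, _, H.col_mem i, rfl⟩)
    have h2 := hinj _ hs fun i ↦ by
      rw [LinearEquiv.apply_symm_apply]
      exact congr_fun hv i
    rw [LinearEquiv.symm_apply_eq, map_zero] at h2
    have h3 := congr((α₀.submatrix (Fintype.equivFinOfCardEq (by simp) :
      Option (Fin m) ≃ Fin (m + 1)) id).map (ev U hxU) *ᵥ $h2)
    rw [mulVec_mulVec, H.left_inv_map, one_mulVec, mulVec_zero] at h3
    exact hv0 h3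
  have hxD : x ∈ T.left.basicOpen e.toRows₁.det :=
    (T.left.evaluation_ne_zero_iff_mem_basicOpen x hxU _).1 hdet
  have hle : T.left.basicOpen e.toRows₁.det ≤ U := T.left.basicOpen_le _
  refine ((H.restrict hle).isGraphOn ?_).le_graphDomain hxD
  have h4 : ((e.map (rs hle)).toRows₁).det = rs hle e.toRows₁.det := by
    rw [RingHom.map_det]
    rfl
  rw [h4]
  exact RingedSpace.isUnit_res_basicOpen _ _

end Charts

end PeriodSpace

namespace PeriodSpace

variable {p : ℕ} [Fact p.Prime]

/-! ## The functor of characteristic subspaces -/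

section CharData

variable {V : Type*} [AddCommGroup V] [Module (ZMod p) V]

/-- A structure of `𝔽_p`-scheme on `T`, together with a characteristic subspace. -/
structure CharData (B : LinearMap.BilinForm (ZMod p) V) (σ : ℕ) (T : Scheme.{0}) where
  /-- The structure morphism. -/
  s : T ⟶ Spec (CommRingCat.of (ZMod p))
  /-- The characteristic subspace. -/
  L : Submod (Over.mk s) V
  char : L.IsCharacteristic B σ

variable [Module.Finite (ZMod p) V] {B : LinearMap.BilinForm (ZMod p) V} {σ : ℕ}
  {T T' T'' : Scheme.{0}}

instance : Small.{0} (CharData B σ T) := by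
  have (s : T ⟶ Spec (CommRingCat.of (ZMod p))) : Small.{0} (Submod (Over.mk s) V) := by
    have (U : (Over.mk s).left.Opens) : Small.{0} (Sec (Over.mk s) V U) :=
      small_of_injective (crd (Module.finBasis (ZMod p) V) Γ((Over.mk s).left, U)).injective
    refine small_of_injective (β := ∀ U : (Over.mk s).left.Opens, Set (Sec (Over.mk s) V U))
      (f := fun K U ↦ K.obj U) fun K L h ↦ ?_
    exact Submod.ext (funext fun U ↦ SetLike.coe_injective (congr_fun h U))
  refine small_of_injective (β := Σ s : T ⟶ Spec (CommRingCat.of (ZMod p)), Submod (Over.mk s) V)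
    (f := fun x ↦ ⟨x.s, x.L⟩) ?_
  rintro ⟨s, L, h⟩ ⟨s', L', h'⟩ he
  cases he
  rfl

namespace CharData

/-- A morphism of schemes, as a morphism of `𝔽_p`-schemes. -/
abbrev hom (f : T' ⟶ T) (s' : T' ⟶ Spec (CommRingCat.of (ZMod p)))
    (s : T ⟶ Spec (CommRingCat.of (ZMod p))) : (Over.mk s' : FpScheme p) ⟶ Over.mk s :=
  Over.homMk f (hom_spec_zmod_ext _ _)

/-- The pullback of a characteristic subspace. -/
def map (f : T' ⟶ T) (x : CharData B σ T) : CharData B σ T' :=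
  ⟨f ≫ x.s, x.L.pullback (hom f _ _), x.char.pullback _⟩

theorem map_eq_iff {f : T' ⟶ T} {x : CharData B σ T} {y : CharData B σ T'} :
    x.map f = y ↔ x.L.pullback (hom f y.s x.s) = y.L := by
  obtain ⟨s, L, h⟩ := y
  obtain rfl : s = f ≫ x.s := hom_spec_zmod_ext _ _
  simp [map]

theorem map_id (x : CharData B σ T) : x.map (𝟙 T) = x :=
  map_eq_iff.2 (x.L.pullback_id)

theorem map_comp (f : T' ⟶ T) (g : T'' ⟶ T') (x : CharData B σ T) :
    x.map (g ≫ f) = (x.map f).map g :=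
  map_eq_iff.2 (Submod.pullback_comp (hom g _ _) (hom f _ _) x.L)

theorem map_eq_map_iff {S : Scheme.{0}} {f : S ⟶ T} {g : S ⟶ T'} {x : CharData B σ T}
    {y : CharData B σ T'} (s : S ⟶ Spec (CommRingCat.of (ZMod p))) : x.map f = y.map g ↔
      x.L.pullback (hom f s x.s) = y.L.pullback (hom g s y.s) := by
  obtain rfl : s = g ≫ y.s := hom_spec_zmod_ext _ _
  exact map_eq_iff

theorem ext_of_openCover (𝓤 : T.OpenCover) {x y : CharData B σ T}
    (h : ∀ i, x.map (𝓤.f i) = y.map (𝓤.f i)) : x = y := by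
  rw [← x.map_id, map_eq_iff]
  refine Submod.ext_of_openCover fun t ↦ ?_
  refine ⟨Over.mk (𝓤.f (𝓤.idx t) ≫ y.s), hom _ _ _, inferInstanceAs (IsOpenImmersion (𝓤.f _)),
    𝓤.covers t, ?_⟩
  rw [← Submod.pullback_comp]
  refine (Eq.trans ?_ ((map_eq_map_iff _).1 (h (𝓤.idx t))))
  congr 1

theorem exists_glue (𝓤 : T.OpenCover) (x : ∀ i, CharData B σ (𝓤.X i))
    (hx : ∀ i j (R : Scheme.{0}) (g : R ⟶ 𝓤.X i) (g' : R ⟶ 𝓤.X j), g ≫ 𝓤.f i = g' ≫ 𝓤.f j →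
      (x i).map g = (x j).map g') :
    ∃ y : CharData B σ T, ∀ i, y.map (𝓤.f i) = x i := by
  let s : T ⟶ Spec (CommRingCat.of (ZMod p)) :=
    𝓤.glueMorphisms (fun i ↦ (x i).s) fun i j ↦ hom_spec_zmod_ext _ _
  let f (i) : (Over.mk (x i).s : FpScheme p) ⟶ Over.mk s := hom (𝓤.f i) _ _
  obtain ⟨K, hK⟩ := Submod.exists_glue f (fun i ↦ inferInstanceAs (IsOpenImmersion (𝓤.f i)))
    (fun i ↦ (x i).L) fun i j R g g' h ↦ by
      exact (map_eq_map_iff R.hom).1 (hx i j R.left g.left g'.left congr(($h).left))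
  refine ⟨⟨s, K, Submod.isCharacteristic_of_local fun t ↦ ?_⟩, fun i ↦ map_eq_iff.2 (hK i)⟩
  refine ⟨_, f (𝓤.idx t), inferInstanceAs (IsOpenImmersion (𝓤.f _)), 𝓤.covers t, ?_⟩
  rw [hK]
  exact (x _).char

end CharData

variable (B σ) in
/-- The functor of characteristic subspaces, on the category of schemes. -/
def charFunctor : Scheme.{0}ᵒᵖ ⥤ Type where
  obj T := Shrink.{0} (CharData B σ T.unop)
  map f := TypeCat.ofHom fun x ↦ equivShrink _ (((equivShrink _).symm x).map f.unop)
  map_id T := by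
    ext x
    simp [CharData.map_id]
  map_comp f g := by
    ext x
    simp [CharData.map_comp]

theorem charFunctor_map_eq_iff {f : T' ⟶ T} {x : CharData B σ T} {y : CharData B σ T'} :
    (charFunctor B σ).map f.op (equivShrink _ x) = equivShrink _ y ↔ x.map f = y := by
  change equivShrink _ (((equivShrink _).symm (equivShrink _ x)).map f) = _ ↔ _
  rw [Equiv.symm_apply_apply, (equivShrink _).injective.eq_iff]

/-- The morphism of functors given by a characteristic subspace. -/
def CharData.toNatTrans (y : CharData B σ T) : yoneda.obj T ⟶ charFunctor B σ :=
  yonedaEquiv.symm (equivShrink _ y)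

theorem CharData.toNatTrans_app (y : CharData B σ T) (f : T' ⟶ T) :
    y.toNatTrans.app (.op T') f = equivShrink _ (y.map f) :=
  charFunctor_map_eq_iff.2 rfl

theorem CharData.toNatTrans_surjective (g : yoneda.obj T ⟶ charFunctor B σ) :
    ∃ y : CharData B σ T, y.toNatTrans = g := by
  obtain ⟨y, rfl⟩ := yonedaEquiv.symm.surjective g
  obtain ⟨y, rfl⟩ := (equivShrink _).surjective y
  exact ⟨y, rfl⟩

theorem isSheaf_charFunctor :
    Presieve.IsSheaf Scheme.zariskiTopology (charFunctor B σ) := by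
  rw [Precoverage.isSheaf_toGrothendieck_iff_of_isStableUnderBaseChange]
  rintro T S hS x hx
  obtain ⟨(𝓤 : T.OpenCover), rfl⟩ := Scheme.exists_cover_of_mem_pretopology hS
  obtain ⟨y, hy⟩ := CharData.exists_glue 𝓤 (fun i ↦ (equivShrink _).symm (x (𝓤.f i) (.mk i)))
    fun i j R g g' h ↦ (equivShrink _).injective (hx g g' (.mk i) (.mk j) h)
  refine ⟨equivShrink _ y, ?_, ?_⟩
  · rintro Z e ⟨i⟩
    obtain ⟨z, hz⟩ := (equivShrink _).surjective (x (𝓤.f i) (.mk i))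
    rw [← hz, charFunctor_map_eq_iff, hy, ← hz, Equiv.symm_apply_apply]
  · intro z hz
    obtain ⟨z, rfl⟩ := (equivShrink _).surjective z
    congr 1
    refine CharData.ext_of_openCover 𝓤 fun i ↦ ?_
    rw [hy, ← charFunctor_map_eq_iff]
    exact (hz (𝓤.f i) (.mk i)).trans ((equivShrink _).apply_symm_apply _).symm

end CharData

section Representability

variable {V : Type*} [AddCommGroup V] [Module (ZMod p) V]
  {B : LinearMap.BilinForm (ZMod p) V} {m : ℕ} {R T : FpScheme p}

open Submod

namespace Chart

variable (C : Chart B m)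

theorem mem_graphDomain_of_pullback_eq {L : Submod T V} (hL : L.IsCharacteristic B (m + 1))
    {g : R ⟶ T} {h : R ⟶ chartScheme p m} (H : C.submod.pullback h = L.pullback g) (x : R.left) :
    g.left x ∈ graphDomain C.b L := by
  obtain ⟨U, hxU, e, α, H₀⟩ := exists_isFrameOn C.b hL.locallyFree hL.summand (g.left x)
  have h1 := C.isGraphOn_pullback h
  rw [H] at h1
  exact mem_graphDomain_of_pullback
    (H₀.reindex (Fintype.equivFinOfCardEq (by simp) : Option (Fin m) ≃ Fin (m + 1))) h1 hxU trivial

/-- The open subscheme of `T` where `L` belongs to the chart. -/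
def dom (L : Submod T V) : FpScheme p := Over.mk ((graphDomain C.b L).ι ≫ T.hom)

/-- The inclusion of the open subscheme where `L` belongs to the chart. -/
def domι (L : Submod T V) : C.dom L ⟶ T := Over.homMk (graphDomain C.b L).ι

variable [Module.Finite (ZMod p) V]

theorem exists_dom_hom (hp : 3 ≤ p) {L : Submod T V} (hL : L.IsCharacteristic B (m + 1)) :
    ∃ h : C.dom L ⟶ chartScheme p m, C.submod.pullback h = L.pullback (C.domι L) := by
  obtain ⟨A, H⟩ := exists_isGraphOn_graphDomain (b := C.b) L
  have h1 := (H.pullback (f := C.domι L)).restrict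
    (W := ⊤) ((graphDomain C.b L).ι_preimage_self.ge)
  obtain ⟨h, hh, -⟩ := C.exists_hom hp (hL.pullback _) h1
  exact ⟨h, hh⟩

instance : Small.{0} (Chart B m) := by
  have : Finite V := Module.finite_of_finite (ZMod p)
  refine small_of_injective (β := ZMod p × ZMod p × GaloisField p 2 ×
    (Option (Fin m) ⊕ Option (Fin m) → V)) (f := fun C ↦ ⟨C.c, C.d, C.θ, C.b⟩) ?_
  rintro ⟨c, d, b, h, θ, hθ⟩ ⟨c', d', b', h', θ', hθ'⟩ he
  simp only [Prod.mk.injEq] at he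
  obtain ⟨rfl, rfl, rfl, he⟩ := he
  obtain rfl := DFunLike.coe_injective he
  rfl

/-- The universal characteristic subspace over the scheme of a chart. -/
def charData (hp : 3 ≤ p) : CharData B (m + 1) (chartScheme p m).left :=
  ⟨(chartScheme p m).hom, C.submod, C.isCharacteristic hp⟩

end Chart

variable [Module.Finite (ZMod p) V]

theorem isOpenImmersion_toNatTrans_charData (hp : 3 ≤ p) (C : Chart B m) :
    IsOpenImmersion.presheaf (C.charData hp).toNatTrans := by
  refine MorphismProperty.relative.of_exists fun T g ↦ ?_
  obtain ⟨y, rfl⟩ := CharData.toNatTrans_surjective g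
  obtain ⟨h, hh⟩ := C.exists_dom_hom hp y.char
  let h' : (graphDomain C.b y.L).toScheme ⟶ (chartScheme p m).left := h.left
  have h1 : (C.charData hp).map h' = y.map (graphDomain C.b y.L).ι :=
    (CharData.map_eq_map_iff _).2 hh
  refine ⟨_, yoneda.map h', (graphDomain C.b y.L).ι, ?_, inferInstance⟩
  refine IsPullback.of_forall_isPullback_app fun ⟨R⟩ ↦ ?_
  rw [Types.isPullback_iff]
  refine ⟨?_, ?_, ?_⟩
  · ext f
    refine (CharData.toNatTrans_app _ (f ≫ h')).trans
      (Eq.trans ?_ (CharData.toNatTrans_app _ (f ≫ (graphDomain C.b y.L).ι)).symm)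
    rw [CharData.map_comp, h1, ← CharData.map_comp]
  · rintro f f' ⟨-, h2⟩
    exact (cancel_mono (graphDomain C.b y.L).ι).1 h2
  · intro (f : R ⟶ _) (f' : R ⟶ T) hf
    replace hf : (C.charData hp).map f = y.map f' := (equivShrink _).injective
      (((CharData.toNatTrans_app _ _).symm.trans hf).trans (CharData.toNatTrans_app _ _))
    have h2 := (CharData.map_eq_map_iff (f' ≫ y.s)).1 hf
    have h3 (x) : f' x ∈ graphDomain C.b y.L :=
      C.mem_graphDomain_of_pullback_eq y.char h2 x
    have h4 : Set.range f' ⊆ Set.range (graphDomain C.b y.L).ι := by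
      rw [Scheme.Opens.range_ι]
      rintro _ ⟨x, rfl⟩
      exact h3 x
    let k := IsOpenImmersion.lift (graphDomain C.b y.L).ι f' h4
    have hk : k ≫ (graphDomain C.b y.L).ι = f' := IsOpenImmersion.lift_fac _ _ _
    refine ⟨k, ?_, hk⟩
    have h5 : (C.charData hp).map (k ≫ h') = (C.charData hp).map f := by
      rw [CharData.map_comp, h1, ← CharData.map_comp, hk, hf]
    have h6 := (CharData.map_eq_map_iff (f' ≫ y.s)).1 h5
    have h7 : CharData.hom (k ≫ h') (f' ≫ y.s) (chartScheme p m).hom =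
      CharData.hom f (f' ≫ y.s) (chartScheme p m).hom := C.hom_ext hp h6
    exact congr_arg CommaMorphism.left h7

theorem isLocallySurjective_charData (hp : 3 ≤ p)
    (hdim : Module.finrank (ZMod p) V = 2 * (m + 1)) (hsymm : B.IsSymm) (hnondeg : B.Nondegenerate)
    (hnonneutral : ¬ IsNeutral B (m + 1)) :
    Presheaf.IsLocallySurjective Scheme.zariskiTopology
      (Sigma.desc fun C : Shrink.{0} (Chart B m) ↦
        (((equivShrink _).symm C).charData hp).toNatTrans) := by
  refine ⟨fun {T} y ↦ ?_⟩
  obtain ⟨y, rfl⟩ := (equivShrink _).surjective y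
  choose C hC using exists_mem_graphDomain hp hdim hsymm hnondeg hnonneutral y.char
  let 𝓤 : T.OpenCover := T.openCoverOfIsOpenCover (fun x : T ↦ graphDomain (C x).b y.L)
    (.mk (top_le_iff.1 fun x _ ↦ Opens.mem_iSup.2 ⟨x, hC x⟩))
  refine GrothendieckTopology.superset_covering _ ?_ 𝓤.mem_grothendieckTopology
  rw [Sieve.generate_le_iff]
  rintro Z e ⟨x⟩
  obtain ⟨h, hh⟩ := (C x).exists_dom_hom hp y.char
  let h' : (graphDomain (C x).b y.L).toScheme ⟶ (chartScheme p m).left := h.left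
  have h1 : ((C x).charData hp).map h' = y.map (graphDomain (C x).b y.L).ι :=
    (CharData.map_eq_map_iff _).2 hh
  let Y (C : Shrink.{0} (Chart B m)) := yoneda.obj (chartScheme p m).left
  let q (C : Shrink.{0} (Chart B m)) : Y C ⟶ charFunctor B (m + 1) :=
    (((equivShrink _).symm C).charData hp).toNatTrans
  have h2 : Sigma.ι Y (equivShrink _ (C x)) ≫ Sigma.desc q = ((C x).charData hp).toNatTrans := by
    rw [Sigma.ι_desc]
    simp only [q, Equiv.symm_apply_apply]
  refine ⟨(Sigma.ι Y (equivShrink _ (C x))).app _ h', ?_⟩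
  refine (ConcreteCategory.congr_hom (congr_app h2 _) h').trans ?_
  exact (CharData.toNatTrans_app _ _).trans (charFunctor_map_eq_iff.2 h1.symm).symm

/-- The functor of characteristic subspaces is representable. -/
theorem exists_isPeriodSpace (hp : 3 ≤ p)
    (hdim : Module.finrank (ZMod p) V = 2 * (m + 1)) (hsymm : B.IsSymm) (hnondeg : B.Nondegenerate)
    (hnonneutral : ¬ IsNeutral B (m + 1)) :
    ∃ (M : FpScheme p) (K : Submod M V), IsPeriodSpace B (m + 1) M K := by
  let F : Sheaf Scheme.zariskiTopology (Type) :=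
    ⟨charFunctor B (m + 1), (isSheaf_iff_isSheaf_of_type _ _).2 isSheaf_charFunctor⟩
  have := isLocallySurjective_charData hp hdim hsymm hnondeg hnonneutral
  obtain ⟨M, ⟨e⟩⟩ := Scheme.LocalRepresentability.isRepresentable (F := F)
    (f := fun C : Shrink.{0} (Chart B m) ↦ (((equivShrink _).symm C).charData hp).toNatTrans)
    (fun C ↦ isOpenImmersion_toNatTrans_charData hp _)
  let y : CharData B (m + 1) M := (equivShrink _).symm (e.homEquiv (𝟙 M))
  have he {T : Scheme.{0}} (f : T ⟶ M) : e.homEquiv f = equivShrink _ (y.map f) := by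
    rw [e.homEquiv_eq]
    refine Eq.trans ?_ (charFunctor_map_eq_iff.2 rfl)
    exact congr_arg _ (Equiv.apply_symm_apply _ _).symm
  refine ⟨Over.mk y.s, y.L, y.char, fun S L hL ↦ ?_⟩
  let z : CharData B (m + 1) S.left := ⟨S.hom, L, hL⟩
  obtain ⟨f, hf⟩ := e.homEquiv.surjective (equivShrink _ z)
  have h1 : y.map f = z := (equivShrink _).injective ((he f).symm.trans hf)
  refine ⟨CharData.hom f z.s y.s, CharData.map_eq_iff.1 h1, fun g hg ↦ ?_⟩
  apply Over.OverMorphism.ext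
  refine e.homEquiv.injective (((he g.left).trans ?_).trans hf.symm)
  congr 1
  exact CharData.map_eq_iff.2 hg

end Representability

end PeriodSpace

namespace PeriodSpace

variable {p : ℕ} [Fact p.Prime]

/-! ## The charts as open subschemes of the period space -/

section PeriodCharts

variable {V : Type*} [AddCommGroup V] [Module (ZMod p) V] [Module.Finite (ZMod p) V]
  {B : LinearMap.BilinForm (ZMod p) V} {m : ℕ} {M : FpScheme p} {K : Submod M V}

open Submod Matrix

theorem IsPeriodSpace.hom_ext (hK : IsPeriodSpace B (m + 1) M K) {T : FpScheme p} {f g : T ⟶ M}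
    (h : K.pullback f = K.pullback g) : f = g :=
  (hK.existsUnique T (K.pullback g) (hK.isCharacteristic.pullback g)).unique h rfl

namespace Chart

variable (C : Chart B m)

/-- The morphism from the scheme of a chart to a period space. -/
def toPeriod (hK : IsPeriodSpace B (m + 1) M K) (hp : 3 ≤ p) : chartScheme p m ⟶ M :=
  (hK.existsUnique _ _ (C.isCharacteristic hp)).choose

variable (hK : IsPeriodSpace B (m + 1) M K) (hp : 3 ≤ p)


theorem pullback_toPeriod : K.pullback (C.toPeriod hK hp) = C.submod :=
  (hK.existsUnique _ _ (C.isCharacteristic hp)).choose_spec.1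

theorem toPeriod_factors : ∃ (k : chartScheme p m ⟶ C.dom K) (_ : IsIso k),
    k ≫ C.domι K = C.toPeriod hK hp := by
  have h3 (x) : (C.toPeriod hK hp).left x ∈ graphDomain C.b K :=
    C.mem_graphDomain_of_pullback_eq (h := 𝟙 _) hK.isCharacteristic
      (by rw [C.pullback_toPeriod hK hp, pullback_id]) x
  have h4 : Set.range (C.toPeriod hK hp).left ⊆ Set.range (graphDomain C.b K).ι := by
    rw [Scheme.Opens.range_ι]
    rintro _ ⟨x, rfl⟩
    exact h3 x
  let k₀ : (chartScheme p m).left ⟶ (graphDomain C.b K).toScheme :=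
    IsOpenImmersion.lift (graphDomain C.b K).ι (C.toPeriod hK hp).left h4
  have hk₀ : k₀ ≫ (graphDomain C.b K).ι = (C.toPeriod hK hp).left :=
    IsOpenImmersion.lift_fac _ _ _
  let k : chartScheme p m ⟶ C.dom K := Over.homMk k₀ (hom_spec_zmod_ext _ _)
  have hk : k ≫ C.domι K = C.toPeriod hK hp := by
    apply Over.OverMorphism.ext
    exact hk₀
  obtain ⟨h, hh⟩ := C.exists_dom_hom hp hK.isCharacteristic
  have : Mono (C.domι K) := by
    have : Mono (C.domι K).left := inferInstanceAs (Mono (graphDomain C.b K).ι)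
    exact Over.mono_of_mono_left _
  refine ⟨k, ⟨h, ?_, ?_⟩, hk⟩
  · refine C.hom_ext hp ?_
    rw [pullback_comp, hh, ← pullback_comp, hk, pullback_toPeriod, pullback_id]
  · rw [← cancel_mono (C.domι K), Category.assoc, hk, Category.id_comp]
    refine hK.hom_ext ?_
    rw [pullback_comp, pullback_toPeriod, hh]

instance : IsOpenImmersion (C.toPeriod hK hp).left := by
  obtain ⟨k, _, hk⟩ := C.toPeriod_factors hK hp
  have : IsOpenImmersion (C.domι K).left := inferInstanceAs (IsOpenImmersion (graphDomain C.b K).ι)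
  have : IsIso k.left := inferInstanceAs (IsIso ((Over.forget _).map k))
  have h1 : IsOpenImmersion k.left := inferInstance
  rw [← hk]
  exact IsOpenImmersion.comp k.left (C.domι K).left

/-- The structure morphism of the scheme of a chart over `𝔽_{p²}`. -/
def hom_fpSq (m : ℕ) : (chartScheme p m).left ⟶ Spec (CommRingCat.of (GaloisField p 2)) :=
  Spec.map (CommRingCat.ofHom (algebraMap (GaloisField p 2) (ChartRing p (GaloisField p 2) m)))

/-- The morphism from the scheme of a chart to the base change of a period space. -/
def toBaseChange : (chartScheme p m).left ⟶ baseChangeFpSq M :=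
  Limits.pullback.lift (C.toPeriod hK hp).left (hom_fpSq m) (hom_spec_zmod_ext _ _)

theorem toBaseChange_hom : C.toBaseChange hK hp ≫ baseChangeFpSqHom M = hom_fpSq m :=
  Limits.pullback.lift_snd _ _ _

instance : Etale (Spec.map (CommRingCat.ofHom (algebraMap (ZMod p) (GaloisField p 2)))) := by
  rw [HasRingHomProperty.Spec_iff (P := @Etale)]
  change (algebraMap (ZMod p) (GaloisField p 2)).Etale
  refine RingHom.etale_algebraMap.2 ?_
  have := Algebra.FormallyEtale.of_isSeparable (ZMod p) (GaloisField p 2)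
  have : Algebra.FinitePresentation (ZMod p) (GaloisField p 2) :=
    Algebra.FinitePresentation.of_finiteType.1 inferInstance
  exact Algebra.Etale.mk

instance : IsOpenImmersion (C.toBaseChange hK hp) := by
  have h1 : C.toBaseChange hK hp ≫ Limits.pullback.fst _ _ = (C.toPeriod hK hp).left :=
    Limits.pullback.lift_fst _ _ _
  have h2 : Etale (C.toBaseChange hK hp ≫ Limits.pullback.fst _ _) := by
    rw [h1]
    infer_instance
  have h3 : Etale (C.toBaseChange hK hp) := .of_comp _ (Limits.pullback.fst _ _)
  have h4 : Mono (C.toBaseChange hK hp) := by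
    have : Mono (C.toBaseChange hK hp ≫ Limits.pullback.fst _ _) := by
      rw [h1]
      infer_instance
    exact mono_of_mono _ (Limits.pullback.fst _ _)
  exact .of_flat_of_mono _

/-- The chart with the other square root. -/
def neg : Chart B m := ⟨C.c, C.d, C.b, C.isAdapted, -C.θ, by rw [neg_sq, C.θ_sq]⟩

end Chart

/-- The base change of a period space is covered by the charts. -/
theorem exists_mem_range_toBaseChange (hK : IsPeriodSpace B (m + 1) M K) (hp : 3 ≤ p)
    (hdim : Module.finrank (ZMod p) V = 2 * (m + 1)) (hsymm : B.IsSymm) (hnondeg : B.Nondegenerate)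
    (hnonneutral : ¬ IsNeutral B (m + 1)) (x : baseChangeFpSq M) :
    ∃ C : Chart B m, x ∈ Set.range (C.toBaseChange hK hp) := by
  let i := (baseChangeFpSq M).fromSpecResidueField x
  let q : baseChangeFpSq M ⟶ M.left := Limits.pullback.fst _ _
  let T : FpScheme p := Over.mk (i ≫ q ≫ M.hom)
  let t : T ⟶ M := Over.homMk (i ≫ q) (by simp [T])
  let ψ : GaloisField p 2 →+* Γ(T.left, ⊤) :=
    (i ≫ baseChangeFpSqHom M).appTop.hom.comp
      (Scheme.ΓSpecIso (CommRingCat.of (GaloisField p 2))).inv.hom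
  obtain ⟨C, hC⟩ := exists_mem_graphDomain hp hdim hsymm hnondeg hnonneutral hK.isCharacteristic
    (q x)
  obtain ⟨A, H⟩ : ∃ A, IsGraphOn C.b (K.pullback t) ⊤ A := by
    obtain ⟨A, H⟩ := exists_isGraphOn_graphDomain (b := C.b) K
    refine ⟨_, (H.pullback (f := t)).restrict (W := ⊤) fun y _ ↦ ?_⟩
    have hy : i y = x := by
      have := Set.mem_range_self (f := i) y
      rwa [Scheme.range_fromSpecResidueField] at this
    change q (i y) ∈ graphDomain C.b K
    rwa [hy]
  have hchar := hK.isCharacteristic.pullback t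
  have hA := ((H.isCharacteristic_iff hp C.isAdapted).1 hchar).sq_eq
  have key (C' : Chart B m) (hb : C'.b = C.b) (h : ψ C'.θ = A none none) :
      x ∈ Set.range (C'.toBaseChange hK hp) := by
    rw [← hb] at H
    obtain ⟨f, hf, hfA⟩ := C'.exists_hom hp hchar H
    have h1 : f ≫ C'.toPeriod hK hp = t := hK.hom_ext (by
      rw [pullback_comp, C'.pullback_toPeriod hK hp, hf])
    have h2 : (chartPull f).comp (algebraMap _ _) = ψ :=
      galoisField_ringHom_ext C'.isAdapted.not_isSquare C'.θ_sq
        ((congr_fun₂ hfA none none).trans h.symm)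
    have h3 : f.left ≫ C'.toBaseChange hK hp = i := by
      refine Limits.pullback.hom_ext ?_ ?_
      · rw [Category.assoc, Chart.toBaseChange, Limits.pullback.lift_fst]
        exact congr_arg CommaMorphism.left h1
      · rw [Category.assoc, Chart.toBaseChange, Limits.pullback.lift_snd]
        refine ext_to_Spec (CommRingCat.hom_ext ?_)
        refine Eq.trans ?_ h2
        have h3 := Scheme.ΓSpecIso_inv_naturality (CommRingCat.ofHom
          (algebraMap (GaloisField p 2) (ChartRing p (GaloisField p 2) m)))
        exact congr(f.left.appTop.hom.comp ($h3).hom).symm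
    have hx : x ∈ Set.range i := by
      rw [Scheme.range_fromSpecResidueField]
      rfl
    obtain ⟨y, hy⟩ := hx
    exact ⟨f.left y, by rw [← Scheme.Hom.comp_apply, h3, hy]⟩
  have hψ : ψ C.θ ^ 2 = A none none ^ 2 := by
    rw [hA, ← map_pow, C.θ_sq]
    exact congr($(Subsingleton.elim (ψ.comp (algebraMap _ _)) (algebraMap (ZMod p) _)) C.d)
  have : IsDomain Γ(T.left, ⊤) :=
    inferInstanceAs (IsDomain Γ(Spec ((baseChangeFpSq M).residueField x), ⊤))
  obtain h | h := sq_eq_sq_iff_eq_or_eq_neg.1 hψ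
  · exact ⟨C, key C rfl h⟩
  · exact ⟨C.neg, key C.neg rfl (by rw [Chart.neg, map_neg, h, neg_neg])⟩

end PeriodCharts

end PeriodSpace

namespace PeriodSpace

/-! ## Unirationality -/

section Unirationality

/-- In a space which is covered by irreducible open subsets, the connected components are open and
irreducible. -/
theorem isOpen_isIrreducible_connectedComponent {X : Type*} [TopologicalSpace X]
    (H : ∀ x : X, ∃ U : Set X, IsOpen U ∧ x ∈ U ∧ IsIrreducible U) (x : X) :
    IsOpen (connectedComponent x) ∧ IsIrreducible (connectedComponent x) := by
  obtain ⟨U, hU, hxU, hirr⟩ := H x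
  have hopen : IsOpen (closure U) := by
    refine isOpen_iff_forall_mem_open.2 fun y hy ↦ ?_
    obtain ⟨W, hW, hyW, hWirr⟩ := H y
    refine ⟨W, ?_, hW, hyW⟩
    have h1 : (W ∩ U).Nonempty := mem_closure_iff.1 hy W hW hyW
    exact (subset_closure_inter_of_isPreirreducible_of_isOpen hWirr.isPreirreducible hU h1).trans
      (closure_mono Set.inter_subset_right)
  have heq : connectedComponent x = closure U :=
    (IsClopen.connectedComponent_subset ⟨isClosed_closure, hopen⟩ (subset_closure hxU)).antisymm
      (hirr.closure.isConnected.isPreconnected.subset_connectedComponent (subset_closure hxU))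
  rw [heq]
  exact ⟨hopen, hirr.closure⟩

/-- The function field of an integral scheme is the fraction field of the ring of functions of an
affine open subscheme. -/
theorem exists_ringHom_functionField {X : Scheme.{0}} [IsIntegral X] {R : CommRingCat.{0}}
    [IsDomain R] (j : Spec R ⟶ X) [IsOpenImmersion j] :
    ∃ ρ : R ⟶ X.functionField,
      (letI := ρ.hom.toAlgebra; IsFractionRing R X.functionField) ∧
        Spec.map ρ ≫ j = X.fromSpecStalk (genericPoint X) := by
  have h : j (genericPoint (Spec R)) = genericPoint X := genericPoint_eq_of_isOpenImmersion j
  let e : X.functionField ≅ (Spec R).functionField :=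
    X.presheaf.stalkCongr (.of_eq h.symm) ≪≫ asIso (j.stalkMap (genericPoint (Spec R)))
  have he : Spec.map e.hom ≫ X.fromSpecStalk (genericPoint X) =
      (Spec R).fromSpecStalk (genericPoint (Spec R)) ≫ j := by
    rw [← Scheme.SpecMap_stalkMap_fromSpecStalk, Iso.trans_hom, Spec.map_comp, Category.assoc]
    congr 1
    exact Scheme.SpecMap_stalkSpecializes_fromSpecStalk (specializes_of_eq h)
  refine ⟨CommRingCat.ofHom (algebraMap R (Spec R).functionField) ≫ e.inv, ?_, ?_⟩
  · let := (CommRingCat.ofHom (algebraMap R (Spec R).functionField) ≫ e.inv).hom.toAlgebra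
    let e' : (Spec R).functionField ≃ₐ[R] X.functionField :=
      AlgEquiv.ofRingEquiv (f := e.symm.commRingCatIsoToRingEquiv) fun _ ↦ rfl
    exact IsLocalization.isLocalization_of_algEquiv (nonZeroDivisors R) e'
  · have h1 : Spec.map (CommRingCat.ofHom (algebraMap R (Spec R).functionField)) =
      (Spec R).fromSpecStalk (genericPoint (Spec R)) := (_root_.AlgebraicGeometry.Spec.fromSpecStalk_eq' R _).symm
    rw [Spec.map_comp, Category.assoc, h1, ← he, ← Spec.map_comp_assoc, e.hom_inv_id, Spec.map_id,
      Category.id_comp]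

/-- A rational map whose restriction to the function field is given by an extension of function
fields is dominant. -/
theorem isDominant_of_fromFunctionField {X Y : Scheme.{0}} [IsIntegral X] [IsIntegral Y]
    (f : X ⤏ Y) {φ : Y.functionField ⟶ X.functionField}
    (h : f.fromFunctionField = Spec.map φ ≫ Y.fromSpecStalk (genericPoint Y)) :
    f.IsDominant := by
  obtain ⟨f, rfl⟩ := f.exists_rep
  rw [Scheme.PartialMap.isDominant_toRationalMap_iff]
  refine ⟨?_⟩
  have hmem : genericPoint Y ∈ Set.range f.hom := by
    let z : Spec X.functionField := genericPoint _
    have h0 : Spec.map φ z = IsLocalRing.closedPoint Y.functionField :=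
      Subsingleton.elim (α := PrimeSpectrum Y.functionField) _ _
    have h1 : (Spec.map φ ≫ Y.fromSpecStalk (genericPoint Y)) z = genericPoint Y := by
      rw [Scheme.Hom.comp_apply, h0, Scheme.fromSpecStalk_closedPoint]
    rw [← h1, ← h]
    exact ⟨_, (Scheme.Hom.comp_apply _ _ _).symm⟩
  have h2 : Dense ({genericPoint Y} : Set Y) := fun y ↦ by
    rw [(genericPoint_spec Y).def]
    trivial
  exact h2.mono (Set.singleton_subset_iff.2 hmem)

variable {p : ℕ} [Fact p.Prime] {k : Type} [Field k] [CharP k p] {m : ℕ}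

theorem isPurelyInseparablyUnirational_of_chart (hk : ∀ c : k, c ^ p ^ 2 = c) {X : Scheme.{0}}
    (sX : X ⟶ Spec (CommRingCat.of k)) [IsIntegral X] [LocallyOfFiniteType sX]
    (j : Spec (CommRingCat.of (ChartRing p k m)) ⟶ X) [IsOpenImmersion j]
    (hj : j ≫ sX = Spec.map (CommRingCat.ofHom (algebraMap k (ChartRing p k m)))) :
    IsPurelyInseparablyUnirational sX := by
  let : Algebra (ZMod p) k := ZMod.algebra k p
  have : IsDomain (CommRingCat.of (ChartRing p k m)) := inferInstanceAs (IsDomain (ChartRing p k m))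
  obtain ⟨ρ, hρ, hρ'⟩ := exists_ringHom_functionField j
  let A := 𝔸(Fin m; Spec (CommRingCat.of k))
  let i : Spec (CommRingCat.of (MvPolynomial (Fin m) k)) ⟶ A :=
    (AffineSpace.SpecIso (Fin m) (CommRingCat.of k)).inv
  have : IsIntegral A := inferInstance
  obtain ⟨τ, hτ, hτ'⟩ := exists_ringHom_functionField i
  let : Algebra (ChartRing p k m) X.functionField := ρ.hom.toAlgebra
  let : Algebra (MvPolynomial (Fin m) k) A.functionField := τ.hom.toAlgebra
  have : IsFractionRing (ChartRing p k m) X.functionField := hρ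
  have : IsFractionRing (MvPolynomial (Fin m) k) A.functionField := hτ
  obtain ⟨φ, hφ, hφ'⟩ := exists_isPurelyInseparable_ringHom (m := m) hk X.functionField
    A.functionField
  let φ' : X.functionField ⟶ A.functionField := CommRingCat.ofHom φ
  have hi : i ≫ (A ↘ Spec (CommRingCat.of k)) = Spec.map (CommRingCat.ofHom MvPolynomial.C) :=
    AffineSpace.SpecIso_inv_over (CommRingCat.of k)
  have h1 : CommRingCat.ofHom (algebraMap k (ChartRing p k m)) ≫ ρ ≫ φ' =
      CommRingCat.ofHom MvPolynomial.C ≫ τ := by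
    ext c
    exact hφ' c
  let g : Spec A.functionField ⟶ X := Spec.map φ' ≫ X.fromSpecStalk (genericPoint X)
  have hg : g ≫ sX = A.fromSpecStalk (genericPoint A) ≫ (A ↘ Spec (CommRingCat.of k)) := by
    rw [← hτ', Category.assoc (Spec.map τ), hi, ← Spec.map_comp, ← h1, Spec.map_comp, Spec.map_comp,
      ← hj, Category.assoc, Category.assoc, reassoc_of% hρ']
  let f := Scheme.RationalMap.equivFunctionField (A ↘ Spec (CommRingCat.of k)) sX ⟨g, hg⟩
  have hf : f.1.fromFunctionField = g :=
    Scheme.RationalMap.fromFunctionField_ofFunctionField _ _ _ _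
  exact ⟨inferInstance, m, f.1, f.2, isDominant_of_fromFunctionField f.1 hf,
    φ', hf, hφ⟩

end Unirationality

section Components

variable {p : ℕ} [Fact p.Prime] {V : Type*} [AddCommGroup V] [Module (ZMod p) V]
  [Module.Finite (ZMod p) V] {B : LinearMap.BilinForm (ZMod p) V} {m : ℕ} {M : FpScheme p}
  {K : Submod M V}

instance : AlgebraicGeometry.IsIntegral (chartScheme p m).left :=
  (affine_isIntegral_iff (CommRingCat.of (ChartRing p (GaloisField p 2) m))).2
    (inferInstanceAs (IsDomain (ChartRing p (GaloisField p 2) m)))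

instance : LocallyOfFiniteType (Chart.hom_fpSq (p := p) m) := by
  have h : Algebra.FiniteType (GaloisField p 2) (MvPolynomial (Pairs m)
      (MvPolynomial (Fin m) (GaloisField p 2))) :=
    .trans (S := MvPolynomial (Fin m) (GaloisField p 2)) inferInstance inferInstance
  have h' : Algebra.FiniteType (GaloisField p 2) (ChartRing p (GaloisField p 2) m) :=
    h.of_surjective (Ideal.Quotient.mkₐ _ _) (Ideal.Quotient.mkₐ_surjective _ _)
  exact (HasRingHomProperty.Spec_iff (P := @LocallyOfFiniteType)
    (φ := CommRingCat.ofHom (algebraMap (GaloisField p 2) (ChartRing p (GaloisField p 2) m)))).2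
    (RingHom.finiteType_algebraMap.2 h')

/-- The connected components of the base change of a period space are open and purely inseparably
unirational. -/
theorem exists_isPurelyInseparablyUnirational (hK : IsPeriodSpace B (m + 1) M K) (hp : 3 ≤ p)
    (hdim : Module.finrank (ZMod p) V = 2 * (m + 1)) (hsymm : B.IsSymm) (hnondeg : B.Nondegenerate)
    (hnonneutral : ¬ IsNeutral B (m + 1)) (x : baseChangeFpSq M) :
    ∃ C : (baseChangeFpSq M).Opens, (C : Set (baseChangeFpSq M)) = connectedComponent x ∧
      IsPurelyInseparablyUnirational (C.ι ≫ baseChangeFpSqHom M) := by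
  choose Ch hCh using exists_mem_range_toBaseChange hK hp hdim hsymm hnondeg hnonneutral
  let j (y : baseChangeFpSq M) : (chartScheme p m).left ⟶ baseChangeFpSq M :=
    (Ch y).toBaseChange hK hp
  have hj (y) : IsOpenImmersion (j y) := inferInstanceAs (IsOpenImmersion (Chart.toBaseChange ..))
  let 𝓤 : (baseChangeFpSq M).OpenCover :=
    Scheme.Cover.mkOfCovers (baseChangeFpSq M) (fun _ ↦ (chartScheme p m).left) j
      (fun y ↦ ⟨y, hCh y⟩) hj
  have hred : IsReduced (baseChangeFpSq M) := (IsReduced.iff_of_openCover _ 𝓤).2 fun _ ↦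
    inferInstanceAs (IsReduced (chartScheme p m).left)
  have hft : LocallyOfFiniteType (baseChangeFpSqHom M) := by
    have : IsZariskiLocalAtSource @LocallyOfFiniteType.{0} :=
      HasRingHomProperty.instIsZariskiLocalAtSource (Q := RingHom.FiniteType)
    refine (IsZariskiLocalAtSource.iff_of_openCover (P := @LocallyOfFiniteType.{0}) 𝓤).2 ?_
    intro y
    change LocallyOfFiniteType ((Ch y).toBaseChange hK hp ≫ baseChangeFpSqHom M)
    rw [Chart.toBaseChange_hom]
    infer_instance
  have hirr (y) : IsIrreducible (Set.range (j y)) := by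
    rw [← Set.image_univ]
    exact (IrreducibleSpace.isIrreducible_univ _).image _ (j y).continuous.continuousOn
  obtain ⟨hopen, hC⟩ := isOpen_isIrreducible_connectedComponent
    (fun y ↦ ⟨_, (j y).isOpenEmbedding.isOpen_range, hCh y, hirr y⟩) x
  let C : (baseChangeFpSq M).Opens := ⟨connectedComponent x, hopen⟩
  have hCirr : IrreducibleSpace C.toScheme := Subtype.irreducibleSpace hC
  have hCint : AlgebraicGeometry.IsIntegral C.toScheme :=
    isIntegral_of_irreducibleSpace_of_isReduced _
  have hsub : Set.range (j x) ⊆ Set.range C.ι := by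
    rw [Scheme.Opens.range_ι]
    exact (hirr x).isConnected.isPreconnected.subset_connectedComponent (hCh x)
  let j' : Spec (CommRingCat.of (ChartRing p (GaloisField p 2) m)) ⟶ C.toScheme :=
    IsOpenImmersion.lift C.ι (j x) hsub
  have hj' : j' ≫ C.ι = j x := IsOpenImmersion.lift_fac _ _ _
  have : IsOpenImmersion (j' ≫ C.ι) := hj' ▸ hj x
  have hj'o : IsOpenImmersion j' := .of_comp j' C.ι
  refine ⟨C, rfl, isPurelyInseparablyUnirational_of_chart galoisField_pow _ j' ?_⟩
  rw [reassoc_of% hj']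
  exact (Ch x).toBaseChange_hom hK hp

end Components

end PeriodSpace

end

theorem mainTheorem10 (p : ℕ) [Fact p.Prime] (hp : 3 ≤ p) (σ : ℕ)
    {V : Type*} [AddCommGroup V] [Module (ZMod p) V] [Module.Finite (ZMod p) V]
    (hdim : Module.finrank (ZMod p) V = 2 * σ)
    (B : LinearMap.BilinForm (ZMod p) V) (hsymm : B.IsSymm) (hnondeg : B.Nondegenerate)
    (hnonneutral : ¬ PeriodSpace.IsNeutral B σ) :
    (∃ (M : PeriodSpace.FpScheme p) (K : PeriodSpace.Submod M V),
      PeriodSpace.IsPeriodSpace B σ M K) ∧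
    ∀ (M : PeriodSpace.FpScheme p) (K : PeriodSpace.Submod M V),
      PeriodSpace.IsPeriodSpace B σ M K →
      ∀ x : PeriodSpace.baseChangeFpSq M,
        ∃ C : (PeriodSpace.baseChangeFpSq M).Opens,
          (C : Set (PeriodSpace.baseChangeFpSq M)) = connectedComponent x ∧
          PeriodSpace.IsPurelyInseparablyUnirational
            (C.ι ≫ PeriodSpace.baseChangeFpSqHom M) := by
  obtain _ | m := σ
  · exact absurd ⟨⊥, by simp, by simp⟩ hnonneutral
  · exact ⟨PeriodSpace.exists_isPeriodSpace hp hdim hsymm hnondeg hnonneutral,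
      fun M K hK ↦ PeriodSpace.exists_isPurelyInseparablyUnirational hK hp hdim hsymm hnondeg
        hnonneutral⟩
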